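/- Let $d\in\{1,2\}$, $L,T>0$, $D=(0,L)^d$, let $q\ge 3$ be an odd integer, $p\ge 2$ real and $\sigma>0$. Let $H^1_0(D)$ be the closure of $C_c^\infty(D)$ in the norm $\|v\|_{H^1}=(\|v\|_{L^2}^2+\|\nabla v\|_{L^2}^2)^{1/2}$, and write $(\cdot,\cdot)$ for the $L^2(D)$ inner products. Let $W$ be a real Wiener process with respect to a filtration $(\mathcal F_t)_{t\ge0}$ on a probability space, and let $u_0$ be an $\mathcal F_0$-measurable $H^1_0(D)$-valued random variable with $\mathbb E\|u_0\|_{H^1}^p<\infty$. Let $G:H^1_0(D)\to H^1_0(D)$ be twice Gateaux differentiable with derivatives $DG$, $D^2G$, and suppose that there is a constant $C_G$ such that, with $\|\cdot\|=\|\cdot\|_{H^1}$ (operator norms for $DG$, $D^2G$), for all $v,w\in H^1_0(D)$: (A1) $\|G(v)-G(w)\|\le C_G\|v-w\|$ and $\|G(v)\|\le C_G(\|v\|+1)$; (A2) $\sup_u\|DG(u)\|+\sup_u\|D^2G(u)\|\le C_G$; (A3) $\|(DG(v)-DG(w))G(w)\|\le C_G\|v-w\|$. Let $\mathcal T_h$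 be a conforming finite triangulation of $\overline D$ into closed $d$-simplices, quasi-uniform with constant $\sigma$ (each simplex contains an open ball of radius $h/\sigma$, where $h$ is the largest diameter of a simplex of $\mathcal T_h$), that satisfies the mesh assumption: if $d=2$, then for each edge $E$ of $\mathcal T_h$ not contained in $\partial D$, $$\frac{1}{d(d-1)}\sum_{K\in\mathcal T_h,\,K\supset E}\cot\theta^K_E\ \ge\ 0,$$ where $\theta_E^K$ is the angle of the triangle $K$ opposite to $E$ (no condition if $d=1$). Let $V_h$ be the space of $v_h\in H^1_0(D)$ that are affine on each $K\in\mathcal T_h$, and let $I_hg=\sum_i g(a_i)\varphi_i$ be the nodal interpolant, where the $a_i$ are the vertices of $\mathcal T_h$ and $\varphi_i$ is the continuous piecewise affine function with $\varphi_i(a_j)=\delta_{ij}$. For $N\ge1$ put $\tau=T/N$, $t_n=n\tau$, $\Delta W_n=W(t_{n+1})-W(t_n)$. A solution of the fully discrete scheme is a sequence of $V_h$-valued random variables $u_h^0,\dots,u_h^N$, with $u_h^n$ being $\mathcal F_{t_n}$-measurable for $1\le n\le N$, such that almost surely $(u_h^0,v_h)=(u_0,v_h)$ for all $v_h\in V_h$,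 and, for $0\le n<N$, almost surely, for all $v_h\in V_h$, $$(u_h^{n+1}-u_h^n,v_h)+\tau(\nabla u_h^{n+1},\nabla v_h)=\tau\bigl(I_h(u_h^{n+1}-(u_h^{n+1})^q),v_h\bigr)+(G(u_h^n),v_h)\,\Delta W_n+\tfrac12\bigl(DG(u_h^n)G(u_h^n),v_h\bigr)\bigl[(\Delta W_n)^2-\tau\bigr].$$ Then there is a constant $C$, which may depend on $d,L,T,q,p,\sigma,G,u_0$ and the underlying stochastic basis, but not on $\mathcal T_h$, $h$, $N$ (that is, $\tau$) or the solution, such that for every such triangulation $\mathcal T_h$, every $N\ge1$ and every solution $(u_h^n)$ of the scheme, $$\sup_{0\le n\le N}\mathbb E\bigl[\|\nabla u_h^n\|_{L^2}^p\bigr]\le C .$$ -/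

import Mathlib

open MeasureTheory ProbabilityTheory
open scoped NNReal ENNReal

noncomputable section

namespace MilsteinFEM

/-- Euclidean `d`-space. -/
abbrev E (d : ℕ) : Type := EuclideanSpace ℝ (Fin d)

/-- The open box `D = (0, L)^d`. -/
def box (d : ℕ) (L : ℝ) : Set (E d) := {x | ∀ i, x i ∈ Set.Ioo 0 L}

/-! ### The space `H¹₀(D)` -/

/-- `L²(D; F)`. -/
abbrev L2 {d : ℕ} (D : Set (E d)) (F : Type) [NormedAddCommGroup F] : Type :=
  Lp F 2 (volume.restrict D)

/-- Pairs `(u, w) ∈ L²(D) × L²(D; ℝᵈ)` with the norm `(‖u‖² + ‖w‖²)^{1/2}`. -/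
abbrev L2Pair {d : ℕ} (D : Set (E d)) : Type := WithLp 2 (L2 D ℝ × L2 D (E d))

/-- The pairs `(φ, ∇φ)` with `φ ∈ C_c^∞(D)`. -/
def testPairs {d : ℕ} (D : Set (E d)) : Set (L2Pair D) :=
  {z | ∃ φ : E d → ℝ, ContDiff ℝ ((⊤ : ℕ∞) : WithTop ℕ∞) φ ∧ HasCompactSupport φ ∧ tsupport φ ⊆ D ∧
    z.fst =ᵐ[volume.restrict D] φ ∧ z.snd =ᵐ[volume.restrict D] fun x => gradient φ x}

/-- `H¹₀(D)`: the closure of `C_c^∞(D)` in the full `H¹` norm. An element is a pair `(u, ∇u)`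
consisting of a function and its weak gradient; the norm is `(‖u‖² + ‖∇u‖²)^{1/2}`. -/
def H10 {d : ℕ} (D : Set (E d)) : Submodule ℝ (L2Pair D) :=
  (Submodule.span ℝ (testPairs D)).topologicalClosure

/-- The element of `L²(D)` underlying `u ∈ H¹₀(D)`. -/
def fn {d : ℕ} {D : Set (E d)} (u : H10 D) : L2 D ℝ := u.1.fst

/-- The weak gradient of `u ∈ H¹₀(D)`; `‖grad u‖` is its `L²(D)` norm. -/
def grad {d : ℕ} {D : Set (E d)} (u : H10 D) : L2 D (E d) := u.1.snd

/-! ### Triangulations -/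

/-- The simplices of full dimension of a simplicial complex in `ℝᵈ`. -/
def cells {d : ℕ} (𝒯 : Geometry.SimplicialComplex ℝ (E d)) : Set (Finset (E d)) :=
  {K | K ∈ 𝒯.faces ∧ K.card = d + 1}

/-- `𝒯` is a (finite, conforming) triangulation of `D` into `d`-simplices. -/
structure IsTriangulation {d : ℕ} (𝒯 : Geometry.SimplicialComplex ℝ (E d)) (D : Set (E d)) :
    Prop where
  finite : 𝒯.faces.Finite
  pure : ∀ s ∈ 𝒯.faces, ∃ K ∈ cells 𝒯, s ⊆ K
  space_eq : 𝒯.space = closure D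

/-- Quasi-uniformity with constant `σ`: every cell contains a ball whose radius is at least
`h / σ`, where `h` is the largest diameter of a cell. -/
def QuasiUniform {d : ℕ} (𝒯 : Geometry.SimplicialComplex ℝ (E d)) (σ : ℝ) : Prop :=
  ∀ K ∈ cells 𝒯, ∀ K' ∈ cells 𝒯, ∃ c : E d,
    Metric.ball c (Metric.diam (convexHull ℝ (K' : Set (E d))) / σ) ⊆ convexHull ℝ (K : Set (E d))

open Classical in
/-- The mesh assumption `1/(d(d-1)) ∑_{K ⊃ E} |κ_E^K| cot θ_E^K ≥ 0` for every edge `E = {a, b}`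
that does not lie on the boundary, in dimension `d = 2`: if `c` is the third vertex of the triangle
`K ⊃ {a, b}`, then `κ_E^K = {c}`, `|κ_E^K| = 1`, and `θ_E^K` is the angle of `K` at `c`.
In dimension `d = 1` there is no vertex `c`, and the condition is empty. -/
def MeshAssumption {d : ℕ} (𝒯 : Geometry.SimplicialComplex ℝ (E d)) (D : Set (E d)) : Prop :=
  ∀ a b : E d, a ≠ b → {a, b} ∈ 𝒯.faces → ¬ segment ℝ a b ⊆ frontier D →
    0 ≤ 1 / ((d : ℝ) * ((d : ℝ) - 1)) *
      ∑ᶠ K ∈ {K | K ∈ cells 𝒯 ∧ a ∈ K ∧ b ∈ K},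
        ∑ c ∈ K \ {a, b}, Real.cot (EuclideanGeometry.angle a c b)

/-! ### The `P₁` Lagrange finite element space -/

/-- `v` represents `u ∈ H¹₀(D)` as a finite element function: it is affine on each closed cell
(which makes it continuous on `D̄`), vanishes on `∂D`, and equals `u` almost everywhere. -/
def IsFERep {d : ℕ} {D : Set (E d)} (𝒯 : Geometry.SimplicialComplex ℝ (E d)) (u : H10 D)
    (v : E d → ℝ) : Prop :=
  (∀ K ∈ cells 𝒯, ∃ ℓ : E d →ᵃ[ℝ] ℝ, Set.EqOn v ℓ (convexHull ℝ (K : Set (E d)))) ∧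
    (∀ x ∈ frontier D, v x = 0) ∧ fn u =ᵐ[volume.restrict D] v

/-- `V_h`: the elements of `H¹₀(D)` that are piecewise affine on the triangulation. -/
def Vh {d : ℕ} (D : Set (E d)) (𝒯 : Geometry.SimplicialComplex ℝ (E d)) :
    Submodule ℝ (H10 D) where
  carrier := {u | ∃ v, IsFERep 𝒯 u v}
  zero_mem' := ⟨0, fun _ _ => ⟨0, fun _ _ => rfl⟩, fun _ _ => rfl, Lp.coeFn_zero ℝ 2 _⟩
  add_mem' := by
    rintro u u' ⟨v, hv, hb, he⟩ ⟨v', hv', hb', he'⟩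
    refine ⟨v + v', fun K hK => ?_, fun x hx => ?_, ?_⟩
    · obtain ⟨ℓ, hℓ⟩ := hv K hK
      obtain ⟨ℓ', hℓ'⟩ := hv' K hK
      exact ⟨ℓ + ℓ', fun x hx => by simp [hℓ hx, hℓ' hx]⟩
    · simp [hb x hx, hb' x hx]
    · exact (Lp.coeFn_add (fn u) (fn u')).trans (he.add he')
  smul_mem' := by
    rintro r u ⟨v, hv, hb, he⟩
    refine ⟨r • v, fun K hK => ?_, fun x hx => ?_, ?_⟩
    · obtain ⟨ℓ, hℓ⟩ := hv K hK
      exact ⟨r • ℓ, fun x hx => by simp [hℓ hx]⟩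
    · simp [hb x hx]
    · exact (Lp.coeFn_smul r (fn u)).trans (he.const_smul r)

/-- The continuous, piecewise affine representative of `u ∈ V_h`. -/
def rep {d : ℕ} {D : Set (E d)} {𝒯 : Geometry.SimplicialComplex ℝ (E d)} (u : Vh D 𝒯) :
    E d → ℝ := Classical.choose u.2

/-- `w` gives the barycentric coordinates of the point `x` with respect to the vertices of `𝒯`:
it is supported in the vertices of a simplex that contains `x`. -/
def IsBarycentric {d : ℕ} (𝒯 : Geometry.SimplicialComplex ℝ (E d)) (x : E d) (w : E d → ℝ) :
    Prop :=
  ∃ K ∈ 𝒯.faces, (∀ y, y ∉ K → w y = 0) ∧ (∀ y, 0 ≤ w y) ∧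
    ∑ y ∈ K, w y = 1 ∧ ∑ y ∈ K, w y • y = x

open Classical in
/-- The nodal basis function of the vertex `a`: at `x`, the barycentric coordinate of `x` that
belongs to `a`. -/
def hat {d : ℕ} (𝒯 : Geometry.SimplicialComplex ℝ (E d)) (a x : E d) : ℝ :=
  if h : ∃ w, IsBarycentric 𝒯 x w then Classical.choose h a else 0

/-- The nodal interpolant `I_h g = ∑ g(a_i) φ_i`, a sum over all vertices of `𝒯`. -/
def interp {d : ℕ} (𝒯 : Geometry.SimplicialComplex ℝ (E d)) (g : E d → ℝ) (x : E d) : ℝ :=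
  ∑ᶠ a ∈ {a : E d | {a} ∈ 𝒯.faces}, g a * hat 𝒯 a x

/-! ### The noise -/

/-- Assumptions (A1), (A2), (A3) on the diffusion map `G : H → H`, with Gateaux derivative `DG`. -/
structure DiffusionAssumptions {H : Type} [NormedAddCommGroup H] [NormedSpace ℝ H]
    (G : H → H) (DG : H → H →L[ℝ] H) : Prop where
  lipschitz : ∃ C : ℝ, ∀ v w, ‖G v - G w‖ ≤ C * ‖v - w‖
  growth : ∃ C : ℝ, ∀ v, ‖G v‖ ≤ C * (‖v‖ + 1)
  gateaux : ∀ u v, HasLineDerivAt ℝ G (DG u v) u v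
  bounded : ∃ (C : ℝ) (D2G : H → H →L[ℝ] H →L[ℝ] H),
    (∀ u v, HasLineDerivAt ℝ DG (D2G u v) u v) ∧ ∀ u u', ‖DG u‖ + ‖D2G u'‖ ≤ C
  commutator : ∃ C : ℝ, ∀ u v, ‖(DG u - DG v) (G v)‖ ≤ C * ‖u - v‖

/-- `W` is a real Wiener process with respect to the filtration `ℱ`. -/
structure IsWiener {Ω : Type*} {mΩ : MeasurableSpace Ω} (P : Measure Ω)
    (ℱ : Filtration ℝ≥0 mΩ) (W : ℝ≥0 → Ω → ℝ) : Prop where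
  brownian : IsBrownianReal W P
  adapted : StronglyAdapted ℱ W
  indep : ∀ s t, s ≤ t →
    Indep (ℱ s) (MeasurableSpace.comap (fun ω => W t ω - W s ω) inferInstance) P

/-! ### The fully discrete scheme -/

/-- The time step `τ = T / N`. -/
def step (T : ℝ≥0) (N : ℕ) : ℝ≥0 := T / N

/-- The increment `ΔW_n = W(t_{n+1}) - W(t_n)`, with `t_n = n τ`. -/
def incr {Ω : Type*} (W : ℝ≥0 → Ω → ℝ) (T : ℝ≥0) (N n : ℕ) (ω : Ω) : ℝ :=
  W ((n + 1 : ℕ) * step T N) ω - W (n * step T N) ω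

/-- `u_h^0, …, u_h^N` is a solution of the Milstein finite element scheme with `F(u) = u - u^q`. -/
structure IsDiscreteSolution {d : ℕ} {D : Set (E d)} {Ω : Type*} {mΩ : MeasurableSpace Ω}
    (P : Measure Ω) (ℱ : Filtration ℝ≥0 mΩ) (W : ℝ≥0 → Ω → ℝ)
    (G : H10 D → H10 D) (DG : H10 D → H10 D →L[ℝ] H10 D) (u₀ : Ω → H10 D) (q : ℕ)
    (T : ℝ≥0) (𝒯 : Geometry.SimplicialComplex ℝ (E d)) (N : ℕ) (u : ℕ → Ω → Vh D 𝒯) : Prop where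
  /-- `u_h^n` is `ℱ_{t_n}`-measurable for `1 ≤ n ≤ N`. -/
  adapted : ∀ n, 1 ≤ n → n ≤ N → StronglyMeasurable[ℱ (n * step T N)] (u n)
  /-- `u_h^0 = P_h u_0`. -/
  initial : ∀ᵐ ω ∂P, ∀ v : Vh D 𝒯,
    inner ℝ (fn (u 0 ω : H10 D)) (fn (v : H10 D)) = inner ℝ (fn (u₀ ω)) (fn (v : H10 D))
  scheme : ∀ n < N, ∀ᵐ ω ∂P, ∀ v : Vh D 𝒯,
    inner ℝ (fn (u (n + 1) ω - u n ω : H10 D)) (fn (v : H10 D))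
      + (step T N : ℝ) * inner ℝ (grad (u (n + 1) ω : H10 D)) (grad (v : H10 D))
    = (step T N : ℝ) * (∫ x in D,
          interp 𝒯 (fun y => rep (u (n + 1) ω) y - rep (u (n + 1) ω) y ^ q) x
            * fn (v : H10 D) x)
      + inner ℝ (fn (G (u n ω))) (fn (v : H10 D)) * incr W T N n ω
      + 1 / 2 * inner ℝ (fn (DG (u n ω) (G (u n ω)))) (fn (v : H10 D))
          * (incr W T N n ω ^ 2 - (step T N : ℝ))

end MilsteinFEM

end

/-!
The `p`-th moment of `‖∇ u_h^n‖` is bounded through the energy `Z_n = 1 + ‖∇ u_h^n‖ ^ 2`, by an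
estimate for one time step followed by a discrete Gronwall argument.

*Deterministic part.* One step of the scheme reads, for all `v ∈ V_h`,
`(x - y, v) + τ (∇x, ∇v) = τ (I_h (x - x ^ q), v)`, where `x = u_h^{n+1}` and `y` is `u_h^n` plus
the `L²` projection `P_h` of the noise. Testing with the discrete Laplacian of `x` gives
`‖∇x‖ ^ 2 ≤ ‖∇y‖ ^ 2 + B τ` for every `τ`, provided that `(∇ I_h x ^ q, ∇x)` absorbs `‖x‖ ^ 2`
(`exists_dissipativity`, `exists_step_bound`). It does so because, by the cotangent formula, the
mesh assumption makes the stiffness matrix entries of all interior edges nonpositive; the discrete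
Dirichlet form is therefore monotone under nodal inequalities (`dirichlet_mono`), and the
Stroock–Varopoulos inequality bounds `(∇ I_h x ^ q, ∇x)` below by a multiple of
`‖∇ I_h x ^ ((q + 1) / 2)‖ ^ 2`.

*Stability of `P_h` in `H¹`*, uniformly over quasi-uniform meshes (`IsL2Proj.norm_grad_sq_le`). A
quasi-interpolant takes as nodal values averages over balls of radius `h`, whose centres are moved
outside the box for boundary vertices. Its error and its gradient are controlled by the translates
of the function, and an inverse estimate transfers the bound to `P_h`. That continuous piecewise
affine functions with zero boundary values do lie in `H¹₀`, the closure of the test functions, is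
shown by dilation and mollification (`IsPL.exists_H10`).

*Stochastic part.* Since the noise coefficients grow at most linearly,
`Z_{n+1} ≤ Z_n (1 + Y)`, where `Y = α ξ + β (ξ ^ 2 - τ) + A (ξ ^ 2 + (ξ ^ 2 - τ) ^ 2 + τ)` with
`ξ = ΔW_n` and bounded `ℱ_{t_n}`-measurable `α`, `β`. From
`(1 + y) ^ s ≤ 1 + s y + C y ^ 2 (1 + |y|) ^ k` for `y ≥ -1` and the independence of `ξ` from
`ℱ_{t_n}`, the terms linear in `α`, `β` drop out and
`E Z_{n+1} ^ (p/2) ≤ (1 + K τ) E Z_n ^ (p/2)` (`exists_moment_step`). The value `u_h^0` is only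
almost surely equal to `P_h u₀`, so it is replaced by the latter before the induction.
-/

namespace MilsteinFEM

/-! ### Translates of smooth functions -/

lemma sq_integral_le_integral_sq {α : Type*} {mα : MeasurableSpace α} (μ : Measure α)
    [IsProbabilityMeasure μ] {f : α → ℝ} (hf : Integrable f μ)
    (hf2 : Integrable (fun x => f x ^ 2) μ) : (∫ x, f x ∂μ) ^ 2 ≤ ∫ x, f x ^ 2 ∂μ := by
  have h : 0 ≤ ∫ x, (f x - ∫ y, f y ∂μ) ^ 2 ∂μ := integral_nonneg fun x => sq_nonneg _
  have h2 : ∫ x, (f x - ∫ y, f y ∂μ) ^ 2 ∂μ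
      = ∫ x, f x ^ 2 ∂μ - (∫ x, f x ∂μ) ^ 2 := by
    set m := ∫ y, f y ∂μ with hm
    have : ∀ x, (f x - m) ^ 2 = f x ^ 2 - (2 * m * f x - m ^ 2) := fun x => by ring
    simp_rw [this]
    have i1 : Integrable (fun x => 2 * m * f x) μ := hf.const_mul _
    have i2 : Integrable (fun x => 2 * m * f x - m ^ 2) μ := i1.sub (integrable_const _)
    rw [integral_sub hf2 i2, integral_sub i1 (integrable_const _), integral_const_mul, ← hm]
    simp
    ring
  linarith

lemma norm_gradient {d : ℕ} (φ : E d → ℝ) (x : E d) : ‖gradient φ x‖ = ‖fderiv ℝ φ x‖ := by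
  simp [gradient]

lemma inner_gradient {d : ℕ} (φ : E d → ℝ) (x y : E d) :
    inner ℝ (gradient φ x) y = fderiv ℝ φ x y := by
  simp [gradient]

lemma continuous_gradient {d : ℕ} {φ : E d → ℝ} (hφ : ContDiff ℝ 1 φ) :
    Continuous (gradient φ) := by
  have := hφ.continuous_fderiv one_ne_zero
  exact (LinearIsometryEquiv.continuous _).comp this

lemma sq_sub_le_integral_gradient {d : ℕ} {φ : E d → ℝ} (hφ : ContDiff ℝ 1 φ) (x z : E d) :
    (φ (x + z) - φ x) ^ 2
      ≤ ‖z‖ ^ 2 * ∫ t in Set.Ioc (0 : ℝ) 1, ‖gradient φ (x + t • z)‖ ^ 2 := by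
  have hcg := continuous_gradient hφ
  have hline : Continuous fun t : ℝ => x + t • z := by fun_prop
  have hd : ∀ t : ℝ, HasDerivAt (fun t : ℝ => φ (x + t • z))
      (inner ℝ (gradient φ (x + t • z)) z) t := by
    intro t
    rw [inner_gradient]
    have h1 : HasFDerivAt φ (fderiv ℝ φ (x + t • z)) (x + t • z) :=
      (hφ.differentiable one_ne_zero _).hasFDerivAt
    have h2 : HasDerivAt (fun t : ℝ => x + t • z) z t := by
      simpa using ((hasDerivAt_id t).smul_const z).const_add x
    exact h1.comp_hasDerivAt t h2
  have hc : Continuous fun t : ℝ => (inner ℝ (gradient φ (x + t • z)) z : ℝ) :=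
    (hcg.comp hline).inner continuous_const
  have ftc := intervalIntegral.integral_eq_sub_of_hasDerivAt (a := 0) (b := 1)
    (fun t _ => hd t) (hc.intervalIntegrable _ _)
  simp only [one_smul, zero_smul, add_zero] at ftc
  rw [← ftc, intervalIntegral.integral_of_le zero_le_one]
  have : IsProbabilityMeasure (volume.restrict (Set.Ioc (0 : ℝ) 1)) := ⟨by simp⟩
  have int : ∀ f : ℝ → ℝ, Continuous f → IntegrableOn f (Set.Ioc 0 1) := fun f hf =>
    (hf.integrableOn_Icc).mono_set Set.Ioc_subset_Icc_self
  refine (sq_integral_le_integral_sq _ (int _ hc) (int _ (hc.pow 2))).trans ?_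
  rw [← integral_const_mul]
  refine integral_mono (int _ (hc.pow 2)) (int _ (by fun_prop)) fun t => ?_
  have h := abs_real_inner_le_norm (gradient φ (x + t • z)) z
  calc _ = |(inner ℝ (gradient φ (x + t • z)) z : ℝ)| ^ 2 := (sq_abs _).symm
    _ ≤ (‖gradient φ (x + t • z)‖ * ‖z‖) ^ 2 := by gcongr
    _ = _ := by ring

lemma lintegral_translate_sub_le {d : ℕ} {φ : E d → ℝ} (hφ : ContDiff ℝ 1 φ) (z : E d) :
    ∫⁻ x, ENNReal.ofReal ((φ (x + z) - φ x) ^ 2)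
      ≤ ENNReal.ofReal (‖z‖ ^ 2) * ∫⁻ x, ENNReal.ofReal (‖gradient φ x‖ ^ 2) := by
  have hcg := continuous_gradient hφ
  have hpt : ∀ x, ENNReal.ofReal ((φ (x + z) - φ x) ^ 2) ≤ ENNReal.ofReal (‖z‖ ^ 2) *
      ∫⁻ t in Set.Ioc (0 : ℝ) 1, ENNReal.ofReal (‖gradient φ (x + t • z)‖ ^ 2) := by
    intro x
    refine (ENNReal.ofReal_le_ofReal (sq_sub_le_integral_gradient hφ x z)).trans ?_
    rw [ENNReal.ofReal_mul (by positivity), ofReal_integral_eq_lintegral_ofReal]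
    · have : Continuous fun t : ℝ => ‖gradient φ (x + t • z)‖ ^ 2 := by fun_prop
      exact (this.integrableOn_Icc).mono_set Set.Ioc_subset_Icc_self
    · exact Filter.Eventually.of_forall fun t => by positivity
  refine (lintegral_mono hpt).trans ?_
  rw [lintegral_const_mul' _ _ ENNReal.ofReal_ne_top]
  refine mul_le_mul' le_rfl ?_
  rw [lintegral_lintegral_swap]
  · have : ∀ t : ℝ, ∫⁻ x : E d, ENNReal.ofReal (‖gradient φ (x + t • z)‖ ^ 2)
        = ∫⁻ x, ENNReal.ofReal (‖gradient φ x‖ ^ 2) := fun t =>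
      lintegral_add_right_eq_self (fun x => ENNReal.ofReal (‖gradient φ x‖ ^ 2)) (t • z)
    simp_rw [this]
    rw [lintegral_const]
    simp
  · have : Continuous fun p : E d × ℝ => ‖gradient φ (p.1 + p.2 • z)‖ ^ 2 := by fun_prop
    exact (ENNReal.continuous_ofReal.comp this).aemeasurable

lemma integrable_gradient_sq {d : ℕ} {φ : E d → ℝ} (hφ : ContDiff ℝ 1 φ)
    (hs : HasCompactSupport φ) : Integrable fun x => ‖gradient φ x‖ ^ 2 := by
  refine Continuous.integrable_of_hasCompactSupport ((continuous_gradient hφ).norm.pow 2) ?_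
  have : HasCompactSupport (gradient φ) :=
    (hs.fderiv (𝕜 := ℝ)).comp_left (g := (InnerProductSpace.toDual ℝ (E d)).symm) (by simp)
  exact this.comp_left (g := fun v => ‖v‖ ^ 2) (by simp)

/-- The `L²` modulus of continuity of a smooth function is controlled by its gradient. -/
lemma integral_translate_sub_le {d : ℕ} {φ : E d → ℝ} (hφ : ContDiff ℝ 1 φ)
    (hs : HasCompactSupport φ) (z : E d) :
    ∫ x, (φ (x + z) - φ x) ^ 2 ≤ ‖z‖ ^ 2 * ∫ x, ‖gradient φ x‖ ^ 2 := by
  have h := lintegral_translate_sub_le hφ z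
  have hcφ := hφ.continuous
  rw [integral_eq_lintegral_of_nonneg_ae (.of_forall fun x => sq_nonneg _)
      (by exact Continuous.aestronglyMeasurable (by fun_prop)),
    integral_eq_lintegral_of_nonneg_ae (.of_forall fun x => by positivity)
      (integrable_gradient_sq hφ hs).aestronglyMeasurable]
  have hfin : ∫⁻ x, ENNReal.ofReal (‖gradient φ x‖ ^ 2) ≠ ∞ :=
    (integrable_gradient_sq hφ hs).lintegral_lt_top.ne
  calc _ ≤ _ := ENNReal.toReal_mono (ENNReal.mul_ne_top ENNReal.ofReal_ne_top hfin) h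
    _ = _ := by rw [ENNReal.toReal_mul, ENNReal.toReal_ofReal (by positivity)]

/-- Poincaré's inequality: the translate of `φ` by `L e_i` has a support disjoint from that
of `φ`, so that the bound on translates controls `φ` itself. -/
lemma poincare_testFunction {d : ℕ} (hd : 0 < d) {L : ℝ} {φ : E d → ℝ}
    (hφ : ContDiff ℝ 1 φ) (hs : HasCompactSupport φ) (hsub : tsupport φ ⊆ box d L) :
    ∫ x, φ x ^ 2 ≤ L ^ 2 * ∫ x, ‖gradient φ x‖ ^ 2 := by
  set z : E d := EuclideanSpace.single ⟨0, hd⟩ L with hz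
  have hnz : ‖z‖ ^ 2 = L ^ 2 := by simp [hz]
  have h := integral_translate_sub_le hφ hs z
  rw [hnz] at h
  refine le_trans ?_ h
  have hcφ := hφ.continuous
  have i1 : Integrable fun x => φ x ^ 2 :=
    Continuous.integrable_of_hasCompactSupport (by fun_prop)
      (hs.comp_left (g := fun v => v ^ 2) (by simp))
  have i2 : Integrable fun x => φ (x + z) ^ 2 := i1.comp_add_right z
  have hzero : ∀ x, φ x ≠ 0 → x ∈ box d L := fun x hx => hsub (subset_tsupport _ hx)
  have hprod : ∀ x, φ (x + z) * φ x = 0 := by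
    intro x
    by_contra hne
    have h1 := hzero _ (left_ne_zero_of_mul hne) ⟨0, hd⟩
    have h2 := hzero _ (right_ne_zero_of_mul hne) ⟨0, hd⟩
    simp [hz] at h1 h2
    linarith [h1.2, h2.1]
  have : ∀ x, (φ (x + z) - φ x) ^ 2 = φ (x + z) ^ 2 + φ x ^ 2 := fun x => by
    linear_combination (-2) * hprod x
  simp_rw [this]
  rw [integral_add i2 i1]
  linarith [integral_nonneg (μ := volume) (f := fun x => φ (x + z) ^ 2) fun x => sq_nonneg _]

/-! ### Affine functions on a convex set that contains a ball -/

lemma exists_inner_add_const {d : ℕ} (ℓ : E d →ᵃ[ℝ] ℝ) :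
    ∃ (g : E d) (c : ℝ), ∀ x, ℓ x = inner ℝ g x + c := by
  refine ⟨(InnerProductSpace.toDual ℝ (E d)).symm ℓ.linear.toContinuousLinearMap, ℓ 0, fun x => ?_⟩
  have := congrFun ℓ.decomp x
  simpa using this

/-- The affine function `x ↦ ⟪g, x⟫ + c`. -/
noncomputable def affineOf {d : ℕ} (g : E d) (c : ℝ) : E d →ᵃ[ℝ] ℝ :=
  (innerₛₗ ℝ g).toAffineMap + AffineMap.const ℝ (E d) c

@[simp] lemma affineOf_apply {d : ℕ} (g : E d) (c : ℝ) (x : E d) :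
    affineOf g c x = inner ℝ g x + c := by
  simp [affineOf]

lemma abs_sub_le_of_mem_convexHull {d : ℕ} {s : Set (E d)} {g : E d} {c m ρ : ℝ}
    (h : ∀ a ∈ s, |inner ℝ g a + c - m| ≤ ρ) {x : E d} (hx : x ∈ convexHull ℝ s) :
    |inner ℝ g x + c - m| ≤ ρ := by
  have hconv : Convex ℝ ((affineOf g c) ⁻¹' Metric.closedBall m ρ) :=
    (convex_closedBall m ρ).affine_preimage _
  have hsub : s ⊆ (affineOf g c) ⁻¹' Metric.closedBall m ρ := fun a ha => by
    simpa [Real.dist_eq] using h a ha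
  simpa [Real.dist_eq] using convexHull_min hsub hconv hx

lemma norm_mul_le_of_ball_subset {d : ℕ} {g c : E d} {r ρ : ℝ} {b m : ℝ} (hr : 0 < r)
    (h : ∀ x ∈ Metric.ball c r, |inner ℝ g x + b - m| ≤ ρ) : ‖g‖ * r ≤ 2 * ρ := by
  rcases eq_or_ne g 0 with rfl | hg
  · have := (abs_nonneg _).trans (h c (Metric.mem_ball_self hr))
    simpa using this
  have hgn : 0 < ‖g‖ := norm_pos_iff.2 hg
  have h1 := h (c + (r / 2 / ‖g‖) • g) (by
    rw [mem_ball_iff_norm]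
    rw [add_sub_cancel_left, norm_smul, Real.norm_of_nonneg (by positivity)]
    field_simp; norm_num)
  have h2 := h (c - (r / 2 / ‖g‖) • g) (by
    rw [mem_ball_iff_norm]
    rw [sub_sub_cancel_left, norm_neg, norm_smul, Real.norm_of_nonneg (by positivity)]
    field_simp; norm_num)
  have h3 : (r / 2 / ‖g‖) * inner ℝ g g = ‖g‖ * r / 2 := by
    rw [real_inner_self_eq_norm_sq]; field_simp
  rw [inner_add_right, inner_smul_right, h3] at h1
  rw [inner_sub_right, inner_smul_right, h3] at h2
  have := (abs_le.1 h1).2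
  have := (abs_le.1 h2).1
  linarith

lemma integrableOn_of_isBounded {d : ℕ} {f : E d → ℝ} (hf : Continuous f) {U : Set (E d)}
    (hU : Bornology.IsBounded U) : IntegrableOn f U :=
  (hf.continuousOn.integrableOn_compact hU.isCompact_closure).mono_set subset_closure

/-- Two points of a ball at distance `r` in the direction of the gradient see values of an affine
function that differ by `r ‖g‖`; averaging over two small balls bounds the gradient by the `L²`
norm. -/
lemma norm_sq_mul_volume_ball_le {d : ℕ} {S : Set (E d)}
    (hSb : Bornology.IsBounded S) {g c : E d} {r b : ℝ} (hr : 0 < r)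
    (hball : Metric.ball c r ⊆ S) :
    ‖g‖ ^ 2 * r ^ 2 * volume.real (Metric.ball (0 : E d) (r / 4))
      ≤ 4 * ∫ x in S, (inner ℝ g x + b) ^ 2 := by
  rcases eq_or_ne g 0 with rfl | hg
  · have : 0 ≤ ∫ x in S, ((inner ℝ (0 : E d) x : ℝ) + b) ^ 2 :=
      integral_nonneg fun x => sq_nonneg _
    simpa using this
  have hgn : 0 < ‖g‖ := norm_pos_iff.2 hg
  set f : E d → ℝ := fun x => (inner ℝ g x + b) ^ 2 with hf
  have hfc : Continuous f := by fun_prop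
  set e : E d := (r / 2 / ‖g‖) • g with he
  have hen : ‖e‖ = r / 2 := by
    rw [he, norm_smul, Real.norm_of_nonneg (by positivity)]; field_simp
  have h3 : inner ℝ g e = ‖g‖ * r / 2 := by
    rw [he, inner_smul_right, real_inner_self_eq_norm_sq]; field_simp
  set B : Set (E d) := Metric.ball c (r / 4) with hB
  have hshift : ∀ w : E d, ‖w‖ = r / 2 → ∫ x in B, f (x + w) ≤ ∫ x in S, f x := by
    intro w hw
    have : ∫ x in B, f (x + w) = ∫ x in Metric.ball (c + w) (r / 4), f x := by
      rw [← (measurePreserving_add_right volume w).setIntegral_preimage_emb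
        (measurableEmbedding_addRight w) f]
      congr 2
      ext x
      simp only [hB, Metric.mem_ball, dist_eq_norm, Set.mem_preimage]
      rw [show x + w - (c + w) = x - c by abel]
    rw [this]
    refine setIntegral_mono_set (integrableOn_of_isBounded hfc hSb)
      (.of_forall fun x => sq_nonneg _) ?_
    refine LE.le.eventuallyLE (Set.Subset.trans ?_ hball)
    refine Metric.ball_subset_ball' ?_
    simp [dist_eq_norm, hw]
    linarith
  have i1 : IntegrableOn (fun x => f (x + e)) B :=
    integrableOn_of_isBounded (by fun_prop) Metric.isBounded_ball
  have i2 : IntegrableOn (fun x => f (x + -e)) B :=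
    integrableOn_of_isBounded (by fun_prop) Metric.isBounded_ball
  have h4 : ∫ _ in B, (‖g‖ * r) ^ 2 / 2 ≤ ∫ x in B, (f (x + e) + f (x + -e)) := by
    refine setIntegral_mono (integrableOn_of_isBounded continuous_const Metric.isBounded_ball)
      (i1.add i2) fun x => ?_
    simp only [hf, inner_add_right, inner_neg_right, h3]
    nlinarith [sq_nonneg (inner ℝ g x + b)]
  rw [integral_add i1 i2, setIntegral_const] at h4
  have h5 := hshift e hen
  have h6 := hshift (-e) (by rw [norm_neg, hen])
  have h7 : volume.real B = volume.real (Metric.ball (0 : E d) (r / 4)) := by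
    simp [hB, Measure.real, Measure.addHaar_ball_center]
  rw [h7, smul_eq_mul] at h4
  nlinarith

lemma volume_le_mul_volume_ball {d : ℕ} {S : Set (E d)} {a : E d} {h r σ : ℝ}
    (hr : 0 < r) (hσ : 0 < σ) (hh : h = σ * r) (hSa : ∀ x ∈ S, dist x a ≤ h) :
    volume.real S ≤ (4 * σ) ^ d * volume.real (Metric.ball (0 : E d) (r / 4)) := by
  have h1 : volume.real S ≤ volume.real (Metric.closedBall a h) :=
    measureReal_mono (fun x hx => hSa x hx) measure_closedBall_lt_top.ne
  have hh0 : 0 ≤ h := by rw [hh]; positivity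
  refine h1.trans (le_of_eq ?_)
  rw [Measure.real, Measure.addHaar_closedBall _ _ hh0, Measure.real,
    Measure.addHaar_ball_of_pos _ _ (r := r / 4) (by positivity), finrank_euclideanSpace, Fintype.card_fin,
    ENNReal.toReal_mul, ENNReal.toReal_mul, ENNReal.toReal_ofReal (by positivity),
    ENNReal.toReal_ofReal (by positivity), ← mul_assoc, ← mul_pow, hh,
    show 4 * σ * (r / 4) = σ * r by ring]

/-- The inverse estimate on a shape regular set. -/
lemma inverse_estimate {d : ℕ} {S : Set (E d)}
    {g c a : E d} {b h r σ : ℝ} (hr : 0 < r) (hσ : 0 < σ) (hh : h = σ * r)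
    (hSa : ∀ x ∈ S, dist x a ≤ h) (hball : Metric.ball c r ⊆ S) :
    volume.real S * ‖g‖ ^ 2 * r ^ 2 ≤ 4 * (4 * σ) ^ d * ∫ x in S, (inner ℝ g x + b) ^ 2 := by
  have hb : Bornology.IsBounded S := (Metric.isBounded_closedBall (x := a) (r := h)).subset hSa
  have h1 := volume_le_mul_volume_ball hr hσ hh hSa
  have h2 := norm_sq_mul_volume_ball_le hb (g := g) (b := b) hr hball
  calc _ = volume.real S * (‖g‖ ^ 2 * r ^ 2) := by ring
    _ ≤ ((4 * σ) ^ d * volume.real (Metric.ball (0 : E d) (r / 4))) * (‖g‖ ^ 2 * r ^ 2) := by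
      gcongr
    _ = (4 * σ) ^ d * (‖g‖ ^ 2 * r ^ 2 * volume.real (Metric.ball (0 : E d) (r / 4))) := by ring
    _ ≤ (4 * σ) ^ d * (4 * ∫ x in S, (inner ℝ g x + b) ^ 2) := by gcongr
    _ = _ := by ring

/-- The value of an affine function at a point near a shape regular set is controlled by the `L²`
norm on the set. -/
lemma volume_mul_sq_le {d : ℕ} {S : Set (E d)} (hS : MeasurableSet S)
    {g c a : E d} {b h r σ : ℝ} (hr : 0 < r) (hσ : 0 < σ) (hh : h = σ * r)
    (hSa : ∀ x ∈ S, dist x a ≤ h) (hball : Metric.ball c r ⊆ S) :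
    volume.real S * (inner ℝ g a + b) ^ 2
      ≤ (2 + 8 * σ ^ 2 * (4 * σ) ^ d) * ∫ x in S, (inner ℝ g x + b) ^ 2 := by
  have hb : Bornology.IsBounded S := (Metric.isBounded_closedBall (x := a) (r := h)).subset hSa
  have h1 := inverse_estimate (g := g) (b := b) hr hσ hh hSa hball
  have hfin : volume S ≠ ∞ := hb.measure_lt_top.ne
  have h2 : ∫ _ in S, (inner ℝ g a + b) ^ 2
      ≤ ∫ x in S, (2 * (inner ℝ g x + b) ^ 2 + 2 * (‖g‖ * h) ^ 2) := by
    refine setIntegral_mono_on (integrableOn_of_isBounded continuous_const hb)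
      (integrableOn_of_isBounded (by fun_prop) hb) hS fun x hx => ?_
    have h3 : |(inner ℝ g (x - a) : ℝ)| ≤ ‖g‖ * h :=
      (abs_real_inner_le_norm _ _).trans (by
        have := hSa x hx
        rw [dist_eq_norm] at this
        gcongr)
    have h4 : (inner ℝ g (x - a) : ℝ) ^ 2 ≤ (‖g‖ * h) ^ 2 := sq_le_sq' (abs_le.1 h3).1 (abs_le.1 h3).2
    rw [inner_sub_right] at h4
    nlinarith [sq_nonneg ((inner ℝ g x + b) + (inner ℝ g x - inner ℝ g a))]
  rw [integral_add (integrableOn_of_isBounded (by fun_prop) hb)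
    (integrableOn_of_isBounded (by fun_prop) hb), integral_const_mul, setIntegral_const,
    setIntegral_const, smul_eq_mul, smul_eq_mul] at h2
  have h5 : volume.real S * (2 * (‖g‖ * h) ^ 2)
      = 2 * σ ^ 2 * (volume.real S * ‖g‖ ^ 2 * r ^ 2) := by rw [hh]; ring
  rw [h5] at h2
  have h6 := mul_le_mul_of_nonneg_left h1 (by positivity : 0 ≤ 2 * σ ^ 2)
  linarith

section

/-! ### The box -/

lemma isOpen_box (d : ℕ) (L : ℝ) : IsOpen (box d L) := by
  have : box d L = ⋂ i, (fun x : E d => x i) ⁻¹' Set.Ioo 0 L := by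
    ext x; simp [box]
  rw [this]
  exact isOpen_iInter_of_finite fun i => isOpen_Ioo.preimage (by fun_prop)

lemma convex_box (d : ℕ) (L : ℝ) : Convex ℝ (box d L) := by
  intro x hx y hy a b ha hb hab i
  have := convex_Ioo (𝕜 := ℝ) (0 : ℝ) L (hx i) (hy i) ha hb hab
  simpa using this

lemma mem_Icc_of_mem_closure_box {d : ℕ} {L : ℝ} {x : E d} (hx : x ∈ closure (box d L))
    (i : Fin d) : x i ∈ Set.Icc 0 L := by
  have hc : IsClosed {x : E d | x i ∈ Set.Icc 0 L} := isClosed_Icc.preimage (by fun_prop)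
  have hsub : box d L ⊆ {x : E d | x i ∈ Set.Icc 0 L} := fun y hy =>
    ⟨(hy i).1.le, (hy i).2.le⟩
  exact closure_minimal hsub hc hx

lemma isBounded_box (d : ℕ) (L : ℝ) : Bornology.IsBounded (box d L) := by
  refine (Metric.isBounded_closedBall (x := (0 : E d)) (r := √(d * L ^ 2))).subset fun x hx => ?_
  rw [mem_closedBall_zero_iff, EuclideanSpace.norm_eq]
  refine Real.sqrt_le_sqrt ?_
  calc ∑ i, ‖x i‖ ^ 2 ≤ ∑ _i : Fin d, L ^ 2 := Finset.sum_le_sum fun i _ => by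
        rw [Real.norm_of_nonneg (hx i).1.le]
        exact pow_le_pow_left₀ (hx i).1.le (hx i).2.le 2
    _ = d * L ^ 2 := by simp

lemma box_nonempty (d : ℕ) {L : ℝ} (hL : 0 < L) : (box d L).Nonempty :=
  ⟨WithLp.toLp 2 fun _ => L / 2, fun i => by constructor <;> simp <;> linarith⟩

lemma interior_closure_box (d : ℕ) {L : ℝ} (hL : 0 < L) :
    interior (closure (box d L)) = box d L := by
  rw [(convex_box d L).interior_closure_eq_interior_of_nonempty_interior
    (by rw [(isOpen_box d L).interior_eq]; exact box_nonempty d hL), (isOpen_box d L).interior_eq]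

lemma mem_frontier_box {d : ℕ} {L : ℝ} {x : E d} :
    x ∈ frontier (box d L) ↔ x ∈ closure (box d L) ∧ ∃ i, x i = 0 ∨ x i = L := by
  rw [frontier, (isOpen_box d L).interior_eq, Set.mem_sdiff]
  refine and_congr_right fun hx => ?_
  simp only [box, Set.mem_ofPred_eq, not_forall]
  refine exists_congr fun i => ?_
  have := mem_Icc_of_mem_closure_box hx i
  constructor
  · intro h
    by_contra! hc
    exact h ⟨lt_of_le_of_ne this.1 hc.1.symm, lt_of_le_of_ne this.2 hc.2⟩
  · rintro (h | h) hm <;> simp [h] at hm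

/-- A convex combination that lies on the boundary of the box uses points of the boundary only. -/
lemma mem_frontier_box_of_sum {d : ℕ} {L : ℝ} {s : Finset (E d)}
    (hs : (s : Set (E d)) ⊆ closure (box d L)) {w : E d → ℝ} (h0 : ∀ y, 0 ≤ w y)
    (h1 : ∑ y ∈ s, w y = 1) (hx : ∑ y ∈ s, w y • y ∈ frontier (box d L)) {a : E d} (ha : a ∈ s)
    (hwa : w a ≠ 0) : a ∈ frontier (box d L) := by
  rw [mem_frontier_box] at hx ⊢
  refine ⟨hs ha, ?_⟩
  obtain ⟨-, i, hi⟩ := hx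
  have hsum : (∑ y ∈ s, w y • y) i = ∑ y ∈ s, w y * y i := by simp
  rw [hsum] at hi
  refine ⟨i, hi.imp (fun h => ?_) fun h => ?_⟩
  · have h2 := (Finset.sum_eq_zero_iff_of_nonneg fun y hy =>
      mul_nonneg (h0 y) (mem_Icc_of_mem_closure_box (hs hy) i).1).1 h a ha
    exact (mul_eq_zero.1 h2).resolve_left hwa
  · have h3 : ∑ y ∈ s, w y * (L - y i) = 0 := by
      simp_rw [mul_sub]
      rw [Finset.sum_sub_distrib, h, ← Finset.sum_mul, h1, one_mul, sub_self]
    have h2 := (Finset.sum_eq_zero_iff_of_nonneg fun y hy =>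
      mul_nonneg (h0 y) (sub_nonneg.2 (mem_Icc_of_mem_closure_box (hs hy) i).2)).1 h3 a ha
    linarith [(mul_eq_zero.1 h2).resolve_left hwa]

/-! ### Cells and barycentric coordinates -/

variable {d : ℕ} {𝒯 : Geometry.SimplicialComplex ℝ (E d)}

/-- The open simplex spanned by the vertices in `K`. -/
def openCell (K : Finset (E d)) : Set (E d) := interior (convexHull ℝ (K : Set (E d)))

lemma isOpen_openCell (K : Finset (E d)) : IsOpen (openCell K) := isOpen_interior

lemma openCell_subset (K : Finset (E d)) : openCell K ⊆ convexHull ℝ (K : Set (E d)) :=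
  interior_subset

lemma affineSpan_eq_top {K : Finset (E d)} (hK : K ∈ cells 𝒯) :
    affineSpan ℝ (K : Set (E d)) = ⊤ := by
  have := (𝒯.indep hK.1).affineSpan_eq_top_iff_card_eq_finrank_add_one.2
    (by simp [hK.2])
  simpa using this

lemma openCell_nonempty {K : Finset (E d)} (hK : K ∈ cells 𝒯) : (openCell K).Nonempty :=
  interior_convexHull_nonempty_iff_affineSpan_eq_top.2 (affineSpan_eq_top hK)

lemma isCompact_convexHull_finset (K : Finset (E d)) :
    IsCompact (convexHull ℝ (K : Set (E d))) := K.finite_toSet.isCompact_convexHull (𝕜 := ℝ)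

lemma openCell_ae_eq (K : Finset (E d)) :
    openCell K =ᵐ[volume] convexHull ℝ (K : Set (E d)) :=
  interior_ae_eq_of_null_frontier ((convex_convexHull ℝ _).addHaar_frontier volume)

lemma disjoint_openCell {K K' : Finset (E d)} (hK : K ∈ cells 𝒯) (hK' : K' ∈ cells 𝒯)
    (hne : K ≠ K') : Disjoint (openCell K) (openCell K') := by
  classical
  rw [Set.disjoint_iff_inter_eq_empty, openCell, openCell, ← interior_inter]
  by_contra hcon
  have hsub := 𝒯.inter_subset_convexHull hK.1 hK'.1
  have h1 : (interior (convexHull ℝ ((K ∩ K' : Finset (E d)) : Set (E d)))).Nonempty := by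
    refine (Set.nonempty_iff_ne_empty.2 hcon).mono (interior_mono ?_)
    rwa [Finset.coe_inter]
  have h2 : affineSpan ℝ ((K ∩ K' : Finset (E d)) : Set (E d)) = ⊤ :=
    interior_convexHull_nonempty_iff_affineSpan_eq_top.1 h1
  have hne' : (K ∩ K').Nonempty := by
    rw [Finset.nonempty_iff_ne_empty]
    rintro h
    simp [h] at h1
  have hf : K ∩ K' ∈ 𝒯.faces := 𝒯.down_closed hK.1 Finset.inter_subset_left hne'
  have h3 := (𝒯.indep hf).affineSpan_eq_top_iff_card_eq_finrank_add_one.1 (by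
    rw [show Set.range ((↑) : (K ∩ K' : Finset (E d)) → E d) = ((K ∩ K' : Finset (E d)) : Set (E d))
      from Subtype.range_coe]
    exact h2)
  simp only [Fintype.card_coe, finrank_euclideanSpace, Fintype.card_fin] at h3
  have e1 : K ∩ K' = K := Finset.eq_of_subset_of_card_le Finset.inter_subset_left
    (by rw [h3, hK.2])
  have e2 : K ∩ K' = K' := Finset.eq_of_subset_of_card_le Finset.inter_subset_right
    (by rw [h3, hK'.2])
  exact hne (e1.symm.trans e2)

lemma IsTriangulation.finite_cells {D : Set (E d)} (h : IsTriangulation 𝒯 D) :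
    (cells 𝒯).Finite := h.finite.subset fun _ hK => hK.1

lemma IsTriangulation.closure_eq {D : Set (E d)} (h : IsTriangulation 𝒯 D) :
    closure D = ⋃ K ∈ cells 𝒯, convexHull ℝ (K : Set (E d)) := by
  rw [← h.space_eq]
  refine Set.Subset.antisymm (fun x hx => ?_) (Set.iUnion₂_subset fun K hK =>
    Geometry.SimplicialComplex.convexHull_subset_space hK.1)
  obtain ⟨s, hs, hx⟩ := Geometry.SimplicialComplex.mem_space_iff.1 hx
  obtain ⟨K, hK, hsK⟩ := h.pure s hs
  exact Set.mem_biUnion hK (convexHull_mono (by exact_mod_cast hsK) hx)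

lemma IsTriangulation.convexHull_subset {D : Set (E d)} (h : IsTriangulation 𝒯 D)
    {K : Finset (E d)} (hK : K ∈ 𝒯.faces) : convexHull ℝ (K : Set (E d)) ⊆ closure D := by
  rw [← h.space_eq]
  exact Geometry.SimplicialComplex.convexHull_subset_space hK

lemma IsTriangulation.openCell_subset_box {L : ℝ} (hL : 0 < L)
    (h : IsTriangulation 𝒯 (box d L)) {K : Finset (E d)} (hK : K ∈ cells 𝒯) :
    openCell K ⊆ box d L := by
  rw [← interior_closure_box d hL]
  exact interior_mono (h.convexHull_subset hK.1)

lemma IsTriangulation.ae_eq_biUnion {L : ℝ} (h : IsTriangulation 𝒯 (box d L)) :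
    box d L =ᵐ[volume] ⋃ K ∈ h.finite_cells.toFinset, openCell K := by
  have h1 : box d L =ᵐ[volume] closure (box d L) :=
    (closure_ae_eq_of_null_frontier ((convex_box d L).addHaar_frontier volume)).symm
  refine h1.trans ?_
  rw [h.closure_eq]
  simp only [Set.Finite.mem_toFinset]
  exact (Filter.EventuallyEq.countable_bUnion h.finite_cells.countable fun K _ => openCell_ae_eq K).symm

lemma IsTriangulation.setIntegral_eq_sum {L : ℝ} (hL : 0 < L)
    (h : IsTriangulation 𝒯 (box d L)) {f : E d → ℝ} (hf : IntegrableOn f (box d L)) :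
    ∫ x in box d L, f x = ∑ K ∈ h.finite_cells.toFinset, ∫ x in openCell K, f x := by
  rw [setIntegral_congr_set h.ae_eq_biUnion]
  refine integral_biUnion_finset _ (fun K _ => (isOpen_openCell K).measurableSet) ?_ ?_
  · intro K hK K' hK' hne
    simp only [Set.Finite.coe_toFinset] at hK hK'
    exact disjoint_openCell hK hK' hne
  · intro K hK
    exact hf.mono_set (h.openCell_subset_box hL (by simpa using hK))

lemma weights_unique {s : Finset (E d)} (hs : AffineIndependent ℝ ((↑) : s → E d))
    {w w' : E d → ℝ} (h1 : ∑ y ∈ s, w y = ∑ y ∈ s, w' y)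
    (h2 : ∑ y ∈ s, w y • y = ∑ y ∈ s, w' y • y) {a : E d} (ha : a ∈ s) : w a = w' a := by
  rw [affineIndependent_iff] at hs
  have := hs Finset.univ (fun y => w y - w' y)
    (by rw [Finset.sum_coe_sort s fun y => w y - w' y, Finset.sum_sub_distrib, h1, sub_self])
    (by
      rw [Finset.sum_coe_sort s fun y => (w y - w' y) • y]
      simp_rw [sub_smul]
      rw [Finset.sum_sub_distrib, h2, sub_self]) ⟨a, ha⟩ (Finset.mem_univ _)
  linarith

lemma exists_weights {s : Finset (E d)} {x : E d} (hx : x ∈ convexHull ℝ (s : Set (E d))) :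
    ∃ w : E d → ℝ, (∀ y, y ∉ s → w y = 0) ∧ (∀ y, 0 ≤ w y) ∧ ∑ y ∈ s, w y = 1 ∧
      ∑ y ∈ s, w y • y = x := by
  classical
  obtain ⟨w, h0, h1, h2⟩ := Finset.mem_convexHull'.1 hx
  refine ⟨fun y => if y ∈ s then w y else 0, fun y hy => by simp [hy], fun y => ?_, ?_, ?_⟩
  · by_cases hy : y ∈ s
    · simpa [hy] using h0 y hy
    · simp [hy]
  · rw [← h1]; exact Finset.sum_congr rfl fun y hy => by simp [hy]
  · rw [← h2]; exact Finset.sum_congr rfl fun y hy => by simp [hy]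

lemma IsBarycentric.mem_convexHull {s : Finset (E d)} {w : E d → ℝ} {x : E d}
    (h0 : ∀ y, 0 ≤ w y) (h1 : ∑ y ∈ s, w y = 1) (h2 : ∑ y ∈ s, w y • y = x) :
    x ∈ convexHull ℝ (s : Set (E d)) :=
  Finset.mem_convexHull'.2 ⟨w, fun y _ => h0 y, h1, h2⟩

/-- Barycentric coordinates are unique, since two simplices meet in a common face. -/
lemma IsBarycentric.unique {x : E d} {w w' : E d → ℝ} (h : IsBarycentric 𝒯 x w)
    (h' : IsBarycentric 𝒯 x w') : w = w' := by
  classical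
  obtain ⟨s, hs, hz, h0, h1, h2⟩ := h
  obtain ⟨s', hs', hz', h0', h1', h2'⟩ := h'
  have hx : x ∈ convexHull ℝ ((s ∩ s' : Finset (E d)) : Set (E d)) := by
    rw [Finset.coe_inter]
    exact 𝒯.inter_subset_convexHull hs hs'
      ⟨IsBarycentric.mem_convexHull h0 h1 h2, IsBarycentric.mem_convexHull h0' h1' h2'⟩
  obtain ⟨v, vz, -, v1, v2⟩ := exists_weights hx
  have key : ∀ (t : Finset (E d)) (ht : t ∈ 𝒯.faces) (hst : s ∩ s' ⊆ t) (u : E d → ℝ)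
      (_ : ∀ y, y ∉ t → u y = 0) (_ : ∑ y ∈ t, u y = 1) (_ : ∑ y ∈ t, u y • y = x), u = v := by
    intro t ht hst u uz u1 u2
    have e1 : ∑ y ∈ t, v y = 1 := by
      rw [← v1]; exact (Finset.sum_subset hst fun y _ hy => vz y hy).symm
    have e2 : ∑ y ∈ t, v y • y = x := by
      rw [← v2]; exact (Finset.sum_subset hst fun y _ hy => by rw [vz y hy, zero_smul]).symm
    funext a
    by_cases ha : a ∈ t
    · exact weights_unique (𝒯.indep ht) (u1.trans e1.symm) (u2.trans e2.symm) ha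
    · rw [uz a ha, vz a fun h => ha (hst h)]
  rw [key s hs Finset.inter_subset_left w hz h1 h2, key s' hs' Finset.inter_subset_right w' hz' h1' h2']

lemma hat_eq {x : E d} {w : E d → ℝ} (h : IsBarycentric 𝒯 x w) (a : E d) : hat 𝒯 a x = w a := by
  have hex : ∃ w, IsBarycentric 𝒯 x w := ⟨w, h⟩
  rw [hat, dif_pos hex]
  exact congrFun ((Classical.choose_spec hex).unique h) a

lemma interp_eq_sum {s : Finset (E d)} (hs : s ∈ 𝒯.faces) {w : E d → ℝ} {x : E d}
    (hz : ∀ y, y ∉ s → w y = 0) (h0 : ∀ y, 0 ≤ w y) (h1 : ∑ y ∈ s, w y = 1)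
    (h2 : ∑ y ∈ s, w y • y = x) (g : E d → ℝ) : interp 𝒯 g x = ∑ a ∈ s, g a * w a := by
  have hb : IsBarycentric 𝒯 x w := ⟨s, hs, hz, h0, h1, h2⟩
  rw [interp]
  simp_rw [hat_eq hb]
  refine finsum_mem_eq_sum_of_inter_support_eq _ ?_
  ext a
  simp only [Set.mem_inter_iff, Set.mem_ofPred_eq, Function.mem_support, Finset.mem_coe]
  refine and_congr_left fun ha => ?_
  have has : a ∈ s := by
    by_contra h
    exact ha (by rw [hz a h, mul_zero])
  exact ⟨fun _ => has, fun _ => 𝒯.down_closed hs (by simpa using has) (Finset.singleton_nonempty a)⟩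

lemma exists_affine_of_values {K : Finset (E d)} (hK : K ∈ cells 𝒯) (g : E d → ℝ) :
    ∃ (γ : E d) (c : ℝ), ∀ a ∈ K, inner ℝ γ a + c = g a := by
  let b : AffineBasis K ℝ (E d) := ⟨(↑), 𝒯.indep hK.1, by simpa using affineSpan_eq_top hK⟩
  obtain ⟨γ, c, h⟩ := exists_inner_add_const
    ((Fintype.linearCombination ℝ fun i : K => g i).toAffineMap.comp b.coords)
  refine ⟨γ, c, fun a ha => ?_⟩
  rw [← h]
  classical
  have hb : b ⟨a, ha⟩ = a := rfl
  have : ∀ i : K, b.coord i a = if i = ⟨a, ha⟩ then 1 else 0 := fun i => by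
    rw [← b.coord_apply i ⟨a, ha⟩, hb]
  simp [Fintype.linearCombination_apply, this]

/-! ### Continuous piecewise affine functions -/

/-- `v` is affine with gradient `γ K` on every closed cell `K`, and vanishes on the boundary. -/
structure IsPL (𝒯 : Geometry.SimplicialComplex ℝ (E d)) (D : Set (E d)) (v : E d → ℝ)
    (γ : Finset (E d) → E d) : Prop where
  affine : ∀ K ∈ cells 𝒯, ∃ c : ℝ, ∀ x ∈ convexHull ℝ (K : Set (E d)), v x = inner ℝ (γ K) x + c
  zero : ∀ x ∈ frontier D, v x = 0

lemma interp_apply_vertex {K : Finset (E d)} (hK : K ∈ 𝒯.faces) (g : E d → ℝ) {a : E d}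
    (ha : a ∈ K) : interp 𝒯 g a = g a := by
  classical
  rw [interp_eq_sum hK (w := fun y => if y = a then 1 else 0)]
  · simp [ha]
  · intro y hy; simp; rintro rfl; exact hy ha
  · intro y; split_ifs <;> norm_num
  · simp [ha]
  · simp [ha]

/-- The nodal interpolant of a function that vanishes at the boundary vertices is a finite element
function. -/
lemma exists_isPL_interp {L : ℝ} (h : IsTriangulation 𝒯 (box d L)) {g : E d → ℝ}
    (hg : ∀ a ∈ frontier (box d L), g a = 0) : ∃ γ, IsPL 𝒯 (box d L) (interp 𝒯 g) γ := by
  classical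
  choose! γ c hγ using fun (K : Finset (E d)) (hK : K ∈ cells 𝒯) => exists_affine_of_values hK g
  refine ⟨γ, fun K hK => ⟨c K, fun x hx => ?_⟩, fun x hx => ?_⟩
  · obtain ⟨w, hz, h0, h1, h2⟩ := exists_weights hx
    rw [interp_eq_sum hK.1 hz h0 h1 h2, ← h2, inner_sum, ← mul_one (c K), ← h1, Finset.mul_sum,
      ← Finset.sum_add_distrib]
    refine Finset.sum_congr rfl fun a ha => ?_
    rw [← hγ K hK a ha, inner_smul_right]
    ring
  · have hx' : x ∈ closure (box d L) := frontier_subset_closure hx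
    rw [← h.space_eq] at hx'
    obtain ⟨s, hs, hxs⟩ := Geometry.SimplicialComplex.mem_space_iff.1 hx'
    obtain ⟨w, hz, h0, h1, h2⟩ := exists_weights hxs
    rw [interp_eq_sum hs hz h0 h1 h2]
    refine Finset.sum_eq_zero fun a ha => ?_
    by_cases hwa : w a = 0
    · rw [hwa, mul_zero]
    · rw [hg a (mem_frontier_box_of_sum ((subset_convexHull ℝ _).trans (h.convexHull_subset hs))
        h0 h1 (h2 ▸ hx) ha hwa), zero_mul]

lemma IsFERep.exists_isPL {D : Set (E d)} {u : H10 D} {v : E d → ℝ} (h : IsFERep 𝒯 u v) :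
    ∃ γ, IsPL 𝒯 D v γ := by
  have : ∀ K ∈ cells 𝒯, ∃ (γ : E d) (c : ℝ), ∀ x ∈ convexHull ℝ (K : Set (E d)),
      v x = inner ℝ γ x + c := fun K hK => by
    obtain ⟨ℓ, hℓ⟩ := h.1 K hK
    obtain ⟨γ, c, hγ⟩ := exists_inner_add_const ℓ
    exact ⟨γ, c, fun x hx => by rw [hℓ hx, hγ]⟩
  choose! γ c hγ using this
  exact ⟨γ, fun K hK => ⟨c K, hγ K hK⟩, h.2.1⟩

lemma IsPL.isFERep {D : Set (E d)} {u : H10 D} {v : E d → ℝ} {γ : Finset (E d) → E d}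
    (h : IsPL 𝒯 D v γ) (hu : fn u =ᵐ[volume.restrict D] v) : IsFERep 𝒯 u v := by
  refine ⟨fun K hK => ?_, h.zero, hu⟩
  obtain ⟨c, hc⟩ := h.affine K hK
  exact ⟨affineOf (γ K) c, fun x hx => by rw [hc x hx, affineOf_apply]⟩

lemma IsPL.sub {D : Set (E d)} {v v' : E d → ℝ} {γ γ' : Finset (E d) → E d}
    (h : IsPL 𝒯 D v γ) (h' : IsPL 𝒯 D v' γ') : IsPL 𝒯 D (v - v') (γ - γ') := by
  refine ⟨fun K hK => ?_, fun x hx => by simp [h.zero x hx, h'.zero x hx]⟩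
  obtain ⟨c, hc⟩ := h.affine K hK
  obtain ⟨c', hc'⟩ := h'.affine K hK
  exact ⟨c - c', fun x hx => by simp [hc x hx, hc' x hx, inner_sub_left]; ring⟩

lemma IsPL.eqOn_of_vertices {D : Set (E d)} {v v' : E d → ℝ} {γ γ' : Finset (E d) → E d}
    (h : IsPL 𝒯 D v γ) (h' : IsPL 𝒯 D v' γ') (hT : IsTriangulation 𝒯 D)
    (hv : ∀ K ∈ cells 𝒯, ∀ a ∈ K, v a = v' a) : Set.EqOn v v' (closure D) := by
  intro x hx
  rw [hT.closure_eq] at hx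
  obtain ⟨K, hK, hxK⟩ := Set.mem_iUnion₂.1 hx
  obtain ⟨c, hc⟩ := (h.sub h').affine K hK
  have := abs_sub_le_of_mem_convexHull (s := (K : Set (E d))) (g := (γ - γ') K) (c := c) (m := 0)
    (ρ := 0) (fun a ha => by
      rw [← hc a (subset_convexHull ℝ _ ha)]; simp [hv K hK a ha]) hxK
  rw [← hc x hxK] at this
  simpa [sub_eq_zero] using this

end

section

/-! ### Weak gradients and density -/

section WeakGradient

variable {d : ℕ} {D : Set (E d)}

lemma fn_add (u v : H10 D) : fn (u + v) = fn u + fn v := rfl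
lemma fn_sub (u v : H10 D) : fn (u - v) = fn u - fn v := rfl
lemma fn_smul (r : ℝ) (v : H10 D) : fn (r • v) = r • fn v := rfl
lemma grad_add (u v : H10 D) : grad (u + v) = grad u + grad v := rfl
lemma grad_sub (u v : H10 D) : grad (u - v) = grad u - grad v := rfl
lemma grad_smul (r : ℝ) (v : H10 D) : grad (r • v) = r • grad v := rfl

lemma norm_sq_eq (u : H10 D) : ‖u‖ ^ 2 = ‖fn u‖ ^ 2 + ‖grad u‖ ^ 2 :=
  WithLp.prod_norm_sq_eq_of_L2 _

lemma continuous_fn : Continuous (fn : H10 D → L2 D ℝ) :=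
  (WithLp.continuous_fst 2 _ _).comp continuous_subtype_val

lemma continuous_grad : Continuous (grad : H10 D → L2 D (E d)) :=
  (WithLp.continuous_snd 2 _ _).comp continuous_subtype_val

lemma norm_grad_le (u : H10 D) : ‖grad u‖ ≤ ‖u‖ := by
  have := norm_sq_eq u
  exact abs_le_of_sq_le_sq' (by nlinarith [sq_nonneg ‖fn u‖]) (norm_nonneg _) |>.2

lemma inner_L2_real (f g : L2 D ℝ) : inner ℝ f g = ∫ x in D, f x * g x := by
  rw [L2.inner_def]
  exact integral_congr_ae (.of_forall fun x => by simp [mul_comm])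

lemma norm_sq_L2_real (f : L2 D ℝ) : ‖f‖ ^ 2 = ∫ x in D, f x ^ 2 := by
  rw [← real_inner_self_eq_norm_sq, inner_L2_real]
  exact integral_congr_ae (.of_forall fun x => by ring)

lemma norm_sq_L2 {F : Type} [NormedAddCommGroup F] [InnerProductSpace ℝ F] (f : L2 D F) :
    ‖f‖ ^ 2 = ∫ x in D, ‖f x‖ ^ 2 := by
  rw [← real_inner_self_eq_norm_sq, L2.inner_def]
  exact integral_congr_ae (.of_forall fun x => by simp)

lemma memLp_of_continuous {F : Type} [NormedAddCommGroup F] {f : E d → F}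
    (hf : Continuous f) (hs : HasCompactSupport f) : MemLp f 2 (volume.restrict D) :=
  (hf.memLp_of_hasCompactSupport hs).mono_measure Measure.restrict_le_self

lemma hasCompactSupport_gradient {φ : E d → ℝ} (hs : HasCompactSupport φ) :
    HasCompactSupport (gradient φ) :=
  (hs.fderiv (𝕜 := ℝ)).comp_left (g := (InnerProductSpace.toDual ℝ (E d)).symm) (by simp)

lemma gradient_fun_add {φ ψ : E d → ℝ} {x : E d} (hφ : DifferentiableAt ℝ φ x)
    (hψ : DifferentiableAt ℝ ψ x) :
    gradient (fun x => φ x + ψ x) x = gradient φ x + gradient ψ x := by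
  simp [gradient, fderiv_fun_add hφ hψ]

lemma gradient_const_mul {φ : E d → ℝ} {x : E d} (r : ℝ) (hφ : DifferentiableAt ℝ φ x) :
    gradient (fun x => r * φ x) x = r • gradient φ x := by
  simp [gradient, fderiv_const_mul hφ r]

lemma span_testPairs : (Submodule.span ℝ (testPairs D) : Set (L2Pair D)) = testPairs D := by
  refine Set.Subset.antisymm (fun z hz => ?_) Submodule.subset_span
  induction hz using Submodule.span_induction with
  | mem z hz => exact hz
  | zero =>
    refine ⟨fun _ => 0, contDiff_const, HasCompactSupport.zero, ?_, Lp.coeFn_zero ℝ 2 _, ?_⟩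
    · rw [show (fun _ : E d => (0 : ℝ)) = 0 from rfl, tsupport_zero]
      exact Set.empty_subset _
    · refine (Lp.coeFn_zero (E d) 2 _).trans (.of_forall fun x => ?_)
      simp [gradient]
  | add z w _ _ hz hw =>
    obtain ⟨φ, h1, h2, h3, h4, h5⟩ := hz
    obtain ⟨ψ, g1, g2, g3, g4, g5⟩ := hw
    have d1 : Differentiable ℝ φ := h1.differentiable (by simp)
    have d2 : Differentiable ℝ ψ := g1.differentiable (by simp)
    refine ⟨fun x => φ x + ψ x, h1.add g1, h2.add g2,
      (tsupport_add φ ψ).trans (Set.union_subset h3 g3), ?_, ?_⟩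
    · exact (Lp.coeFn_add z.fst w.fst).trans (h4.add g4)
    · refine (Lp.coeFn_add z.snd w.snd).trans ((h5.add g5).trans (.of_forall fun x => ?_))
      exact (gradient_fun_add (d1 x) (d2 x)).symm
  | smul r z _ hz =>
    obtain ⟨φ, h1, h2, h3, h4, h5⟩ := hz
    have d1 : Differentiable ℝ φ := h1.differentiable (by simp)
    refine ⟨fun x => r * φ x, contDiff_const.mul h1, h2.mul_left,
      (tsupport_mul_subset_right).trans h3, ?_, ?_⟩
    · exact (Lp.coeFn_smul r z.fst).trans (h4.const_smul r)
    · refine (Lp.coeFn_smul r z.snd).trans ((h5.const_smul r).trans (.of_forall fun x => ?_))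
      exact (gradient_const_mul r (d1 x)).symm

lemma testPairs_subset {z : L2Pair D} (hz : z ∈ testPairs D) : z ∈ H10 D :=
  Submodule.le_topologicalClosure _ (Submodule.subset_span hz)

/-- A closed property of `H¹₀` functions has to be checked on test functions only. -/
lemma H10_induction {p : H10 D → Prop} (hc : IsClosed {u | p u})
    (ht : ∀ (u : H10 D) (φ : E d → ℝ), ContDiff ℝ ((⊤ : ℕ∞) : WithTop ℕ∞) φ → HasCompactSupport φ →
      tsupport φ ⊆ D → fn u =ᵐ[volume.restrict D] φ →
      grad u =ᵐ[volume.restrict D] gradient φ → p u) (u : H10 D) : p u := by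
  have hu : (u : L2Pair D) ∈ closure (testPairs D) := by
    rw [← span_testPairs, ← Submodule.topologicalClosure_coe]
    exact u.2
  obtain ⟨z, hz, hlim⟩ := mem_closure_iff_seq_limit.1 hu
  have hlim' : Filter.Tendsto (fun n => (⟨z n, testPairs_subset (hz n)⟩ : H10 D)) Filter.atTop
      (nhds u) := tendsto_subtype_rng.2 hlim
  refine hc.mem_of_tendsto hlim' (.of_forall fun n => ?_)
  obtain ⟨φ, h1, h2, h3, h4, h5⟩ := hz n
  exact ht _ φ h1 h2 h3 h4 h5

lemma setIntegral_eq_integral_of_tsupport {F : Type} [NormedAddCommGroup F] [NormedSpace ℝ F]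
    {f : E d → F} (h : ∀ x, x ∉ D → f x = 0) : ∫ x in D, f x = ∫ x, f x :=
  setIntegral_eq_integral_of_forall_compl_eq_zero h

/-- Integration by parts. -/
lemma weak_gradient (u : H10 D) {ψ : E d → ℝ} (hψ : ContDiff ℝ ((⊤ : ℕ∞) : WithTop ℕ∞) ψ)
    (hs : HasCompactSupport ψ) (e : E d) :
    ∫ x in D, fn u x * fderiv ℝ ψ x e = - ∫ x in D, inner ℝ (grad u x) (ψ x • e) := by
  have c1 : Continuous fun x => fderiv ℝ ψ x e :=
    (hψ.continuous_fderiv (by simp)).clm_apply continuous_const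
  have s1 : HasCompactSupport fun x => fderiv ℝ ψ x e :=
    (hs.fderiv (𝕜 := ℝ)).comp_left (g := fun ℓ : E d →L[ℝ] ℝ => ℓ e) (by simp)
  have c2 : Continuous fun x => ψ x • e := hψ.continuous.smul continuous_const
  have s2 : HasCompactSupport fun x => ψ x • e := hs.smul_right
  have m1 : MemLp (fun x => fderiv ℝ ψ x e) 2 (volume.restrict D) := memLp_of_continuous c1 s1
  have m2 : MemLp (fun x => ψ x • e) 2 (volume.restrict D) := memLp_of_continuous c2 s2
  have e1 : ∀ u : H10 D, ∫ x in D, fn u x * fderiv ℝ ψ x e = inner ℝ (fn u) (m1.toLp _) := by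
    intro u
    rw [inner_L2_real]
    refine integral_congr_ae ?_
    filter_upwards [m1.coeFn_toLp] with x hx
    rw [hx]
  have e2 : ∀ u : H10 D, ∫ x in D, inner ℝ (grad u x) (ψ x • e)
      = inner ℝ (grad u) (m2.toLp _) := by
    intro u
    rw [L2.inner_def]
    refine integral_congr_ae ?_
    filter_upwards [m2.coeFn_toLp] with x hx
    rw [hx]
  refine H10_induction (p := fun u => ∫ x in D, fn u x * fderiv ℝ ψ x e
    = - ∫ x in D, inner ℝ (grad u x) (ψ x • e)) ?_ ?_ u
  · simp_rw [e1, e2]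
    exact isClosed_eq (continuous_fn.inner continuous_const)
      (continuous_grad.inner continuous_const).neg
  · intro u φ h1 h2 h3 h4 h5
    have hD : ∀ x, x ∉ D → φ x = 0 := fun x hx =>
      image_eq_zero_of_notMem_tsupport fun h => hx (h3 h)
    have hD' : ∀ x, x ∉ D → fderiv ℝ φ x = 0 := fun x hx =>
      fderiv_of_notMem_tsupport ℝ fun h => hx (h3 h)
    have a1 : ∫ x in D, fn u x * fderiv ℝ ψ x e = ∫ x, φ x * fderiv ℝ ψ x e := by
      rw [← setIntegral_eq_integral_of_tsupport (D := D) fun x hx => by rw [hD x hx, zero_mul]]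
      refine integral_congr_ae ?_
      filter_upwards [h4] with x hx
      rw [hx]
    have a2 : ∫ x in D, inner ℝ (grad u x) (ψ x • e) = ∫ x, fderiv ℝ φ x e * ψ x := by
      rw [← setIntegral_eq_integral_of_tsupport (D := D) fun x hx => by
        rw [hD' x hx, zero_apply, zero_mul]]
      refine integral_congr_ae ?_
      filter_upwards [h5] with x hx
      rw [hx, inner_smul_right, inner_gradient, mul_comm]
    rw [a1, a2]
    have c3 : Continuous fun x => fderiv ℝ φ x e :=
      (h1.continuous_fderiv (by simp)).clm_apply continuous_const
    refine integral_mul_fderiv_eq_neg_fderiv_mul_of_integrable ?_ ?_ ?_ ?_ ?_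
    · exact (c3.mul hψ.continuous).integrable_of_hasCompactSupport hs.mul_left
    · exact (h1.continuous.mul c1).integrable_of_hasCompactSupport h2.mul_right
    · exact (h1.continuous.mul hψ.continuous).integrable_of_hasCompactSupport hs.mul_left
    · exact fun x _ => h1.differentiable (by simp) x
    · exact fun x _ => hψ.differentiable (by simp) x

lemma hasCompactSupport_integrable_mul_fderiv {ψ : E d → ℝ}
    (hψ : ContDiff ℝ ((⊤ : ℕ∞) : WithTop ℕ∞) ψ) (hs : HasCompactSupport ψ) (γ e : E d) (c : ℝ) :
    ∫ x, (inner ℝ γ x + c) * fderiv ℝ ψ x e = - ∫ x, inner ℝ γ e * ψ x := by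
  have hd : ∀ x, HasFDerivAt (fun x : E d => (inner ℝ γ x : ℝ) + c) (innerSL ℝ γ) x := fun x =>
    ((innerSL ℝ γ).hasFDerivAt).add_const c
  have hf : ∀ x, fderiv ℝ (fun x : E d => (inner ℝ γ x : ℝ) + c) x e = inner ℝ γ e := fun x => by
    rw [(hd x).fderiv]; rfl
  have c1 : Continuous fun x => fderiv ℝ ψ x e :=
    (hψ.continuous_fderiv (by simp)).clm_apply continuous_const
  have s1 : HasCompactSupport fun x => fderiv ℝ ψ x e :=
    (hs.fderiv (𝕜 := ℝ)).comp_left (g := fun ℓ : E d →L[ℝ] ℝ => ℓ e) (by simp)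
  have hψc := hψ.continuous
  have key := integral_mul_fderiv_eq_neg_fderiv_mul_of_integrable (μ := volume) (v := e)
    (f := fun x : E d => (inner ℝ γ x : ℝ) + c) (g := ψ) ?_ ?_ ?_ ?_ ?_
  · simp_rw [hf] at key
    exact key
  · simp_rw [hf]
    exact (by fun_prop : Continuous fun x => (inner ℝ γ e : ℝ) * ψ x).integrable_of_hasCompactSupport
      hs.mul_left
  · exact (by fun_prop : Continuous fun x => ((inner ℝ γ x : ℝ) + c) * fderiv ℝ ψ x e)
      |>.integrable_of_hasCompactSupport s1.mul_left
  · exact (by fun_prop : Continuous fun x => ((inner ℝ γ x : ℝ) + c) * ψ x)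
      |>.integrable_of_hasCompactSupport hs.mul_left
  · exact fun x _ => (hd x).differentiableAt
  · exact fun x _ => hψ.differentiable (by simp) x

/-- The weak gradient is local: it is constant where the function is affine. This follows by testing
both `u` and the affine function with smooth functions supported in `U`. -/
lemma grad_ae_eq_of_affine (hDm : MeasurableSet D) (hD : Bornology.IsBounded D) (u : H10 D)
    {U : Set (E d)} (hU : IsOpen U) (hUD : U ⊆ D) {γ : E d} {c : ℝ}
    (h : ∀ᵐ x ∂volume.restrict U, fn u x = inner ℝ γ x + c) :
    ∀ᵐ x ∂volume.restrict U, grad u x = γ := by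
  have hDfin : IsFiniteMeasure (volume.restrict D) :=
    ⟨by simpa using hD.measure_lt_top⟩
  have gint : IntegrableOn (fun x => grad u x) D :=
    (Lp.memLp (grad u)).integrable (by norm_num)
  have key : ∀ i : Fin d, ∀ᵐ x ∂volume, x ∈ U → grad u x i - γ i = 0 := by
    intro i
    set e : E d := EuclideanSpace.single i 1 with he
    have hcoord : ∀ v : E d, v i = inner ℝ v e := fun v => by
      simp [he, EuclideanSpace.inner_single_right]
    have gi : IntegrableOn (fun x => grad u x i) D := by
      simp_rw [hcoord]
      exact gint.inner_const e
    refine IsOpen.ae_eq_zero_of_integral_contDiff_smul_eq_zero hU ?_ fun ψ h1 h2 h3 => ?_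
    · have : IntegrableOn (fun x => grad u x i - γ i) U :=
        (gi.mono_set hUD).sub (integrableOn_of_isBounded continuous_const (hD.subset hUD))
      exact this.locallyIntegrableOn
    · have hz : ∀ x, x ∉ U → ψ x = 0 := fun x hx =>
        image_eq_zero_of_notMem_tsupport fun h => hx (h3 h)
      have hz' : ∀ x, x ∉ U → fderiv ℝ ψ x = 0 := fun x hx =>
        fderiv_of_notMem_tsupport ℝ fun h => hx (h3 h)
      have w := weak_gradient u h1 h2 e
      have w1 : ∫ x in D, fn u x * fderiv ℝ ψ x e = - ∫ x in U, inner ℝ γ e * ψ x := by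
        rw [setIntegral_eq_of_subset_of_forall_sdiff_eq_zero hDm hUD fun x hx => by
            rw [hz' x hx.2]; simp,
          setIntegral_eq_integral_of_tsupport (D := U) (f := fun x => inner ℝ γ e * ψ x) fun x hx =>
            by rw [hz x hx, mul_zero],
          ← hasCompactSupport_integrable_mul_fderiv h1 h2 γ e c,
          ← setIntegral_eq_integral_of_tsupport (D := U)
            (f := fun x => (inner ℝ γ x + c) * fderiv ℝ ψ x e) fun x hx => by
            rw [hz' x hx]; simp]
        refine integral_congr_ae ?_
        filter_upwards [h] with x hx
        rw [hx]
      have w2 : ∫ x in D, inner ℝ (grad u x) (ψ x • e) = ∫ x in U, ψ x * grad u x i := by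
        rw [setIntegral_eq_of_subset_of_forall_sdiff_eq_zero hDm hUD fun x hx => by
            rw [hz x hx.2]; simp]
        refine integral_congr_ae (.of_forall fun x => ?_)
        simp only [inner_smul_right, hcoord]
      rw [w1, w2, neg_inj] at w
      have i1 : IntegrableOn (fun x => ψ x * grad u x i) U :=
        ((gi.mono_set hUD).locallyIntegrable).integrable_smul_left_of_hasCompactSupport
          h1.continuous h2
      have i2 : IntegrableOn (fun x => inner ℝ γ e * ψ x) U :=
        ((h1.continuous.integrable_of_hasCompactSupport h2).const_mul _).integrableOn
      rw [← setIntegral_eq_integral_of_tsupport (D := U) fun x hx => by rw [hz x hx, zero_smul]]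
      have e1 : ∀ x, ψ x • (grad u x i - γ i) = ψ x * grad u x i - inner ℝ γ e * ψ x := fun x => by
        rw [hcoord γ, smul_eq_mul]; ring
      simp_rw [e1]
      rw [integral_sub i1 i2, w, sub_self]
  rw [ae_restrict_iff' hU.measurableSet]
  filter_upwards [ae_all_iff.2 key] with x hx hxU
  ext i
  exact sub_eq_zero.1 (hx i hxU)

lemma fn_injective (hDo : IsOpen D) (hD : Bornology.IsBounded D) {u v : H10 D}
    (h : fn u = fn v) : u = v := by
  have h0 : fn (u - v) = 0 := by rw [fn_sub, h, sub_self]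
  have h1 : grad (u - v) = 0 := by
    have := grad_ae_eq_of_affine hDo.measurableSet hD (u - v) hDo subset_rfl (γ := 0) (c := 0) (by
      rw [h0]
      filter_upwards [Lp.coeFn_zero ℝ 2 (volume.restrict D)] with x hx
      rw [hx]; simp)
    refine Lp.ext ?_
    filter_upwards [this, Lp.coeFn_zero (E d) 2 (volume.restrict D)] with x hx hx'
    rw [hx, hx']; rfl
  have h2 := norm_sq_eq (u - v)
  rw [h0, h1] at h2
  simp only [norm_zero] at h2
  exact sub_eq_zero.1 (norm_eq_zero.1 (pow_eq_zero_iff two_ne_zero |>.1 (by linarith)))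

end WeakGradient

/-- Poincaré's inequality on `H¹₀`. -/
lemma poincare {d : ℕ} (hd : 0 < d) {L : ℝ} (hL : 0 < L) (u : H10 (box d L)) :
    ‖fn u‖ ≤ L * ‖grad u‖ := by
  refine H10_induction (p := fun u => ‖fn u‖ ≤ L * ‖grad u‖)
    (isClosed_le continuous_fn.norm (continuous_const.mul continuous_grad.norm)) ?_ u
  intro u φ h1 h2 h3 h4 h5
  refine (sq_le_sq₀ (norm_nonneg _) (by positivity)).1 ?_
  rw [mul_pow, norm_sq_L2_real, norm_sq_L2]
  have hD : ∀ x, x ∉ box d L → φ x = 0 := fun x hx =>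
    image_eq_zero_of_notMem_tsupport fun h => hx (h3 h)
  have hD' : ∀ x, x ∉ box d L → gradient φ x = 0 := fun x hx => by
    rw [gradient, fderiv_of_notMem_tsupport ℝ fun h => hx (h3 h), map_zero]
  have a1 : ∫ x in box d L, fn u x ^ 2 = ∫ x, φ x ^ 2 := by
    rw [← setIntegral_eq_integral_of_tsupport (D := box d L) fun x hx => by rw [hD x hx]; simp]
    refine integral_congr_ae ?_
    filter_upwards [h4] with x hx
    rw [hx]
  have a2 : ∫ x in box d L, ‖grad u x‖ ^ 2 = ∫ x, ‖gradient φ x‖ ^ 2 := by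
    rw [← setIntegral_eq_integral_of_tsupport (D := box d L) fun x hx => by rw [hD' x hx]; simp]
    refine integral_congr_ae ?_
    filter_upwards [h5] with x hx
    rw [hx]
  rw [a1, a2]
  exact poincare_testFunction hd (h1.of_le (by simp)) h2 h3

end

section

/-! ### Piecewise affine functions belong to `H¹₀` -/

/-- A continuous function that is Lipschitz on each set of a finite closed cover of an interval
is Lipschitz on the interval. -/
lemma abs_sub_le_of_closed_cover {ι : Type*} [Finite ι] {f : ℝ → ℝ} (hf : Continuous f)
    {F : ι → Set ℝ} (hF : ∀ i, IsClosed (F i)) (hcov : ∀ t, ∃ i, t ∈ F i) {M : ℝ}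
    (hlip : ∀ i, ∀ s ∈ F i, ∀ t ∈ F i, |f t - f s| ≤ M * |t - s|) : |f 1 - f 0| ≤ M := by
  have hS : IsClosed ({t | |f t - f 0| ≤ M * t} ∩ Set.Icc (0 : ℝ) 1) :=
    (isClosed_le (by fun_prop) (by fun_prop)).inter isClosed_Icc
  have key := hS.Icc_subset_of_forall_exists_gt (by simp) (fun x hx y hy => ?_)
  · simpa using key (Set.right_mem_Icc.2 zero_le_one)
  · have h1 : ∀ᶠ t in nhdsWithin x (Set.Ioi x), ∀ i, x ∉ F i → t ∉ F i := by
      refine nhdsWithin_le_nhds (Filter.eventually_all.2 fun i => ?_)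
      by_cases hi : x ∈ F i
      · exact .of_forall fun t h => absurd hi h
      · filter_upwards [(hF i).isOpen_compl.mem_nhds hi] with t ht _ using ht
    obtain ⟨t, ht, hxt⟩ := (h1.and (Ioc_mem_nhdsGT hy)).exists
    refine ⟨t, ?_, hxt⟩
    obtain ⟨i, hi⟩ := hcov t
    have hxi : x ∈ F i := by
      by_contra hc
      exact ht i hc hi
    have h2 := hlip i x hxi t hi
    rw [abs_of_pos (sub_pos.2 hxt.1)] at h2
    have h3 : |f x - f 0| ≤ M * x := hx.1
    calc |f t - f 0| = |(f t - f x) + (f x - f 0)| := by ring_nf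
      _ ≤ |f t - f x| + |f x - f 0| := abs_add_le _ _
      _ ≤ M * (t - x) + M * x := add_le_add h2 h3
      _ = M * t := by ring

variable {d : ℕ} {𝒯 : Geometry.SimplicialComplex ℝ (E d)} {L : ℝ}

/-- The extension by zero of a finite element function is Lipschitz. -/
lemma IsPL.exists_lipschitz (hT : IsTriangulation 𝒯 (box d L)) {v : E d → ℝ}
    {γ : Finset (E d) → E d} (h : IsPL 𝒯 (box d L) v γ) :
    ∃ M, 0 ≤ M ∧ ∀ x y, |(box d L).indicator v y - (box d L).indicator v x| ≤ M * ‖y - x‖ := by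
  classical
  have hfin := hT.finite_cells.to_subtype
  set V := (box d L).indicator v with hV
  -- On the line through the two points, the preimages of the closed cells and of the complement of
  -- the box form a finite closed cover.
  let F : Option (cells 𝒯) → Set (E d) := fun o =>
    o.elim (box d L)ᶜ fun K => convexHull ℝ ((K : Finset (E d)) : Set (E d))
  have hFc : ∀ o, IsClosed (F o) := by
    rintro (_ | K)
    · exact (isOpen_box d L).isClosed_compl
    · exact (isCompact_convexHull_finset _).isClosed
  have hcov : ∀ x, ∃ o, x ∈ F o := by
    intro x
    by_cases hx : x ∈ box d L
    · have := subset_closure hx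
      rw [hT.closure_eq] at this
      obtain ⟨K, hK, hxK⟩ := Set.mem_iUnion₂.1 this
      exact ⟨some ⟨K, hK⟩, hxK⟩
    · exact ⟨none, hx⟩
  have hVeq : ∀ K ∈ cells 𝒯, Set.EqOn V v (convexHull ℝ (K : Set (E d))) := by
    intro K hK x hx
    by_cases hxb : x ∈ box d L
    · simp [hV, hxb]
    · have : x ∈ frontier (box d L) := by
        rw [frontier, (isOpen_box d L).interior_eq]
        exact ⟨hT.convexHull_subset hK.1 hx, hxb⟩
      simp [hV, hxb, h.zero x this]
  have hVc : Continuous V := by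
    rw [← continuousOn_univ, show (Set.univ : Set (E d)) = ⋃ o, F o from
      (Set.eq_univ_of_forall fun x => Set.mem_iUnion.2 (hcov x)).symm]
    refine (locallyFinite_of_finite _).continuousOn_iUnion hFc ?_
    rintro (_ | K)
    · refine ContinuousOn.congr (f := fun _ => (0 : ℝ)) continuousOn_const fun x hx => ?_
      exact Set.indicator_of_notMem hx _
    · obtain ⟨c, hc⟩ := h.affine K K.2
      exact ContinuousOn.congr (f := fun x => inner ℝ (γ K) x + c) (by fun_prop)
        fun x hx => (hVeq K K.2 hx).trans (hc x hx)
  set M := ∑ K ∈ hT.finite_cells.toFinset, ‖γ K‖ with hM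
  have hM0 : 0 ≤ M := Finset.sum_nonneg fun _ _ => norm_nonneg _
  have hlip : ∀ o, ∀ x ∈ F o, ∀ y ∈ F o, |V y - V x| ≤ M * ‖y - x‖ := by
    rintro (_ | K) x hx y hy
    · have e1 : V x = 0 := Set.indicator_of_notMem hx _
      have e2 : V y = 0 := Set.indicator_of_notMem hy _
      rw [e1, e2]; simp; positivity
    · obtain ⟨c, hc⟩ := h.affine K K.2
      rw [hVeq K K.2 hx, hVeq K K.2 hy, hc x hx, hc y hy, add_sub_add_right_eq_sub,
        ← inner_sub_right]
      refine (abs_real_inner_le_norm _ _).trans ?_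
      gcongr
      exact Finset.single_le_sum (f := fun K => ‖γ K‖) (fun _ _ => norm_nonneg _) (by simp)
  refine ⟨M, hM0, fun x y => ?_⟩
  have hline : Continuous fun t : ℝ => x + t • (y - x) := by fun_prop
  have := abs_sub_le_of_closed_cover (f := fun t : ℝ => V (x + t • (y - x)))
    (hVc.comp hline) (F := fun o => (fun t : ℝ => x + t • (y - x)) ⁻¹' F o)
    (fun o => (hFc o).preimage hline) (fun t => hcov _) (M := M * ‖y - x‖) (fun o s hs t ht => ?_)
  · simpa using this
  · refine (hlip o _ hs _ ht).trans (le_of_eq ?_)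
    rw [add_sub_add_left_eq_sub, ← sub_smul, norm_smul, Real.norm_eq_abs]
    ring

lemma abs_integral_mul_sub_le {ρ f : E d → ℝ} (hρ : Continuous ρ) (hρs : HasCompactSupport ρ)
    (hρ0 : ∀ t, 0 ≤ ρ t) (hρ1 : ∫ t, ρ t = 1) (hf : Continuous f) {m B : ℝ}
    (h : ∀ t, ρ t ≠ 0 → |f t - m| ≤ B) : |(∫ t, ρ t * f t) - m| ≤ B := by
  have i1 : Integrable fun t => ρ t * f t :=
    (hρ.mul hf).integrable_of_hasCompactSupport hρs.mul_right
  have i2 : Integrable ρ := hρ.integrable_of_hasCompactSupport hρs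
  have e1 : (∫ t, ρ t * f t) - m = ∫ t, ρ t * (f t - m) := by
    simp_rw [mul_sub]
    rw [integral_sub i1 (i2.mul_const m), integral_mul_const, hρ1, one_mul]
  rw [e1]
  calc |∫ t, ρ t * (f t - m)| ≤ ∫ t, |ρ t * (f t - m)| := abs_integral_le_integral_abs
    _ ≤ ∫ t, ρ t * B := by
      refine integral_mono_of_nonneg (.of_forall fun t => abs_nonneg _) (i2.mul_const B)
        (.of_forall fun t => ?_)
      dsimp only
      rw [abs_mul, abs_of_nonneg (hρ0 t)]
      by_cases ht : ρ t = 0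
      · simp [ht]
      · exact mul_le_mul_of_nonneg_left (h t ht) (hρ0 t)
    _ = B := by rw [integral_mul_const, hρ1, one_mul]

/-- Contracting a Lipschitz function that vanishes outside the box towards the centre `c₀` of the box
and mollifying it at scale `L δ / 4` gives a test function. -/
lemma exists_test_approx (hL : 0 < L) {V : E d → ℝ} {M R : ℝ} (hM : 0 ≤ M)
    (hlip : ∀ x y, |V y - V x| ≤ M * ‖y - x‖) (hV0 : ∀ x, x ∉ box d L → V x = 0)
    {c₀ : E d} (hc₀ : ∀ i, c₀ i = L / 2) (hR : ∀ x ∈ box d L, ‖x - c₀‖ ≤ R)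
    {δ : ℝ} (hδ : 0 < δ) (hδ' : δ ≤ 1 / 2) :
    ∃ φ : E d → ℝ, ContDiff ℝ ((⊤ : ℕ∞) : WithTop ℕ∞) φ ∧ HasCompactSupport φ ∧
      tsupport φ ⊆ box d L ∧ (∀ x ∈ box d L, |φ x - V x| ≤ M * ((2 * R + L) * δ)) ∧
      (∀ x, ‖gradient φ x‖ ≤ 2 * M) ∧
      ∀ x ∈ box d L, ∀ (γ : E d) (c r : ℝ), (∀ y ∈ Metric.ball x r, V y = inner ℝ γ y + c) →
        (2 * R + L) * δ < r → gradient φ x = (1 - δ)⁻¹ • γ := by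
  set lam : ℝ := (1 - δ)⁻¹ with hlam
  have hδ1 : 0 < 1 - δ := by linarith
  have hlam0 : 0 < lam := inv_pos.2 hδ1
  have hlam2 : lam ≤ 2 := by
    rw [hlam, inv_le_comm₀ hδ1 two_pos]; linarith
  have hlam3 : lam - 1 ≤ 2 * δ := by
    have : lam * (1 - δ) = 1 := inv_mul_cancel₀ hδ1.ne'
    nlinarith
  have hlam1 : 1 ≤ lam := by
    have : lam * (1 - δ) = 1 := inv_mul_cancel₀ hδ1.ne'
    nlinarith
  have hVc : Continuous V := by
    have : LipschitzWith (Real.toNNReal M) V := LipschitzWith.of_dist_le_mul fun x y => by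
      rw [Real.coe_toNNReal _ hM, Real.dist_eq, dist_eq_norm]
      exact hlip y x
    exact this.continuous
  let b : ContDiffBump (0 : E d) := ⟨L * δ / 8, L * δ / 4, by positivity, by
    have : 0 < L * δ := by positivity
    linarith⟩
  set ρ : E d → ℝ := b.normed volume with hρ
  have hρc : Continuous ρ := b.continuous_normed
  have hρs : HasCompactSupport ρ := b.hasCompactSupport_normed
  have hρ0 : ∀ t, 0 ≤ ρ t := b.nonneg_normed
  have hρ1 : ∫ t, ρ t = 1 := b.integral_normed
  have hρb : ∀ t, ρ t ≠ 0 → ‖t‖ ≤ L * δ / 4 := fun t ht => by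
    have : t ∈ Function.support ρ := ht
    rw [hρ, b.support_normed_eq, mem_ball_zero_iff] at this
    exact this.le
  set P : E d → E d → E d := fun x t => c₀ + lam • (x - t - c₀) with hP
  set W : E d → ℝ := fun x => V (c₀ + lam • (x - c₀)) with hW
  have hWc : Continuous W := by fun_prop
  set φ : E d → ℝ := convolution ρ W (ContinuousLinearMap.lsmul ℝ ℝ) volume with hφ
  have hφe : ∀ x, φ x = ∫ t, ρ t * V (P x t) := fun x => rfl
  have hPdist : ∀ x ∈ box d L, ∀ y t, ρ t ≠ 0 →
      ‖P y t - x‖ ≤ 2 * ‖y - x‖ + (2 * R + L / 2) * δ := by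
    intro x hx y t ht
    have e : P y t - x = lam • (y - x) + (lam - 1) • (x - c₀) - lam • t := by
      simp only [hP]; module
    rw [e]
    have hxR := hR x hx
    calc _ ≤ ‖lam • (y - x)‖ + ‖(lam - 1) • (x - c₀)‖ + ‖lam • t‖ :=
          (norm_sub_le _ _).trans (by gcongr; exact norm_add_le _ _)
      _ = lam * ‖y - x‖ + (lam - 1) * ‖x - c₀‖ + lam * ‖t‖ := by
          rw [norm_smul, norm_smul, norm_smul, Real.norm_of_nonneg hlam0.le,
            Real.norm_of_nonneg (sub_nonneg.2 hlam1)]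
      _ ≤ 2 * ‖y - x‖ + (2 * δ) * R + 2 * (L * δ / 4) := by
          gcongr
          exact hρb t ht
      _ = _ := by ring
  have hPsub : ∀ x y t, P y t - P x t = lam • (y - x) := by
    intro x y t; simp only [hP]; module
  have hcontP : ∀ x, Continuous fun t => V (P x t) := fun x => by fun_prop
  have hint : ∀ x, Integrable fun t => ρ t * V (P x t) := fun x =>
    (hρc.mul (hcontP x)).integrable_of_hasCompactSupport hρs.mul_right
  have hsm : ContDiff ℝ ((⊤ : ℕ∞) : WithTop ℕ∞) φ :=
    hρs.contDiff_convolution_left _ b.contDiff_normed hWc.locallyIntegrable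
  -- `φ` is supported in the box that is shrunk towards `c₀` by the factor `1 - δ / 2`: contracting by
  -- `1 - δ` gains `L δ / 2` on each side, of which the mollification loses only half.
  set S : Set (E d) := {x | ∀ i, |x i - L / 2| ≤ L / 2 * (1 - δ / 2)} with hS
  have hSc : IsClosed S := by
    have : S = ⋂ i, {x : E d | |x i - L / 2| ≤ L / 2 * (1 - δ / 2)} := by ext x; simp [hS]
    rw [this]
    exact isClosed_iInter fun i => isClosed_le (by fun_prop) continuous_const
  have hSb : S ⊆ box d L := by
    intro x hx i
    have h1 := abs_le.1 (hx i)
    have : 0 < L * δ := by positivity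
    constructor <;> nlinarith [h1.1, h1.2]
  have hsupp : Function.support φ ⊆ S := by
    intro x hx
    by_contra hxS
    apply hx
    rw [hφe]
    refine integral_eq_zero_of_ae (.of_forall fun t => ?_)
    dsimp only [Pi.zero_apply]
    by_cases ht : ρ t = 0
    · rw [ht, zero_mul]
    rw [hV0, mul_zero]
    intro hbox
    apply hxS
    intro i
    have h1 := hbox i
    have h2 : P x t i = L / 2 + lam * (x i - t i - L / 2) := by simp [hP, hc₀]
    have h3 : |t i| ≤ L * δ / 4 := (PiLp.norm_apply_le t i).trans (hρb t ht)
    rw [h2] at h1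
    have h4 : |lam * (x i - t i - L / 2)| ≤ L / 2 := abs_le.2 ⟨by linarith [h1.1], by linarith [h1.2]⟩
    rw [abs_mul, abs_of_pos hlam0, hlam, inv_mul_le_iff₀ hδ1] at h4
    have h5 : |x i - L / 2| ≤ |x i - t i - L / 2| + |t i| := by
      rw [show x i - L / 2 = (x i - t i - L / 2) + t i by ring]
      exact abs_add_le _ _
    linarith
  have htsupp : tsupport φ ⊆ S := closure_minimal hsupp hSc
  refine ⟨φ, hsm, ?_, htsupp.trans hSb, ?_, ?_, ?_⟩
  · exact HasCompactSupport.of_support_subset_isCompact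
      (Metric.isCompact_of_isClosed_isBounded hSc ((isBounded_box d L).subset hSb)) hsupp
  · intro x hx
    rw [hφe]
    refine abs_integral_mul_sub_le hρc hρs hρ0 hρ1 (hcontP x) fun t ht => (hlip _ _).trans ?_
    have := hPdist x hx x t ht
    rw [sub_self, norm_zero] at this
    have : 0 < L * δ := by positivity
    gcongr
    nlinarith
  · intro x
    rw [norm_gradient]
    refine norm_fderiv_le_of_lip' ℝ (by positivity) (.of_forall fun y => ?_)
    rw [Real.norm_eq_abs, hφe x, hφe y, ← integral_sub (hint y) (hint x)]
    have e : ∀ t, ρ t * V (P y t) - ρ t * V (P x t) = ρ t * (V (P y t) - V (P x t)) :=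
      fun t => by ring
    simp_rw [e]
    rw [← sub_zero (∫ t, _)]
    refine abs_integral_mul_sub_le hρc hρs hρ0 hρ1
      (f := fun t => V (P y t) - V (P x t)) ((hcontP y).sub (hcontP x)) fun t ht => ?_
    rw [sub_zero]
    refine (hlip _ _).trans ?_
    rw [hPsub, norm_smul, Real.norm_of_nonneg hlam0.le]
    have := mul_le_mul_of_nonneg_right hlam2 (norm_nonneg (y - x))
    nlinarith
  · intro x hx γ c r hr hδr
    have hpos : 0 < r - (2 * R + L / 2) * δ := by
      have : 0 < L * δ := by positivity
      nlinarith
    have hnear : ∀ᶠ y in nhds x, φ y = lam * inner ℝ γ y +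
        ∫ t, ρ t * (inner ℝ γ (c₀ + lam • (- t - c₀)) + c) := by
      filter_upwards [Metric.ball_mem_nhds x (half_pos hpos)] with y hy
      rw [mem_ball_iff_norm] at hy
      have i1 : Integrable fun t => ρ t * (inner ℝ γ (c₀ + lam • (- t - c₀)) + c) :=
        (by fun_prop : Continuous fun t => ρ t * (inner ℝ γ (c₀ + lam • (- t - c₀)) + c))
          |>.integrable_of_hasCompactSupport hρs.mul_right
      have i2 : Integrable fun t => ρ t * (lam * inner ℝ γ y) :=
        (hρc.integrable_of_hasCompactSupport hρs).mul_const _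
      have : lam * inner ℝ γ y = ∫ t, ρ t * (lam * inner ℝ γ y) := by
        rw [integral_mul_const, hρ1, one_mul]
      rw [hφe, this, ← integral_add i2 i1]
      refine integral_congr_ae (.of_forall fun t => ?_)
      dsimp only
      by_cases ht : ρ t = 0
      · simp [ht]
      rw [hr _ (by
        rw [mem_ball_iff_norm]
        linarith [hPdist x hx y t ht]), ← mul_add]
      congr 1
      have : P y t = lam • y + (c₀ + lam • (- t - c₀)) := by simp only [hP]; module
      rw [this, inner_add_right, inner_smul_right]
      ring
    have hder : HasFDerivAt φ (lam • innerSL ℝ γ) x := by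
      refine HasFDerivAt.congr_of_eventuallyEq ?_ hnear
      exact (((innerSL ℝ γ).hasFDerivAt).const_mul lam).add_const _
    refine ext_inner_right ℝ fun w => ?_
    rw [inner_gradient, hder.fderiv, real_inner_smul_left]
    rfl

/-- A finite element function is the limit in `H¹` of the test functions of
`exists_test_approx`. -/
lemma IsPL.exists_H10 (hL : 0 < L) (hT : IsTriangulation 𝒯 (box d L))
    {v : E d → ℝ} {γ : Finset (E d) → E d} (h : IsPL 𝒯 (box d L) v γ) :
    ∃ u : H10 (box d L), fn u =ᵐ[volume.restrict (box d L)] v := by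
  classical
  have hfinm : IsFiniteMeasure (volume.restrict (box d L)) :=
    ⟨by simpa using (isBounded_box d L).measure_lt_top⟩
  have hDm : MeasurableSet (box d L) := (isOpen_box d L).measurableSet
  obtain ⟨M, hM, hlip⟩ := h.exists_lipschitz hT
  set V := (box d L).indicator v with hV
  have hV0 : ∀ x, x ∉ box d L → V x = 0 := fun x hx => Set.indicator_of_notMem hx _
  let c₀ : E d := WithLp.toLp 2 fun _ => L / 2
  obtain ⟨R, hR⟩ := (isBounded_box d L).subset_closedBall c₀
  have hR' : ∀ x ∈ box d L, ‖x - c₀‖ ≤ R := fun x hx => by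
    simpa [dist_eq_norm] using hR hx
  let δ : ℕ → ℝ := fun n => 1 / ((n : ℝ) + 2)
  have hδ : ∀ n, 0 < δ n := fun n => by positivity
  have hδ' : ∀ n, δ n ≤ 1 / 2 := fun n =>
    one_div_le_one_div_of_le two_pos (by linarith [n.cast_nonneg (α := ℝ)])
  have hδlim : Filter.Tendsto δ Filter.atTop (nhds 0) := by
    have := (tendsto_const_div_atTop_nhds_zero_nat (1 : ℝ)).comp (Filter.tendsto_add_atTop_nat 2)
    refine this.congr fun n => ?_
    simp [δ]
  choose φ φs φc φt φv φg φe using fun n => exists_test_approx hL hM hlip hV0 (c₀ := c₀)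
    (fun i => rfl) hR' (hδ n) (hδ' n)
  have m1 : ∀ n, MemLp (φ n) 2 (volume.restrict (box d L)) := fun n =>
    memLp_of_continuous (φs n).continuous (φc n)
  have m2 : ∀ n, MemLp (gradient (φ n)) 2 (volume.restrict (box d L)) := fun n =>
    memLp_of_continuous (continuous_gradient ((φs n).of_le (by simp)))
      (hasCompactSupport_gradient (φc n))
  have hVc : Continuous V := by
    have : LipschitzWith (Real.toNNReal M) V := LipschitzWith.of_dist_le_mul fun x y => by
      rw [Real.coe_toNNReal _ hM, Real.dist_eq, dist_eq_norm]
      exact hlip y x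
    exact this.continuous
  have mV : MemLp V 2 (volume.restrict (box d L)) := by
    refine memLp_of_continuous hVc (HasCompactSupport.of_support_subset_isCompact
      (isBounded_box d L).isCompact_closure fun x hx => subset_closure ?_)
    by_contra hc
    exact hx (hV0 x hc)
  -- The candidate for the weak gradient is constant on each open cell; the cells cover the box up to
  -- a null set.
  let Γ : E d → E d := fun x =>
    ∑ K ∈ hT.finite_cells.toFinset, (openCell K).indicator (fun _ => γ K) x
  have mΓ : MemLp Γ 2 (volume.restrict (box d L)) := by
    refine memLp_finsetSum _ fun K _ => ?_
    exact (memLp_const _).indicator (isOpen_openCell K).measurableSet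
  have hΓ : ∀ K ∈ cells 𝒯, ∀ x ∈ openCell K, Γ x = γ K := by
    intro K hK x hx
    simp only [Γ]
    rw [Finset.sum_eq_single K]
    · simp [hx]
    · intro K' hK' hne
      exact Set.indicator_of_notMem (fun hx' => Set.disjoint_left.1
        (disjoint_openCell (by simpa using hK') hK hne) hx' hx) _
    · intro hK'; exact absurd hK (by simpa using hK')
  have hae : ∀ᵐ x ∂volume.restrict (box d L), ∃ K ∈ cells 𝒯, x ∈ openCell K := by
    rw [ae_restrict_iff' hDm]
    filter_upwards [hT.ae_eq_biUnion] with x hx hxb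
    have : x ∈ ⋃ K ∈ hT.finite_cells.toFinset, openCell K := (iff_of_eq hx).1 hxb
    simpa using this
  have hγM : ∀ᵐ x ∂volume.restrict (box d L), ∀ᶠ n in Filter.atTop,
      gradient (φ n) x = (1 - δ n)⁻¹ • Γ x := by
    filter_upwards [hae] with x ⟨K, hK, hx⟩
    obtain ⟨c, hc⟩ := h.affine K hK
    obtain ⟨r, hr0, hr⟩ := Metric.isOpen_iff.1 (isOpen_openCell K) x hx
    have h1 : Filter.Tendsto (fun n => (2 * R + L) * δ n) Filter.atTop (nhds 0) := by
      simpa using hδlim.const_mul (2 * R + L)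
    filter_upwards [h1.eventually_lt_const hr0] with n hn
    rw [hΓ K hK x hx]
    refine φe n x (hT.openCell_subset_box hL hK hx) (γ K) c r (fun y hy => ?_) hn
    have hy' := hr hy
    rw [hV, Set.indicator_of_mem (hT.openCell_subset_box hL hK hy'),
      hc y (openCell_subset K hy')]
  have hgrad_lim : ∀ᵐ x ∂volume.restrict (box d L),
      Filter.Tendsto (fun n => gradient (φ n) x) Filter.atTop (nhds (Γ x)) := by
    filter_upwards [hγM] with x hx
    refine Filter.Tendsto.congr' (hx.mono fun n hn => hn.symm) ?_
    have : Filter.Tendsto (fun n => (1 - δ n)⁻¹ • Γ x) Filter.atTop (nhds ((1 - 0 : ℝ)⁻¹ • Γ x)) :=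
      ((tendsto_const_nhds.sub hδlim).inv₀ (by norm_num)).smul_const _
    simpa using this
  have hval_lim : ∀ᵐ x ∂volume.restrict (box d L),
      Filter.Tendsto (fun n => φ n x) Filter.atTop (nhds (V x)) := by
    rw [ae_restrict_iff' hDm]
    refine .of_forall fun x hx => ?_
    rw [tendsto_iff_norm_sub_tendsto_zero]
    refine squeeze_zero (fun n => norm_nonneg _) (fun n => φv n x hx) ?_
    simpa using (hδlim.const_mul (2 * R + L)).const_mul M
  -- Dominated convergence: `φ n` and its gradient are bounded uniformly in `n` on the bounded box.
  have hR0 : 0 ≤ R := by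
    obtain ⟨x, hx⟩ := box_nonempty d hL
    exact (norm_nonneg _).trans (hR' x hx)
  have hΓb : ∀ᵐ x ∂volume.restrict (box d L), ‖Γ x‖ ≤ 2 * M := by
    filter_upwards [hgrad_lim] with x hx
    exact le_of_tendsto hx.norm (.of_forall fun n => φg n x)
  let z : ℕ → L2Pair (box d L) := fun n => WithLp.toLp 2 ((m1 n).toLp _, (m2 n).toLp _)
  let w : L2Pair (box d L) := WithLp.toLp 2 (mV.toLp _, mΓ.toLp _)
  have hz : ∀ n, z n ∈ H10 (box d L) := fun n => testPairs_subset
    ⟨φ n, φs n, φc n, φt n, (m1 n).coeFn_toLp, (m2 n).coeFn_toLp⟩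
  have hlim1 : Filter.Tendsto (fun n => ∫ x in box d L, (φ n x - V x) ^ 2) Filter.atTop (nhds 0) := by
    have := tendsto_integral_of_dominated_convergence (μ := volume.restrict (box d L))
      (F := fun n x => (φ n x - V x) ^ 2) (f := fun _ => (0 : ℝ))
      (fun _ => (M * ((2 * R + L) * (1 / 2))) ^ 2)
      (fun n => (((φs n).continuous.sub hVc).pow 2).aestronglyMeasurable)
      (integrable_const _) (fun n => ?_) ?_
    · simpa using this
    · rw [ae_restrict_iff' hDm]
      refine .of_forall fun x hx => ?_
      rw [norm_pow, Real.norm_eq_abs]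
      have h1 := φv n x hx
      have h2 := hδ' n
      have h3 : M * ((2 * R + L) * δ n) ≤ M * ((2 * R + L) * (1 / 2)) := by gcongr
      exact pow_le_pow_left₀ (abs_nonneg _) (h1.trans h3) 2
    · filter_upwards [hval_lim] with x hx
      simpa using (hx.sub_const (V x)).pow 2
  have hlim2 : Filter.Tendsto (fun n => ∫ x in box d L, ‖gradient (φ n) x - Γ x‖ ^ 2) Filter.atTop
      (nhds 0) := by
    have := tendsto_integral_of_dominated_convergence (μ := volume.restrict (box d L))
      (F := fun n x => ‖gradient (φ n) x - Γ x‖ ^ 2) (f := fun _ => (0 : ℝ))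
      (fun _ => (4 * M) ^ 2)
      (fun n => (((m2 n).aestronglyMeasurable.sub mΓ.aestronglyMeasurable).norm.pow 2))
      (integrable_const _) (fun n => ?_) ?_
    · simpa using this
    · filter_upwards [hΓb] with x hx
      rw [norm_pow, norm_norm]
      have h1 := φg n x
      have h2 := norm_sub_le (gradient (φ n) x) (Γ x)
      exact pow_le_pow_left₀ (norm_nonneg _) (by linarith) 2
    · filter_upwards [hgrad_lim] with x hx
      simpa using (hx.sub_const (Γ x)).norm.pow 2
  have hnorm : ∀ n, ‖z n - w‖ ^ 2 = (∫ x in box d L, (φ n x - V x) ^ 2)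
      + ∫ x in box d L, ‖gradient (φ n) x - Γ x‖ ^ 2 := by
    intro n
    rw [WithLp.prod_norm_sq_eq_of_L2]
    have e1 : (z n - w).fst = ((m1 n).sub mV).toLp _ := (MemLp.toLp_sub (m1 n) mV).symm
    have e2 : (z n - w).snd = ((m2 n).sub mΓ).toLp _ := (MemLp.toLp_sub (m2 n) mΓ).symm
    rw [e1, e2, norm_sq_L2_real, norm_sq_L2]
    congr 1
    · refine integral_congr_ae ?_
      filter_upwards [((m1 n).sub mV).coeFn_toLp] with x hx
      rw [hx]; rfl
    · refine integral_congr_ae ?_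
      filter_upwards [((m2 n).sub mΓ).coeFn_toLp] with x hx
      rw [hx]; rfl
  have hlim : Filter.Tendsto z Filter.atTop (nhds w) := by
    rw [tendsto_iff_norm_sub_tendsto_zero]
    have h1 : Filter.Tendsto (fun n => ‖z n - w‖ ^ 2) Filter.atTop (nhds 0) := by
      simp_rw [hnorm]
      simpa using hlim1.add hlim2
    have h2 := h1.sqrt
    simpa [Real.sqrt_sq] using h2
  have hw : w ∈ H10 (box d L) :=
    (Submodule.isClosed_topologicalClosure _).mem_of_tendsto hlim (.of_forall hz)
  refine ⟨⟨w, hw⟩, ?_⟩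
  have : fn (⟨w, hw⟩ : H10 (box d L)) =ᵐ[volume.restrict (box d L)] V := mV.coeFn_toLp
  filter_upwards [this, ae_restrict_mem hDm] with x hx hxb
  rw [hx, hV, Set.indicator_of_mem hxb]

end

section

/-! ### The finite element space -/

/-- Every cell contains a ball of radius `r` and has diameter at most `σ r`. -/
structure IsShapeRegular {d : ℕ} (𝒯 : Geometry.SimplicialComplex ℝ (E d)) (σ r : ℝ) : Prop where
  pos : 0 < r
  ball : ∀ K ∈ cells 𝒯, ∃ c, Metric.ball c r ⊆ openCell K
  dist_le : ∀ K ∈ cells 𝒯, ∀ x ∈ convexHull ℝ (K : Set (E d)), ∀ y ∈ convexHull ℝ (K : Set (E d)),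
    dist x y ≤ σ * r

variable {d : ℕ} {𝒯 : Geometry.SimplicialComplex ℝ (E d)} {L σ r : ℝ}

lemma IsTriangulation.exists_cell (hL : 0 < L) (hT : IsTriangulation 𝒯 (box d L)) :
    (cells 𝒯).Nonempty := by
  obtain ⟨x, hx⟩ := box_nonempty d hL
  have := subset_closure hx
  rw [hT.closure_eq] at this
  obtain ⟨K, hK, -⟩ := Set.mem_iUnion₂.1 this
  exact ⟨K, hK⟩

lemma QuasiUniform.exists_isShapeRegular (hd : 0 < d) (hL : 0 < L) (hσ : 0 < σ)
    (hT : IsTriangulation 𝒯 (box d L)) (h : QuasiUniform 𝒯 σ) : ∃ r, IsShapeRegular 𝒯 σ r := by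
  obtain ⟨K', hK', hmax⟩ := hT.finite_cells.exists_maximalFor
    (fun K : Finset (E d) => Metric.diam (convexHull ℝ (K : Set (E d)))) _ (hT.exists_cell hL)
  have hmax' : ∀ K ∈ cells 𝒯, Metric.diam (convexHull ℝ (K : Set (E d)))
      ≤ Metric.diam (convexHull ℝ (K' : Set (E d))) := fun K hK => by
    by_contra! hc
    exact absurd (hmax hK hc.le) (not_le.2 hc)
  have hb : ∀ K : Finset (E d), Bornology.IsBounded (convexHull ℝ (K : Set (E d))) := fun K =>
    (isCompact_convexHull_finset K).isBounded
  have hpos : 0 < Metric.diam (convexHull ℝ (K' : Set (E d))) := by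
    obtain ⟨a, ha, b, hb', hab⟩ := Finset.one_lt_card.1 (show 1 < K'.card by rw [hK'.2]; omega)
    exact (dist_pos.2 hab).trans_le (Metric.dist_le_diam_of_mem (hb K')
      (subset_convexHull ℝ _ ha) (subset_convexHull ℝ _ hb'))
  refine ⟨Metric.diam (convexHull ℝ (K' : Set (E d))) / σ, div_pos hpos hσ, fun K hK => ?_,
    fun K hK x hx y hy => ?_⟩
  · obtain ⟨c, hc⟩ := h K hK K' hK'
    exact ⟨c, interior_maximal hc Metric.isOpen_ball⟩
  · rw [mul_div_cancel₀ _ hσ.ne']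
    exact (Metric.dist_le_diam_of_mem (hb K) hx hy).trans (hmax' K hK)

lemma exists_isPL_rep (u : Vh (box d L) 𝒯) : ∃ γ, IsPL 𝒯 (box d L) (rep u) γ :=
  (Classical.choose_spec u.2).exists_isPL

lemma fn_ae_eq_rep (u : Vh (box d L) 𝒯) :
    fn (u : H10 (box d L)) =ᵐ[volume.restrict (box d L)] rep u :=
  (Classical.choose_spec u.2).2.2

lemma IsPL.mem_Vh {D : Set (E d)} {u : H10 D} {v : E d → ℝ} {γ : Finset (E d) → E d}
    (h : IsPL 𝒯 D v γ) (hu : fn u =ᵐ[volume.restrict D] v) : u ∈ Vh D 𝒯 :=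
  ⟨v, h.isFERep hu⟩

lemma IsPL.grad_ae_eq (hL : 0 < L) (hT : IsTriangulation 𝒯 (box d L)) {u : H10 (box d L)}
    {v : E d → ℝ} {γ : Finset (E d) → E d} (h : IsPL 𝒯 (box d L) v γ)
    (hu : fn u =ᵐ[volume.restrict (box d L)] v) {K : Finset (E d)} (hK : K ∈ cells 𝒯) :
    ∀ᵐ x ∂volume.restrict (openCell K), grad u x = γ K := by
  obtain ⟨c, hc⟩ := h.affine K hK
  have hsub := hT.openCell_subset_box hL hK
  refine grad_ae_eq_of_affine (isOpen_box d L).measurableSet (isBounded_box d L) u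
    (isOpen_openCell K) hsub (c := c) ?_
  filter_upwards [ae_restrict_of_ae_restrict_of_subset hsub hu,
    ae_restrict_mem (isOpen_openCell K).measurableSet] with x hx hxK
  rw [hx, hc x (openCell_subset K hxK)]

lemma IsPL.inner_grad_eq_sum (hL : 0 < L) (hT : IsTriangulation 𝒯 (box d L))
    {u u' : H10 (box d L)} {v v' : E d → ℝ} {γ γ' : Finset (E d) → E d}
    (h : IsPL 𝒯 (box d L) v γ) (hu : fn u =ᵐ[volume.restrict (box d L)] v)
    (h' : IsPL 𝒯 (box d L) v' γ') (hu' : fn u' =ᵐ[volume.restrict (box d L)] v') :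
    inner ℝ (grad u) (grad u')
      = ∑ K ∈ hT.finite_cells.toFinset, volume.real (openCell K) * inner ℝ (γ K) (γ' K) := by
  rw [L2.inner_def, hT.setIntegral_eq_sum hL (L2.integrable_inner (𝕜 := ℝ) _ _)]
  refine Finset.sum_congr rfl fun K hK => ?_
  have hK' : K ∈ cells 𝒯 := by simpa using hK
  rw [← smul_eq_mul, ← setIntegral_const]
  refine integral_congr_ae ?_
  filter_upwards [h.grad_ae_eq hL hT hu hK', h'.grad_ae_eq hL hT hu' hK'] with x hx hx'
  rw [hx, hx']

lemma IsPL.norm_sq_fn_eq_sum (hL : 0 < L) (hT : IsTriangulation 𝒯 (box d L))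
    {u : H10 (box d L)} {v : E d → ℝ} (hu : fn u =ᵐ[volume.restrict (box d L)] v) :
    ‖fn u‖ ^ 2 = ∑ K ∈ hT.finite_cells.toFinset, ∫ x in openCell K, v x ^ 2 := by
  have h1 : ‖fn u‖ ^ 2 = ∫ x in box d L, v x ^ 2 := by
    rw [norm_sq_L2_real]
    refine integral_congr_ae ?_
    filter_upwards [hu] with x hx
    rw [hx]
  rw [h1, hT.setIntegral_eq_sum hL]
  refine (Lp.memLp (fn u)).integrable_sq.congr ?_
  filter_upwards [hu] with x hx
  rw [hx]

/-- The inverse estimate. -/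
lemma norm_grad_sq_mul_le (hL : 0 < L) (hσ : 0 < σ) (hT : IsTriangulation 𝒯 (box d L))
    (hr : IsShapeRegular 𝒯 σ r) (u : Vh (box d L) 𝒯) :
    ‖grad (u : H10 (box d L))‖ ^ 2 * r ^ 2 ≤ 4 * (4 * σ) ^ d * ‖fn (u : H10 (box d L))‖ ^ 2 := by
  obtain ⟨γ, hγ⟩ := exists_isPL_rep u
  have hu := fn_ae_eq_rep u
  rw [← real_inner_self_eq_norm_sq, hγ.inner_grad_eq_sum hL hT hu hγ hu,
    IsPL.norm_sq_fn_eq_sum hL hT hu, Finset.sum_mul, Finset.mul_sum]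
  refine Finset.sum_le_sum fun K hK => ?_
  have hK' : K ∈ cells 𝒯 := by simpa using hK
  obtain ⟨c, hc⟩ := hr.ball K hK'
  obtain ⟨b, hb⟩ := hγ.affine K hK'
  have hx0 : c ∈ convexHull ℝ (K : Set (E d)) :=
    openCell_subset K (hc (Metric.mem_ball_self hr.pos))
  rw [real_inner_self_eq_norm_sq, setIntegral_congr_fun (isOpen_openCell K).measurableSet
    (g := fun x => (inner ℝ (γ K) x + b) ^ 2) fun x hx => by
      dsimp only
      rw [hb x (openCell_subset K hx)]]
  exact inverse_estimate hr.pos hσ rfl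
    (fun x hx => hr.dist_le K hK' x (openCell_subset K hx) c hx0) hc

lemma coeFn_finsetSum {ι : Type*} {D : Set (E d)} (s : Finset ι) (f : ι → L2 D ℝ) :
    (∑ i ∈ s, f i : L2 D ℝ) =ᵐ[volume.restrict D] fun x => ∑ i ∈ s, f i x := by
  classical
  induction s using Finset.induction_on with
  | empty => exact Lp.coeFn_zero ℝ 2 (volume.restrict D)
  | insert a s ha ih =>
    rw [Finset.sum_insert ha]
    filter_upwards [Lp.coeFn_add (f a) (∑ i ∈ s, f i), ih] with x hx hx'
    rw [hx, Pi.add_apply, hx', Finset.sum_insert ha]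

/-- The finite element space is spanned by the nodal basis. -/
lemma finiteDimensional_Vh (hL : 0 < L) (hT : IsTriangulation 𝒯 (box d L)) :
    FiniteDimensional ℝ (Vh (box d L) 𝒯) := by
  classical
  let g : E d → E d → ℝ := fun a y => if y = a ∧ y ∉ frontier (box d L) then 1 else 0
  have hg : ∀ a, ∀ y ∈ frontier (box d L), g a y = 0 := fun a y hy => by simp [g, hy]
  choose γ hγ using fun a => exists_isPL_interp hT (hg a)
  choose Φ hΦ using fun a => (hγ a).exists_H10 hL hT
  let vtx : Finset (E d) := hT.finite_cells.toFinset.biUnion id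
  have hle : Vh (box d L) 𝒯 ≤ Submodule.span ℝ (Φ '' (vtx : Set (E d))) := by
    intro u hu
    have key : u = ∑ a ∈ vtx, rep (⟨u, hu⟩ : Vh (box d L) 𝒯) a • Φ a := by
      set v := rep (⟨u, hu⟩ : Vh (box d L) 𝒯) with hv
      obtain ⟨γ', hγ'⟩ := exists_isPL_rep (⟨u, hu⟩ : Vh (box d L) 𝒯)
      rw [← hv] at hγ'
      have hfn : fn (∑ a ∈ vtx, v a • Φ a) = ∑ a ∈ vtx, v a • fn (Φ a) := by
        induction vtx using Finset.induction_on with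
        | empty => rfl
        | insert a s ha ih => rw [Finset.sum_insert ha, Finset.sum_insert ha, fn_add, fn_smul, ih]
      refine fn_injective (isOpen_box d L) (isBounded_box d L) ?_
      rw [hfn]
      refine Lp.ext ?_
      have h1 : ∀ᵐ x ∂volume.restrict (box d L), ∀ a ∈ vtx,
          (v a • fn (Φ a) : L2 (box d L) ℝ) x = v a * interp 𝒯 (g a) x := by
        rw [Filter.eventually_all_finset]
        intro a _
        filter_upwards [Lp.coeFn_smul (v a) (fn (Φ a)), hΦ a] with x hx hx'
        rw [hx, Pi.smul_apply, hx', smul_eq_mul]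
      have h2 := coeFn_finsetSum vtx (fun a => (v a • fn (Φ a) : L2 (box d L) ℝ))
      filter_upwards [fn_ae_eq_rep (⟨u, hu⟩ : Vh (box d L) 𝒯), h1, h2,
        ae_restrict_mem (isOpen_box d L).measurableSet] with x hx hx1 hx2 hxb
      have hx3 := subset_closure hxb
      rw [hT.closure_eq] at hx3
      obtain ⟨K, hK, hxK⟩ := Set.mem_iUnion₂.1 hx3
      obtain ⟨w, hz, h0, hw1, hw2⟩ := exists_weights hxK
      obtain ⟨c, hc⟩ := hγ'.affine K hK
      rw [hx, hx2, Finset.sum_congr rfl hx1]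
      simp_rw [interp_eq_sum hK.1 hz h0 hw1 hw2]
      simp_rw [Finset.mul_sum]
      rw [Finset.sum_comm]
      refine (hc x hxK).trans ?_
      calc inner ℝ (γ' K) x + c = ∑ b ∈ K, w b * v b := by
            conv_lhs => rw [← hw2, inner_sum, ← mul_one c, ← hw1, Finset.mul_sum,
              ← Finset.sum_add_distrib]
            refine Finset.sum_congr rfl fun b hb => ?_
            rw [hc b (subset_convexHull ℝ _ hb), inner_smul_right]
            ring
        _ = _ := by
            refine Finset.sum_congr rfl fun b hb => ?_
            by_cases hbf : b ∈ frontier (box d L)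
            · simp [g, hbf, hγ'.zero b hbf]
            · rw [Finset.sum_eq_single b]
              · simp [g, hbf]; ring
              · intro a _ hab
                simp [g, hab.symm]
              · intro hb'
                exact absurd (Finset.mem_biUnion.2 ⟨K, by simpa using hK, hb⟩) hb'
    rw [key]
    exact Submodule.sum_mem _ fun a ha => Submodule.smul_mem _ _
      (Submodule.subset_span ⟨a, ha, rfl⟩)
  have : FiniteDimensional ℝ (Submodule.span ℝ (Φ '' (vtx : Set (E d)))) :=
    FiniteDimensional.span_of_finite ℝ (vtx.finite_toSet.image _)
  exact Submodule.finiteDimensional_of_le hle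

/-- The linear map underlying `fn`. -/
noncomputable def fnₗ (D : Set (E d)) : H10 D →ₗ[ℝ] L2 D ℝ where
  toFun := fn
  map_add' := fn_add
  map_smul' := fn_smul

/-- The linear map underlying `grad`. -/
noncomputable def gradₗ (D : Set (E d)) : H10 D →ₗ[ℝ] L2 D (E d) where
  toFun := grad
  map_add' := grad_add
  map_smul' := grad_smul

lemma exists_linearMap_of_injective {V M : Type*} [AddCommGroup V] [Module ℝ V]
    [FiniteDimensional ℝ V] [AddCommGroup M] [Module ℝ M] (b : V →ₗ[ℝ] Module.Dual ℝ V)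
    (hb : Function.Injective b) (β : M →ₗ[ℝ] Module.Dual ℝ V) :
    ∃ A : M →ₗ[ℝ] V, ∀ m, b (A m) = β m := by
  let e := LinearEquiv.ofInjectiveOfFinrankEq b hb Subspace.dual_finrank_eq.symm
  exact ⟨e.symm.toLinearMap.comp β, fun m => e.apply_symm_apply (β m)⟩

/-- Riesz representation in `V_h` with the `L²` inner product. -/
lemma exists_riesz (hL : 0 < L) (hT : IsTriangulation 𝒯 (box d L)) {M : Type*} [AddCommGroup M]
    [Module ℝ M] (β : M →ₗ[ℝ] Vh (box d L) 𝒯 →ₗ[ℝ] ℝ) :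
    ∃ A : M →ₗ[ℝ] Vh (box d L) 𝒯, ∀ m (v : Vh (box d L) 𝒯),
      inner ℝ (fn (A m : H10 (box d L))) (fn (v : H10 (box d L))) = β m v := by
  have := finiteDimensional_Vh hL hT
  let J : Vh (box d L) 𝒯 →ₗ[ℝ] L2 (box d L) ℝ := (fnₗ (box d L)).comp (Submodule.subtype _)
  let b : Vh (box d L) 𝒯 →ₗ[ℝ] Vh (box d L) 𝒯 →ₗ[ℝ] ℝ := (innerₗ (L2 (box d L) ℝ)).compl₁₂ J J
  have hb : ∀ u v : Vh (box d L) 𝒯,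
      b u v = inner ℝ (fn (u : H10 (box d L))) (fn (v : H10 (box d L))) := fun u v => rfl
  have hinj : Function.Injective b := by
    rw [injective_iff_map_eq_zero]
    intro u hu
    have h1 := LinearMap.congr_fun hu u
    rw [hb, LinearMap.zero_apply, inner_self_eq_zero] at h1
    exact Subtype.ext (fn_injective (isOpen_box d L) (isBounded_box d L) (v := 0) h1)
  obtain ⟨A, hA⟩ := exists_linearMap_of_injective b hinj β
  exact ⟨A, fun m v => by rw [← hb, hA]⟩

/-- `Ph` is the `L²` projection onto the finite element space. -/
def IsL2Proj {D : Set (E d)} (Ph : H10 D →ₗ[ℝ] Vh D 𝒯) : Prop :=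
  ∀ (w : H10 D) (v : Vh D 𝒯),
    inner ℝ (fn (Ph w : H10 D)) (fn (v : H10 D)) = inner ℝ (fn w) (fn (v : H10 D))

/-- `B` is the negative discrete Laplacian. -/
def IsNegLaplacian {D : Set (E d)} (B : Vh D 𝒯 →ₗ[ℝ] Vh D 𝒯) : Prop :=
  ∀ u v : Vh D 𝒯,
    inner ℝ (fn (B u : H10 D)) (fn (v : H10 D)) = inner ℝ (grad (u : H10 D)) (grad (v : H10 D))

lemma exists_isL2Proj (hL : 0 < L) (hT : IsTriangulation 𝒯 (box d L)) :
    ∃ Ph : H10 (box d L) →ₗ[ℝ] Vh (box d L) 𝒯, IsL2Proj Ph :=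
  exists_riesz hL hT ((innerₗ (L2 (box d L) ℝ)).compl₁₂ (fnₗ (box d L))
    ((fnₗ (box d L)).comp (Submodule.subtype _)))

lemma exists_isNegLaplacian (hL : 0 < L) (hT : IsTriangulation 𝒯 (box d L)) :
    ∃ B : Vh (box d L) 𝒯 →ₗ[ℝ] Vh (box d L) 𝒯, IsNegLaplacian B :=
  exists_riesz hL hT ((innerₗ (L2 (box d L) (E d))).compl₁₂
    ((gradₗ (box d L)).comp (Submodule.subtype _)) ((gradₗ (box d L)).comp (Submodule.subtype _)))

lemma IsL2Proj.norm_fn_le {D : Set (E d)} {Ph : H10 D →ₗ[ℝ] Vh D 𝒯} (h : IsL2Proj Ph) (w : H10 D) :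
    ‖fn (Ph w : H10 D)‖ ≤ ‖fn w‖ := by
  have h1 := h w (Ph w)
  rw [real_inner_self_eq_norm_sq] at h1
  have h2 := real_inner_le_norm (fn w) (fn (Ph w : H10 D))
  rcases (norm_nonneg (fn (Ph w : H10 D))).eq_or_lt with h0 | h0
  · rw [← h0]; exact norm_nonneg _
  · nlinarith

lemma eq_of_inner_fn_eq {u w : Vh (box d L) 𝒯}
    (h : ∀ v : Vh (box d L) 𝒯, inner ℝ (fn (u : H10 (box d L))) (fn (v : H10 (box d L)))
      = inner ℝ (fn (w : H10 (box d L))) (fn (v : H10 (box d L)))) : u = w := by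
  have h1 : ∀ v : Vh (box d L) 𝒯,
      inner ℝ (fn ((u - w : Vh (box d L) 𝒯) : H10 (box d L))) (fn (v : H10 (box d L))) = 0 := by
    intro v
    rw [Submodule.coe_sub, fn_sub, inner_sub_left, h, sub_self]
  have h2 := inner_self_eq_zero.1 (h1 (u - w))
  have h3 : ((u - w : Vh (box d L) 𝒯) : H10 (box d L)) = 0 :=
    fn_injective (isOpen_box d L) (isBounded_box d L) h2
  exact sub_eq_zero.1 (Subtype.ext h3)

lemma IsL2Proj.apply_of_mem {Ph : H10 (box d L) →ₗ[ℝ] Vh (box d L) 𝒯} (h : IsL2Proj Ph)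
    (u : Vh (box d L) 𝒯) : Ph u = u :=
  eq_of_inner_fn_eq fun v => h u v

end

section

/-! ### Quasi-interpolation and stability of the `L²` projection in `H¹` -/

variable {d : ℕ} {𝒯 : Geometry.SimplicialComplex ℝ (E d)} {L σ r : ℝ}

/-- The mean square oscillation of `φ` about `x` at the scale `h`; the average is taken over a ball
of radius `3 h`, but normalized by the volume of a ball of radius `h`. -/
noncomputable def meanSqOsc (φ : E d → ℝ) (h : ℝ) (x : E d) : ℝ :=
  (volume.real (Metric.ball (0 : E d) h))⁻¹ *
    ∫ z in Metric.ball (0 : E d) (3 * h), (φ (x + z) - φ x) ^ 2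

lemma volume_real_ball_pos {h : ℝ} (hh : 0 < h) (b : E d) : 0 < volume.real (Metric.ball b h) :=
  ENNReal.toReal_pos (Metric.measure_ball_pos volume b hh).ne' measure_ball_lt_top.ne

lemma meanSqOsc_nonneg {h : ℝ} (φ : E d → ℝ) (x : E d) : 0 ≤ meanSqOsc φ h x :=
  mul_nonneg (inv_nonneg.2 ENNReal.toReal_nonneg) (integral_nonneg fun _ => sq_nonneg _)

lemma sq_average_sub_le {φ : E d → ℝ} (hφ : Continuous φ) {h : ℝ} (hh : 0 < h) {b x : E d}
    (hbx : dist b x ≤ 2 * h) :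
    ((volume.real (Metric.ball b h))⁻¹ * (∫ y in Metric.ball b h, φ y) - φ x) ^ 2
      ≤ meanSqOsc φ h x := by
  set m := (volume.real (Metric.ball b h))⁻¹ * (∫ y in Metric.ball b h, φ y) with hm
  have hpos := volume_real_ball_pos hh b
  have hvol : volume.real (Metric.ball (0 : E d) h) = volume.real (Metric.ball b h) := by
    simp [Measure.real, Measure.addHaar_ball_center]
  have hm' : ∫ y in Metric.ball b h, φ y = volume.real (Metric.ball b h) * m := by
    rw [hm]; field_simp
  have i1 : ∀ f : E d → ℝ, Continuous f → IntegrableOn f (Metric.ball b h) := fun f hf =>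
    integrableOn_of_isBounded hf Metric.isBounded_ball
  have h1 : volume.real (Metric.ball b h) * (m - φ x) ^ 2
      ≤ ∫ y in Metric.ball b h, (φ y - φ x) ^ 2 := by
    have h2 : ∫ y in Metric.ball b h, ((m - φ x) ^ 2 + 2 * (m - φ x) * (φ y - m))
        ≤ ∫ y in Metric.ball b h, (φ y - φ x) ^ 2 := by
      refine setIntegral_mono (i1 _ (by fun_prop)) (i1 _ (by fun_prop)) fun y => ?_
      dsimp only
      nlinarith [sq_nonneg (φ y - m)]
    rw [integral_add (i1 _ (by fun_prop)) (i1 _ (by fun_prop)), integral_const_mul,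
      integral_sub (i1 _ hφ) (i1 _ (by fun_prop)), hm', setIntegral_const, setIntegral_const] at h2
    simpa using h2
  have h3 : ∫ y in Metric.ball b h, (φ y - φ x) ^ 2
      ≤ ∫ y in Metric.ball x (3 * h), (φ y - φ x) ^ 2 := by
    refine setIntegral_mono_set (integrableOn_of_isBounded (by fun_prop) Metric.isBounded_ball)
      (.of_forall fun _ => sq_nonneg _) (LE.le.eventuallyLE (Metric.ball_subset_ball' ?_))
    linarith
  have h4 : ∫ y in Metric.ball x (3 * h), (φ y - φ x) ^ 2
      = ∫ z in Metric.ball (0 : E d) (3 * h), (φ (x + z) - φ x) ^ 2 := by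
    rw [← (measurePreserving_add_left volume x).setIntegral_preimage_emb
      (measurableEmbedding_addLeft x) (fun y => (φ y - φ x) ^ 2)]
    congr 2
    ext y
    simp [dist_eq_norm]
  rw [meanSqOsc, hvol, le_inv_mul_iff₀ hpos, ← h4]
  exact h1.trans h3

/-- Averaging the bound on translates over the ball of radius `3 h`. -/
lemma integral_meanSqOsc_le {φ : E d → ℝ} (hφ : ContDiff ℝ 1 φ) (hs : HasCompactSupport φ) {h : ℝ}
    (hh : 0 < h) {D : Set (E d)} (hD : Bornology.IsBounded D) :
    IntegrableOn (meanSqOsc φ h) D ∧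
      ∫ x in D, meanSqOsc φ h x ≤ 3 ^ d * 9 * h ^ 2 * ∫ x, ‖gradient φ x‖ ^ 2 := by
  have hc := hφ.continuous
  have hpos := volume_real_ball_pos hh (0 : E d)
  set B := Metric.ball (0 : E d) (3 * h) with hB
  have hF : Continuous fun p : E d × E d => (φ (p.1 + p.2) - φ p.1) ^ 2 := by fun_prop
  have hint : Integrable (fun p : E d × E d => (φ (p.1 + p.2) - φ p.1) ^ 2)
      ((volume.restrict D).prod (volume.restrict B)) := by
    rw [Measure.prod_restrict]
    have : IsCompact (closure D ×ˢ closure B) :=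
      hD.isCompact_closure.prod Metric.isBounded_ball.isCompact_closure
    exact (hF.continuousOn.integrableOn_compact this).mono_set
      (Set.prod_mono subset_closure subset_closure)
  have hsq : Integrable fun x => ‖gradient φ x‖ ^ 2 := integrable_gradient_sq hφ hs
  have hφ2 : ∀ z : E d, Integrable fun x => (φ (x + z) - φ x) ^ 2 := by
    intro z
    have i1 : Integrable fun x => φ x := hc.integrable_of_hasCompactSupport hs
    have i3 : HasCompactSupport fun x => φ (x + z) :=
      hs.comp_homeomorph (Homeomorph.addRight z)
    exact Continuous.integrable_of_hasCompactSupport (by fun_prop)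
      ((i3.sub hs).comp_left (g := fun v => v ^ 2) (by simp))
  have hG0 : 0 ≤ ∫ x, ‖gradient φ x‖ ^ 2 := integral_nonneg fun _ => by positivity
  refine ⟨hint.integral_prod_left.const_mul _, ?_⟩
  simp only [meanSqOsc]
  rw [integral_const_mul, integral_integral_swap hint, inv_mul_le_iff₀ hpos]
  calc ∫ z in B, ∫ x in D, (φ (x + z) - φ x) ^ 2
      ≤ ∫ z in B, (9 * h ^ 2 * ∫ x, ‖gradient φ x‖ ^ 2) := by
        refine setIntegral_mono_on hint.integral_prod_right
          (integrableOn_of_isBounded continuous_const Metric.isBounded_ball)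
          Metric.isOpen_ball.measurableSet fun z hz => ?_
        calc ∫ x in D, (φ (x + z) - φ x) ^ 2 ≤ ∫ x, (φ (x + z) - φ x) ^ 2 :=
              setIntegral_le_integral (hφ2 z) (.of_forall fun _ => sq_nonneg _)
          _ ≤ ‖z‖ ^ 2 * ∫ x, ‖gradient φ x‖ ^ 2 := integral_translate_sub_le hφ hs z
          _ ≤ (3 * h) ^ 2 * ∫ x, ‖gradient φ x‖ ^ 2 := by
              have := (mem_ball_zero_iff.1 hz).le
              gcongr
          _ = _ := by ring
    _ = volume.real B * (9 * h ^ 2 * ∫ x, ‖gradient φ x‖ ^ 2) := by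
        rw [setIntegral_const, smul_eq_mul]
    _ = _ := by
        have : volume.real B = 3 ^ d * volume.real (Metric.ball (0 : E d) h) := by
          rw [hB, Measure.real, Measure.addHaar_ball_mul_of_pos _ _ (by norm_num) h,
            ENNReal.toReal_mul, finrank_euclideanSpace, Fintype.card_fin,
            ENNReal.toReal_ofReal (by positivity)]
          rfl
        rw [this]; ring

/-- A boundary vertex has a ball of radius `h` within reach that lies outside the box. -/
lemma exists_exterior_ball {a : E d} (ha : a ∈ frontier (box d L)) {h : ℝ} (hh : 0 < h) :
    ∃ b, dist b a ≤ h ∧ Disjoint (Metric.ball b h) (box d L) := by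
  obtain ⟨-, i, hi⟩ := mem_frontier_box.1 ha
  have hcoord : ∀ x b : E d, x ∈ Metric.ball b h → |x i - b i| < h := fun x b hx => by
    rw [mem_ball_iff_norm] at hx
    exact (PiLp.norm_apply_le (x - b) i).trans_lt hx
  rcases hi with hi | hi
  · refine ⟨a - EuclideanSpace.single i h, ?_, Set.disjoint_left.2 fun x hx hxb => ?_⟩
    · simp [abs_of_pos hh]
    · have h1 := (abs_lt.1 (hcoord _ _ hx)).2
      have h2 := (hxb i).1
      simp [hi] at h1
      linarith
  · refine ⟨a + EuclideanSpace.single i h, ?_, Set.disjoint_left.2 fun x hx hxb => ?_⟩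
    · simp [dist_eq_norm, abs_of_pos hh]
    · have h1 := (abs_lt.1 (hcoord _ _ hx)).1
      have h2 := (hxb i).2
      simp [hi] at h1
      linarith

/-- Quasi-interpolation: the nodal values are averages over balls near the vertices. For a vertex on
the boundary the ball lies outside the box, so that the average vanishes. -/
lemma exists_quasiInterp (hL : 0 < L) (hσ : 0 < σ) (hT : IsTriangulation 𝒯 (box d L))
    (hr : IsShapeRegular 𝒯 σ r) {w : H10 (box d L)} {φ : E d → ℝ}
    (hφ : ContDiff ℝ ((⊤ : ℕ∞) : WithTop ℕ∞) φ) (hs : HasCompactSupport φ)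
    (hsub : tsupport φ ⊆ box d L) (hw : fn w =ᵐ[volume.restrict (box d L)] φ)
    (hgw : grad w =ᵐ[volume.restrict (box d L)] gradient φ) :
    ∃ u : Vh (box d L) 𝒯,
      ‖fn (u - w : H10 (box d L))‖ ^ 2 ≤ 3 ^ d * 9 * (σ * r) ^ 2 * ‖grad w‖ ^ 2 ∧
      ‖grad (u : H10 (box d L))‖ ^ 2 * r ^ 2 ≤ 4 * (3 ^ d * 9 * (σ * r) ^ 2 * ‖grad w‖ ^ 2) := by
  classical
  have hr0 := hr.pos
  set h := σ * r with hh_def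
  have hh : 0 < h := mul_pos hσ hr.pos
  have hφc := hφ.continuous
  have hDm : MeasurableSet (box d L) := (isOpen_box d L).measurableSet
  have hφ0 : ∀ x, x ∉ box d L → φ x = 0 := fun x hx =>
    image_eq_zero_of_notMem_tsupport fun h => hx (hsub h)
  have hb : ∀ a : E d, ∃ b, dist b a ≤ h ∧
      (a ∈ frontier (box d L) → Disjoint (Metric.ball b h) (box d L)) := by
    intro a
    by_cases ha : a ∈ frontier (box d L)
    · obtain ⟨b, h1, h2⟩ := exists_exterior_ball ha hh
      exact ⟨b, h1, fun _ => h2⟩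
    · exact ⟨a, by simpa using hh.le, fun h => absurd h ha⟩
  choose b hb1 hb2 using hb
  let g : E d → ℝ := fun a => (volume.real (Metric.ball (b a) h))⁻¹ * ∫ y in Metric.ball (b a) h, φ y
  have hg : ∀ a ∈ frontier (box d L), g a = 0 := by
    intro a ha
    have : ∫ y in Metric.ball (b a) h, φ y = 0 :=
      setIntegral_eq_zero_of_forall_eq_zero fun y hy =>
        hφ0 y (Set.disjoint_left.1 (hb2 a ha) hy)
    simp [g, this]
  obtain ⟨γ, hγ⟩ := exists_isPL_interp hT hg
  obtain ⟨u, hu⟩ := hγ.exists_H10 hL hT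
  -- For fixed `x` in the cell, each nodal value differs from `φ x` by at most the oscillation, hence
  -- so does the affine function on the whole cell; this bounds its gradient as well.
  have hpt : ∀ K ∈ cells 𝒯, ∀ x ∈ openCell K,
      (interp 𝒯 g x - φ x) ^ 2 ≤ meanSqOsc φ h x ∧ ‖γ K‖ ^ 2 * r ^ 2 ≤ 4 * meanSqOsc φ h x := by
    intro K hK x hx
    obtain ⟨c, hc⟩ := hγ.affine K hK
    have hx' := openCell_subset K hx
    have hvert : ∀ a ∈ (K : Set (E d)), |inner ℝ (γ K) a + c - φ x| ≤ √(meanSqOsc φ h x) := by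
      intro a ha
      have ha' : a ∈ convexHull ℝ (K : Set (E d)) := subset_convexHull ℝ _ ha
      rw [← hc a ha', interp_apply_vertex hK.1 g ha]
      refine Real.abs_le_sqrt (sq_average_sub_le hφc hh ?_)
      calc dist (b a) x ≤ dist (b a) a + dist a x := dist_triangle _ _ _
        _ ≤ h + h := add_le_add (hb1 a) (hr.dist_le K hK a ha' x hx')
        _ = 2 * h := by ring
    have hall : ∀ y ∈ convexHull ℝ (K : Set (E d)),
        |inner ℝ (γ K) y + c - φ x| ≤ √(meanSqOsc φ h x) := fun y hy =>
      abs_sub_le_of_mem_convexHull hvert hy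
    have hsq : √(meanSqOsc φ h x) ^ 2 = meanSqOsc φ h x := Real.sq_sqrt (meanSqOsc_nonneg φ x)
    constructor
    · rw [← hsq, ← sq_abs, hc x hx']
      exact pow_le_pow_left₀ (abs_nonneg _) (hall x hx') 2
    · obtain ⟨c', hc'⟩ := hr.ball K hK
      have h1 := norm_mul_le_of_ball_subset hr.pos
        fun y hy => hall y (openCell_subset K (hc' hy))
      have h2 := pow_le_pow_left₀ (by positivity) h1 2
      rw [mul_pow, mul_pow, hsq] at h2
      linarith
  have hae : ∀ᵐ x ∂volume.restrict (box d L), ∃ K ∈ cells 𝒯, x ∈ openCell K := by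
    rw [ae_restrict_iff' hDm]
    filter_upwards [hT.ae_eq_biUnion] with x hx hxb
    have : x ∈ ⋃ K ∈ hT.finite_cells.toFinset, openCell K := (iff_of_eq hx).1 hxb
    simpa using this
  have hgr : ∀ᵐ x ∂volume.restrict (box d L), ∀ K ∈ hT.finite_cells.toFinset, x ∈ openCell K →
      grad u x = γ K := by
    rw [Filter.eventually_all_finset]
    intro K hK
    have hK' : K ∈ cells 𝒯 := by simpa using hK
    have := hγ.grad_ae_eq hL hT hu hK'
    rw [ae_restrict_iff' (isOpen_openCell K).measurableSet] at this
    exact ae_restrict_of_ae this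
  obtain ⟨hint, hle⟩ := integral_meanSqOsc_le (hφ.of_le (by simp)) hs hh (isBounded_box d L)
  have hgrad : ∫ x, ‖gradient φ x‖ ^ 2 = ‖grad w‖ ^ 2 := by
    rw [norm_sq_L2, ← setIntegral_eq_integral_of_tsupport (D := box d L) fun x hx => by
      rw [gradient, fderiv_of_notMem_tsupport ℝ fun h => hx (hsub h)]; simp]
    refine integral_congr_ae ?_
    filter_upwards [hgw] with x hx
    rw [hx]
  rw [hgrad] at hle
  refine ⟨⟨u, hγ.mem_Vh hu⟩, le_trans ?_ hle, le_trans ?_ (mul_le_mul_of_nonneg_left hle four_pos.le)⟩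
  · rw [norm_sq_L2_real]
    refine integral_mono_of_nonneg (.of_forall fun _ => sq_nonneg _) hint ?_
    have h2 := Lp.coeFn_sub (fn u) (fn w)
    filter_upwards [hae, hu, hw, h2] with x ⟨K, hK, hx⟩ hux hwx h2x
    rw [fn_sub]
    rw [h2x, Pi.sub_apply, hux, hwx]
    exact (hpt K hK x hx).1
  · rw [norm_sq_L2, ← integral_mul_const, ← integral_const_mul]
    refine integral_mono_of_nonneg (.of_forall fun _ => by positivity) (hint.const_mul 4) ?_
    filter_upwards [hae, hgr] with x ⟨K, hK, hx⟩ hgx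
    rw [hgx K (by simpa using hK) hx]
    exact (hpt K hK x hx).2

/-- The `L²` projection is continuous on `H¹₀`, by the inverse estimate on the given mesh. -/
lemma IsL2Proj.continuous (hL : 0 < L) (hσ : 0 < σ) (hT : IsTriangulation 𝒯 (box d L))
    (hr : IsShapeRegular 𝒯 σ r) {Ph : H10 (box d L) →ₗ[ℝ] Vh (box d L) 𝒯} (hP : IsL2Proj Ph) :
    Continuous Ph := by
  have hr0 := hr.pos
  set c := 4 * (4 * σ) ^ d / r ^ 2 + 1 with hc
  have hc0 : 0 ≤ c := by positivity
  refine (LinearMap.mkContinuous Ph (√c) fun w => ?_).continuous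
  refine (sq_le_sq₀ (norm_nonneg _) (by positivity)).1 ?_
  rw [mul_pow, Real.sq_sqrt hc0]
  have h1 := norm_grad_sq_mul_le hL hσ hT hr (Ph w)
  have h2 := pow_le_pow_left₀ (norm_nonneg _) (hP.norm_fn_le w) 2
  have h3 : ‖fn w‖ ^ 2 ≤ ‖w‖ ^ 2 := by nlinarith [norm_sq_eq w, sq_nonneg ‖grad w‖]
  have h4 : ‖Ph w‖ ^ 2 = ‖fn (Ph w : H10 (box d L))‖ ^ 2 + ‖grad (Ph w : H10 (box d L))‖ ^ 2 :=
    norm_sq_eq _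
  have h5 : ‖grad (Ph w : H10 (box d L))‖ ^ 2
      ≤ 4 * (4 * σ) ^ d / r ^ 2 * ‖fn (Ph w : H10 (box d L))‖ ^ 2 := by
    rw [div_mul_eq_mul_div, le_div_iff₀ (by positivity)]
    exact h1
  calc ‖Ph w‖ ^ 2 ≤ c * ‖fn (Ph w : H10 (box d L))‖ ^ 2 := by rw [h4, hc]; linarith
    _ ≤ c * ‖w‖ ^ 2 := mul_le_mul_of_nonneg_left (h2.trans h3) hc0

/-- On a shape regular triangulation the `L²` projection is bounded with respect to the norm of the
gradient: its difference from the quasi-interpolant is controlled by the inverse estimate. -/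
lemma IsL2Proj.norm_grad_sq_le (hL : 0 < L) (hσ : 0 < σ) (hT : IsTriangulation 𝒯 (box d L))
    (hr : IsShapeRegular 𝒯 σ r) {Ph : H10 (box d L) →ₗ[ℝ] Vh (box d L) 𝒯} (hP : IsL2Proj Ph)
    (w : H10 (box d L)) :
    ‖grad (Ph w : H10 (box d L))‖ ^ 2
      ≤ 72 * ((4 * σ) ^ d + 1) * 3 ^ d * σ ^ 2 * ‖grad w‖ ^ 2 := by
  have hcont : Continuous fun w => grad (Ph w : H10 (box d L)) :=
    continuous_grad.comp (continuous_subtype_val.comp (hP.continuous hL hσ hT hr))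
  refine H10_induction (p := fun w => ‖grad (Ph w : H10 (box d L))‖ ^ 2
      ≤ 72 * ((4 * σ) ^ d + 1) * 3 ^ d * σ ^ 2 * ‖grad w‖ ^ 2)
    (isClosed_le (hcont.norm.pow 2) (continuous_const.mul (continuous_grad.norm.pow 2))) ?_ w
  intro w φ h1 h2 h3 h4 h5
  obtain ⟨u, hu1, hu2⟩ := exists_quasiInterp hL hσ hT hr h1 h2 h3 h4 h5
  have hr0 := hr.pos
  set S := 3 ^ d * 9 * (σ * r) ^ 2 * ‖grad w‖ ^ 2 with hS
  -- `Ph w = u - Ph (u - w)`, as `Ph` fixes the quasi-interpolant `u`.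
  have e1 : Ph w = u - Ph ((u : H10 (box d L)) - w) := by
    rw [map_sub, hP.apply_of_mem]; abel
  have e2 := norm_grad_sq_mul_le hL hσ hT hr (Ph ((u : H10 (box d L)) - w))
  have e3 := hP.norm_fn_le ((u : H10 (box d L)) - w)
  have e4 : ‖fn (Ph ((u : H10 (box d L)) - w) : H10 (box d L))‖ ^ 2 ≤ S :=
    (pow_le_pow_left₀ (norm_nonneg _) e3 2).trans hu1
  have e5 : ‖grad (Ph w : H10 (box d L))‖ ≤ ‖grad (u : H10 (box d L))‖
      + ‖grad (Ph ((u : H10 (box d L)) - w) : H10 (box d L))‖ := by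
    conv_lhs => rw [e1]
    rw [Submodule.coe_sub, grad_sub]
    exact norm_sub_le _ _
  set A := ‖grad (u : H10 (box d L))‖
  set B := ‖grad (Ph ((u : H10 (box d L)) - w) : H10 (box d L))‖
  have e6 : ‖grad (Ph w : H10 (box d L))‖ ^ 2 ≤ 2 * A ^ 2 + 2 * B ^ 2 := by
    have := pow_le_pow_left₀ (norm_nonneg _) e5 2
    nlinarith [sq_nonneg (A - B)]
  have e7 : B ^ 2 * r ^ 2 ≤ 4 * (4 * σ) ^ d * S := e2.trans (by gcongr)
  refine le_of_mul_le_mul_right (a := r ^ 2) ?_ (by positivity)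
  calc ‖grad (Ph w : H10 (box d L))‖ ^ 2 * r ^ 2 ≤ (2 * A ^ 2 + 2 * B ^ 2) * r ^ 2 := by gcongr
    _ = 2 * (A ^ 2 * r ^ 2) + 2 * (B ^ 2 * r ^ 2) := by ring
    _ ≤ 2 * (4 * S) + 2 * (4 * (4 * σ) ^ d * S) := by gcongr
    _ = _ := by rw [hS]; ring

end

/-! ### The cotangent formula -/

/-- The determinant of two vectors in the plane. -/
def det₂ (p q : E 2) : ℝ := p 0 * q 1 - p 1 * q 0

lemma cot_angle (a b c : E 2) :
    Real.cot (EuclideanGeometry.angle a c b) = inner ℝ (a - c) (b - c) / |det₂ (a - c) (b - c)| := by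
  set x := a - c
  set y := b - c
  have hang : EuclideanGeometry.angle a c b = InnerProductGeometry.angle x y := rfl
  have h1 := InnerProductGeometry.cos_angle_mul_norm_mul_norm x y
  have h2 := InnerProductGeometry.sin_angle_mul_norm_mul_norm x y
  have h3 : inner ℝ x x * inner ℝ y y - inner ℝ x y * inner ℝ x y = det₂ x y ^ 2 := by
    simp only [PiLp.inner_apply, Fin.sum_univ_two, RCLike.inner_apply, conj_trivial, det₂]
    ring
  rw [h3, Real.sqrt_sq_eq_abs] at h2
  rw [hang, Real.cot_eq_cos_div_sin, ← h1, ← h2]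
  by_cases hxy : ‖x‖ * ‖y‖ = 0
  · have : x = 0 ∨ y = 0 := by simpa using hxy
    rcases this with h | h <;> simp [h, Real.cos_pi_div_two]
  · rw [mul_div_mul_right _ _ hxy]

lemma det_sq_mul_inner (a b c γ γ' : E 2) :
    det₂ (b - a) (c - a) ^ 2 * inner ℝ γ γ'
      = inner ℝ (a - c) (b - c) * (inner ℝ γ (a - b) * inner ℝ γ' (a - b))
      + inner ℝ (a - b) (c - b) * (inner ℝ γ (a - c) * inner ℝ γ' (a - c))
      + inner ℝ (b - a) (c - a) * (inner ℝ γ (b - c) * inner ℝ γ' (b - c)) := by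
  simp only [PiLp.inner_apply, Fin.sum_univ_two, RCLike.inner_apply, conj_trivial, det₂,
    PiLp.sub_apply]
  ring

/-- The area of the reference triangle; only its sign matters. -/
noncomputable def refArea : ℝ :=
  volume.real (convexHull ℝ {(0 : E 2), EuclideanSpace.single 0 1, EuclideanSpace.single 1 1})

lemma volume_triangle (a b c : E 2) :
    volume.real (convexHull ℝ {a, b, c}) = refArea * |det₂ (b - a) (c - a)| := by
  set p := b - a with hp
  set q := c - a with hq
  let A : E 2 →ₗ[ℝ] E 2 := Matrix.toLin (EuclideanSpace.basisFun (Fin 2) ℝ).toBasis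
    (EuclideanSpace.basisFun (Fin 2) ℝ).toBasis !![p 0, q 0; p 1, q 1]
  have hA : LinearMap.det A = det₂ p q := by
    rw [LinearMap.det_toLin, Matrix.det_fin_two_of, det₂]; ring
  have h0 : A (EuclideanSpace.single 0 1) = p := by
    have := Matrix.toLin_self (EuclideanSpace.basisFun (Fin 2) ℝ).toBasis
      (EuclideanSpace.basisFun (Fin 2) ℝ).toBasis !![p 0, q 0; p 1, q 1] 0
    simp only [OrthonormalBasis.coe_toBasis, EuclideanSpace.basisFun_apply, Fin.sum_univ_two] at this
    rw [show A = Matrix.toLin (EuclideanSpace.basisFun (Fin 2) ℝ).toBasis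
      (EuclideanSpace.basisFun (Fin 2) ℝ).toBasis !![p 0, q 0; p 1, q 1] from rfl, this]
    ext i; fin_cases i <;> simp
  have h1 : A (EuclideanSpace.single 1 1) = q := by
    have := Matrix.toLin_self (EuclideanSpace.basisFun (Fin 2) ℝ).toBasis
      (EuclideanSpace.basisFun (Fin 2) ℝ).toBasis !![p 0, q 0; p 1, q 1] 1
    simp only [OrthonormalBasis.coe_toBasis, EuclideanSpace.basisFun_apply, Fin.sum_univ_two] at this
    rw [show A = Matrix.toLin (EuclideanSpace.basisFun (Fin 2) ℝ).toBasis
      (EuclideanSpace.basisFun (Fin 2) ℝ).toBasis !![p 0, q 0; p 1, q 1] from rfl, this]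
    ext i; fin_cases i <;> simp
  have himg : convexHull ℝ {a, b, c} = (fun x => a + x) ''
      (A '' convexHull ℝ {(0 : E 2), EuclideanSpace.single 0 1, EuclideanSpace.single 1 1}) := by
    rw [A.image_convexHull]
    have e : (fun x => a + x) '' convexHull ℝ (A '' {(0 : E 2), EuclideanSpace.single 0 1,
        EuclideanSpace.single 1 1}) = ((AffineEquiv.constVAdd ℝ (E 2) a : E 2 ≃ᵃ[ℝ] E 2) :
          E 2 →ᵃ[ℝ] E 2) '' convexHull ℝ (A '' {(0 : E 2), EuclideanSpace.single 0 1,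
        EuclideanSpace.single 1 1}) := rfl
    rw [e, AffineMap.image_convexHull]
    congr 1
    simp only [Set.image_insert_eq, Set.image_singleton, h0, h1, map_zero]
    simp [hp, hq]
  rw [himg, Measure.real, Set.image_add_left, measure_preimage_add, Measure.addHaar_image_linearMap,
    hA, ENNReal.toReal_mul, ENNReal.toReal_ofReal (abs_nonneg _), refArea, Measure.real, mul_comm]

open Classical in
/-- The cotangent formula for the local stiffness matrix. Every edge is counted twice. -/
lemma stiffness_triangle {𝒯 : Geometry.SimplicialComplex ℝ (E 2)} {K : Finset (E 2)}
    (hK : K ∈ cells 𝒯) (γ γ' : E 2) :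
    volume.real (openCell K) * inner ℝ γ γ'
      = refArea / 2 * ∑ a ∈ K, ∑ b ∈ K, (inner ℝ γ (a - b) * inner ℝ γ' (a - b)) *
          ∑ c ∈ K \ {a, b}, Real.cot (EuclideanGeometry.angle a c b) := by
  obtain ⟨a, b, c, hab, hac, hbc, rfl⟩ := Finset.card_eq_three.1 hK.2
  have hvol : volume.real (openCell {a, b, c}) = volume.real (convexHull ℝ {a, b, c}) := by
    rw [measureReal_congr (openCell_ae_eq _)]
    simp
  have hne : det₂ (b - a) (c - a) ≠ 0 := by
    intro h0
    have h1 : volume.real (openCell {a, b, c}) = 0 := by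
      rw [hvol, volume_triangle, h0]; simp
    have h2 := (isOpen_openCell ({a, b, c} : Finset (E 2))).measure_pos volume (openCell_nonempty hK)
    have h3 : volume (openCell ({a, b, c} : Finset (E 2))) ≠ ⊤ :=
      ((isCompact_convexHull_finset _).isBounded.subset (openCell_subset _)).measure_lt_top.ne
    exact (ENNReal.toReal_pos h2.ne' h3).ne' h1
  have e1 : ({a, b, c} : Finset (E 2)) \ {a, b} = {c} := by grind
  have e2 : ({a, b, c} : Finset (E 2)) \ {a, c} = {b} := by grind
  have e3 : ({a, b, c} : Finset (E 2)) \ {b, c} = {a} := by grind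
  have e1' : ({a, b, c} : Finset (E 2)) \ {b, a} = {c} := by grind
  have e2' : ({a, b, c} : Finset (E 2)) \ {c, a} = {b} := by grind
  have e3' : ({a, b, c} : Finset (E 2)) \ {c, b} = {a} := by grind
  have hs : ∀ f : E 2 → ℝ, ∑ x ∈ ({a, b, c} : Finset (E 2)), f x = f a + f b + f c := fun f => by
    rw [Finset.sum_insert (by simp [hab, hac]), Finset.sum_insert (by simp [hbc]),
      Finset.sum_singleton]; ring
  have hsum : ∑ x ∈ ({a, b, c} : Finset (E 2)), ∑ y ∈ ({a, b, c} : Finset (E 2)),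
      (inner ℝ γ (x - y) * inner ℝ γ' (x - y)) *
          ∑ z ∈ {a, b, c} \ {x, y}, Real.cot (EuclideanGeometry.angle x z y)
      = 2 * ((inner ℝ γ (a - b) * inner ℝ γ' (a - b)) * Real.cot (EuclideanGeometry.angle a c b)
        + (inner ℝ γ (a - c) * inner ℝ γ' (a - c)) * Real.cot (EuclideanGeometry.angle a b c)
        + (inner ℝ γ (b - c) * inner ℝ γ' (b - c)) * Real.cot (EuclideanGeometry.angle b a c)) := by
    rw [hs, hs, hs, hs, e1, e2, e3, e1', e2', e3']
    simp only [Finset.sum_singleton, sub_self, inner_zero_right, zero_mul]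
    rw [EuclideanGeometry.angle_comm b c a, EuclideanGeometry.angle_comm c b a,
      EuclideanGeometry.angle_comm c a b, ← neg_sub a b, ← neg_sub a c, ← neg_sub b c]
    simp only [inner_neg_right]
    ring
  rw [hsum, hvol, volume_triangle, cot_angle, cot_angle, cot_angle]
  have d1 : det₂ (a - c) (b - c) = det₂ (b - a) (c - a) := by simp [det₂]; ring
  have d2 : |det₂ (a - b) (c - b)| = |det₂ (b - a) (c - a)| := by
    rw [← abs_neg]; congr 1; simp [det₂]; ring
  rw [d1, d2]
  have key := det_sq_mul_inner a b c γ γ'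
  rw [← sq_abs] at key
  have hpos : 0 < |det₂ (b - a) (c - a)| := abs_pos.2 hne
  field_simp
  linear_combination refArea * key

lemma IsPL.sub_eq_inner {d : ℕ} {𝒯 : Geometry.SimplicialComplex ℝ (E d)} {D : Set (E d)}
    {v : E d → ℝ} {γ : Finset (E d) → E d} (h : IsPL 𝒯 D v γ) {K : Finset (E d)} (hK : K ∈ cells 𝒯)
    {a b : E d} (ha : a ∈ K) (hb : b ∈ K) : inner ℝ (γ K) (a - b) = v a - v b := by
  obtain ⟨c, hc⟩ := h.affine K hK
  rw [hc a (subset_convexHull ℝ _ ha), hc b (subset_convexHull ℝ _ hb), inner_sub_right]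
  ring

open Classical in
/-- Summing over the cells first turns the sum into one over edges, in which the factor of `Φ a b` is
the sum of cotangents of the mesh assumption; on the boundary edges, which are exempt from it, `Φ`
vanishes. -/
lemma stiffness_sum_nonneg {L : ℝ} {𝒯 : Geometry.SimplicialComplex ℝ (E 2)}
    (hT : IsTriangulation 𝒯 (box 2 L)) (hm : MeshAssumption 𝒯 (box 2 L)) {Φ : E 2 → E 2 → ℝ}
    (h0 : ∀ a, Φ a a = 0) (hbd : ∀ a ∈ frontier (box 2 L), ∀ b ∈ frontier (box 2 L), Φ a b = 0)
    (hΦ : ∀ K ∈ cells 𝒯, ∀ a ∈ K, ∀ b ∈ K, 0 ≤ Φ a b) :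
    0 ≤ ∑ K ∈ hT.finite_cells.toFinset, ∑ a ∈ K, ∑ b ∈ K,
      Φ a b * ∑ c ∈ K \ {a, b}, Real.cot (EuclideanGeometry.angle a c b) := by
  set C := hT.finite_cells.toFinset with hC
  let vtx : Finset (E 2) := C.biUnion id
  have hsub : ∀ K ∈ C, K ⊆ vtx := fun K hK => Finset.subset_biUnion_of_mem id hK
  let ω : Finset (E 2) → E 2 → E 2 → ℝ := fun K a b =>
    ∑ c ∈ K \ {a, b}, Real.cot (EuclideanGeometry.angle a c b)
  have e1 : ∀ K ∈ C, ∑ a ∈ K, ∑ b ∈ K, Φ a b * ω K a b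
      = ∑ a ∈ vtx, ∑ b ∈ vtx, if a ∈ K ∧ b ∈ K then Φ a b * ω K a b else 0 := by
    intro K hK
    have hf : ∀ f : E 2 → ℝ, ∑ a ∈ K, f a = ∑ a ∈ vtx, if a ∈ K then f a else 0 := fun f => by
      rw [← Finset.sum_filter]
      congr 1
      ext a
      simpa using fun ha => hsub K hK ha
    rw [hf]
    refine Finset.sum_congr rfl fun a _ => ?_
    rw [hf]
    by_cases ha : a ∈ K <;> simp [ha]
  rw [Finset.sum_congr rfl e1, Finset.sum_comm]
  refine Finset.sum_nonneg fun a _ => ?_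
  rw [Finset.sum_comm]
  refine Finset.sum_nonneg fun b _ => ?_
  have e2 : ∑ K ∈ C, (if a ∈ K ∧ b ∈ K then Φ a b * ω K a b else 0)
      = Φ a b * ∑ᶠ K ∈ {K | K ∈ cells 𝒯 ∧ a ∈ K ∧ b ∈ K}, ω K a b := by
    rw [← Finset.sum_filter, ← Finset.mul_sum]
    congr 1
    rw [← finsum_mem_coe_finset]
    congr! 3
    simp [hC]
  rw [e2]
  by_cases hab : a = b
  · rw [hab, h0, zero_mul]
  by_cases hex : ∃ K ∈ cells 𝒯, a ∈ K ∧ b ∈ K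
  · obtain ⟨K, hK, ha, hb⟩ := hex
    by_cases hseg : segment ℝ a b ⊆ frontier (box 2 L)
    · rw [hbd a (hseg (left_mem_segment ℝ a b)) b (hseg (right_mem_segment ℝ a b)), zero_mul]
    · have hface : {a, b} ∈ 𝒯.faces :=
        𝒯.down_closed hK.1 (by simp [Finset.insert_subset_iff, ha, hb]) (by simp)
      have := hm a b hab hface hseg
      exact mul_nonneg (hΦ K hK a ha b hb) ((mul_nonneg_iff_of_pos_left (by norm_num)).1 this)
  · have : {K | K ∈ cells 𝒯 ∧ a ∈ K ∧ b ∈ K} = ∅ := by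
      refine Set.eq_empty_of_forall_notMem fun K hK => hex ⟨K, hK.1, hK.2.1, hK.2.2⟩
    rw [this]; simp

/-- The discrete Dirichlet form is monotone in the products of nodal differences: by the mesh
assumption it is a sum of such products with nonnegative weights. -/
lemma dirichlet_mono {d : ℕ} (hd : d = 1 ∨ d = 2) {L : ℝ}
    {𝒯 : Geometry.SimplicialComplex ℝ (E d)} (hT : IsTriangulation 𝒯 (box d L))
    (hm : MeshAssumption 𝒯 (box d L)) {v₁ v₂ w₁ w₂ : E d → ℝ}
    {γ₁ γ₂ ζ₁ ζ₂ : Finset (E d) → E d} (hv₁ : IsPL 𝒯 (box d L) v₁ γ₁)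
    (hv₂ : IsPL 𝒯 (box d L) v₂ γ₂) (hw₁ : IsPL 𝒯 (box d L) w₁ ζ₁) (hw₂ : IsPL 𝒯 (box d L) w₂ ζ₂)
    (h : ∀ K ∈ cells 𝒯, ∀ a ∈ K, ∀ b ∈ K,
      (v₁ a - v₁ b) * (v₂ a - v₂ b) ≤ (w₁ a - w₁ b) * (w₂ a - w₂ b)) :
    ∑ K ∈ hT.finite_cells.toFinset, volume.real (openCell K) * inner ℝ (γ₁ K) (γ₂ K)
      ≤ ∑ K ∈ hT.finite_cells.toFinset, volume.real (openCell K) * inner ℝ (ζ₁ K) (ζ₂ K) := by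
  classical
  rcases hd with rfl | rfl
  · refine Finset.sum_le_sum fun K hK => mul_le_mul_of_nonneg_left ?_ ENNReal.toReal_nonneg
    have hK' : K ∈ cells 𝒯 := by simpa using hK
    obtain ⟨a, b, hab, hKe⟩ := Finset.card_eq_two.1 hK'.2
    have ha : a ∈ K := by simp [hKe]
    have hb : b ∈ K := by simp [hKe]
    have h1 := h K hK' a ha b hb
    rw [← hv₁.sub_eq_inner hK' ha hb, ← hv₂.sub_eq_inner hK' ha hb,
      ← hw₁.sub_eq_inner hK' ha hb, ← hw₂.sub_eq_inner hK' ha hb] at h1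
    have hne : (a - b) 0 ≠ 0 := fun h0 => hab (sub_eq_zero.1 (by
      ext i; rw [Subsingleton.elim i 0, h0]; rfl))
    have hpos : 0 < (a - b) 0 ^ 2 := by positivity
    simp only [PiLp.inner_apply, Fin.sum_univ_one, RCLike.inner_apply, conj_trivial] at h1 ⊢
    refine le_of_mul_le_mul_right ?_ hpos
    linarith
  · rw [← sub_nonneg, ← Finset.sum_sub_distrib]
    have e : ∀ K ∈ hT.finite_cells.toFinset,
        volume.real (openCell K) * inner ℝ (ζ₁ K) (ζ₂ K)
          - volume.real (openCell K) * inner ℝ (γ₁ K) (γ₂ K)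
        = refArea / 2 * ∑ a ∈ K, ∑ b ∈ K,
          ((w₁ a - w₁ b) * (w₂ a - w₂ b) - (v₁ a - v₁ b) * (v₂ a - v₂ b)) *
            ∑ c ∈ K \ {a, b}, Real.cot (EuclideanGeometry.angle a c b) := by
      intro K hK
      have hK' : K ∈ cells 𝒯 := by simpa using hK
      rw [stiffness_triangle hK', stiffness_triangle hK', ← mul_sub, ← Finset.sum_sub_distrib]
      congr 1
      refine Finset.sum_congr rfl fun a ha => ?_
      rw [← Finset.sum_sub_distrib]
      refine Finset.sum_congr rfl fun b hb => ?_
      rw [hv₁.sub_eq_inner hK' ha hb, hv₂.sub_eq_inner hK' ha hb,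
        hw₁.sub_eq_inner hK' ha hb, hw₂.sub_eq_inner hK' ha hb]
      ring
    rw [Finset.sum_congr rfl e, ← Finset.mul_sum]
    refine mul_nonneg (div_nonneg ENNReal.toReal_nonneg two_pos.le) ?_
    refine stiffness_sum_nonneg hT hm (fun a => by simp) (fun a ha b hb => ?_)
      fun K hK a ha b hb => sub_nonneg.2 (h K hK a ha b hb)
    simp [hv₁.zero a ha, hv₁.zero b hb, hw₁.zero a ha, hw₁.zero b hb]

section

/-! ### Dissipativity of the discrete nonlinearity -/

lemma pow_sub_pow_eq_integral (n : ℕ) (a b : ℝ) :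
    a ^ (n + 1) - b ^ (n + 1)
      = (n + 1) * (a - b) * ∫ t in Set.Ioc (0 : ℝ) 1, (b + t * (a - b)) ^ n := by
  have hd : ∀ t : ℝ, HasDerivAt (fun t : ℝ => (b + t * (a - b)) ^ (n + 1))
      ((n + 1) * (a - b) * (b + t * (a - b)) ^ n) t := by
    intro t
    have h1 : HasDerivAt (fun t : ℝ => b + t * (a - b)) (a - b) t := by
      simpa using ((hasDerivAt_id t).mul_const (a - b)).const_add b
    refine (h1.pow (n + 1)).congr_deriv ?_
    push_cast
    ring
  have hc : Continuous fun t : ℝ => (n + 1) * (a - b) * (b + t * (a - b)) ^ n := by fun_prop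
  have ftc := intervalIntegral.integral_eq_sub_of_hasDerivAt (a := 0) (b := 1)
    (fun t _ => hd t) (hc.intervalIntegrable _ _)
  rw [intervalIntegral.integral_of_le zero_le_one, integral_const_mul] at ftc
  rw [ftc]
  ring

/-- The Stroock–Varopoulos inequality for odd powers. -/
lemma sq_pow_sub_pow_le (n : ℕ) (a b : ℝ) :
    (a ^ (n + 1) - b ^ (n + 1)) ^ 2
      ≤ (n + 1) ^ 2 * ((a ^ (2 * n + 1) - b ^ (2 * n + 1)) * (a - b)) := by
  rw [pow_sub_pow_eq_integral, pow_sub_pow_eq_integral]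
  have : IsProbabilityMeasure (volume.restrict (Set.Ioc (0 : ℝ) 1)) := ⟨by simp⟩
  have int : ∀ f : ℝ → ℝ, Continuous f → IntegrableOn f (Set.Ioc 0 1) := fun f hf =>
    (hf.integrableOn_Icc).mono_set Set.Ioc_subset_Icc_self
  have h := sq_integral_le_integral_sq (volume.restrict (Set.Ioc (0 : ℝ) 1))
    (f := fun t => (b + t * (a - b)) ^ n) (int _ (by fun_prop)) (int _ (by fun_prop))
  simp_rw [← pow_mul, mul_comm n 2] at h
  set I := ∫ t in Set.Ioc (0 : ℝ) 1, (b + t * (a - b)) ^ n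
  set J := ∫ t in Set.Ioc (0 : ℝ) 1, (b + t * (a - b)) ^ (2 * n)
  have hJ : 0 ≤ J := (sq_nonneg I).trans h
  have h1 : (a - b) ^ 2 * I ^ 2 ≤ (a - b) ^ 2 * J := by gcongr
  have h2 : (a - b) ^ 2 * J ≤ (2 * n + 1) * ((a - b) ^ 2 * J) := by
    have : 0 ≤ (a - b) ^ 2 * J := by positivity
    have hn : (0 : ℝ) ≤ n := n.cast_nonneg
    nlinarith [mul_nonneg hn this]
  calc _ = ((n : ℝ) + 1) ^ 2 * ((a - b) ^ 2 * I ^ 2) := by ring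
    _ ≤ ((n : ℝ) + 1) ^ 2 * ((2 * n + 1) * ((a - b) ^ 2 * J)) := by
      exact mul_le_mul_of_nonneg_left (h1.trans h2) (by positivity)
    _ = _ := by push_cast; ring

variable {d : ℕ} {𝒯 : Geometry.SimplicialComplex ℝ (E d)} {L σ r : ℝ}

lemma IsPL.const_mul {D : Set (E d)} {v : E d → ℝ} {γ : Finset (E d) → E d} (k : ℝ)
    (h : IsPL 𝒯 D v γ) : IsPL 𝒯 D (fun x => k * v x) (fun K => k • γ K) := by
  refine ⟨fun K hK => ?_, fun x hx => by rw [h.zero x hx, mul_zero]⟩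
  obtain ⟨c, hc⟩ := h.affine K hK
  exact ⟨k * c, fun x hx => by rw [hc x hx, real_inner_smul_left]; ring⟩

lemma sq_le_eps_mul_pow {n : ℕ} (hn : 1 ≤ n) {ε : ℝ} (hε : 0 < ε) (t : ℝ) :
    t ^ 2 ≤ ε * (t ^ (n + 1)) ^ 2 + (ε + ε⁻¹) := by
  have h1 : t ^ 4 ≤ (t ^ (n + 1)) ^ 2 + 1 := by
    rw [← pow_mul, show t ^ 4 = (t ^ 2) ^ 2 by ring, show (n + 1) * 2 = 2 * (n + 1) by ring, pow_mul]
    rcases le_total (t ^ 2) 1 with h | h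
    · have : (t ^ 2) ^ 2 ≤ 1 := pow_le_one₀ (sq_nonneg t) h
      have : 0 ≤ (t ^ 2) ^ (n + 1) := by positivity
      linarith
    · have : (t ^ 2) ^ 2 ≤ (t ^ 2) ^ (n + 1) := pow_le_pow_right₀ h (by omega)
      linarith
  have h2 : t ^ 2 ≤ ε * t ^ 4 + ε⁻¹ := by
    have h3 : ε * ε⁻¹ = 1 := mul_inv_cancel₀ hε.ne'
    have h4 : 0 < ε⁻¹ := inv_pos.2 hε
    have h5 : 0 ≤ ε * (t ^ 2 - ε⁻¹) ^ 2 := by positivity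
    have h6 : ε * (t ^ 2 - ε⁻¹) ^ 2 = ε * t ^ 4 - 2 * t ^ 2 * (ε * ε⁻¹) + ε⁻¹ * (ε * ε⁻¹) := by ring
    rw [h6, h3] at h5
    nlinarith [sq_nonneg t]
  nlinarith

/-- The nodal power `I_h (v ^ (n + 1))` dominates `v` in `L²`, cell by cell: the largest nodal value
bounds `v` on the cell, and its power is controlled by the `L²` norm of the affine function that
takes it. -/
lemma norm_fn_sq_le_nodal_pow (hL : 0 < L) (hσ : 0 < σ) (hT : IsTriangulation 𝒯 (box d L))
    (hr : IsShapeRegular 𝒯 σ r) {n : ℕ} (hn : 1 ≤ n) {ε : ℝ} (hε : 0 < ε)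
    {u w : H10 (box d L)} {v vs : E d → ℝ} {γ γs : Finset (E d) → E d}
    (hv : IsPL 𝒯 (box d L) v γ) (hu : fn u =ᵐ[volume.restrict (box d L)] v)
    (hvs : IsPL 𝒯 (box d L) vs γs) (hw : fn w =ᵐ[volume.restrict (box d L)] vs)
    (hnod : ∀ K ∈ cells 𝒯, ∀ a ∈ K, vs a = v a ^ (n + 1)) :
    ‖fn u‖ ^ 2 ≤ ε * (2 + 8 * σ ^ 2 * (4 * σ) ^ d) * ‖fn w‖ ^ 2
      + (ε + ε⁻¹) * volume.real (box d L) := by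
  have hvol : volume.real (box d L) = ∑ K ∈ hT.finite_cells.toFinset, volume.real (openCell K) := by
    have := hT.setIntegral_eq_sum hL (f := fun _ => (1 : ℝ))
      (integrableOn_of_isBounded continuous_const (isBounded_box d L))
    simpa using this
  rw [IsPL.norm_sq_fn_eq_sum hL hT hu, IsPL.norm_sq_fn_eq_sum hL hT hw, hvol, Finset.mul_sum,
    Finset.mul_sum, ← Finset.sum_add_distrib]
  refine Finset.sum_le_sum fun K hK => ?_
  have hK' : K ∈ cells 𝒯 := by simpa using hK
  have hKm := (isOpen_openCell K).measurableSet
  obtain ⟨c, hc⟩ := hv.affine K hK'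
  obtain ⟨cs, hcs⟩ := hvs.affine K hK'
  obtain ⟨z, hz⟩ := hr.ball K hK'
  have hKne : K.Nonempty := Finset.card_pos.1 (by rw [hK'.2]; omega)
  obtain ⟨a, ha, hmax⟩ := K.exists_max_image (fun a => |v a|) hKne
  have hac := subset_convexHull ℝ (K : Set (E d)) ha
  have h1 : ∀ x ∈ openCell K, v x ^ 2 ≤ ε * vs a ^ 2 + (ε + ε⁻¹) := by
    intro x hx
    have h2 := abs_sub_le_of_mem_convexHull (s := (K : Set (E d))) (g := γ K) (c := c) (m := 0)
      (ρ := |v a|) (fun b hb => by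
        rw [sub_zero, ← hc b (subset_convexHull ℝ _ hb)]; exact hmax b hb) (openCell_subset K hx)
    rw [sub_zero, ← hc x (openCell_subset K hx)] at h2
    calc v x ^ 2 ≤ v a ^ 2 := sq_le_sq.2 h2
      _ ≤ _ := by
        rw [hnod K hK' a ha]
        exact sq_le_eps_mul_pow hn hε _
  have hKb : Bornology.IsBounded (openCell K) :=
    (isCompact_convexHull_finset K).isBounded.subset (openCell_subset K)
  have e1 : ∫ x in openCell K, v x ^ 2 ≤ volume.real (openCell K) * (ε * vs a ^ 2 + (ε + ε⁻¹)) := by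
    rw [← smul_eq_mul, ← setIntegral_const]
    refine setIntegral_mono_on ?_ (integrableOn_of_isBounded continuous_const hKb) hKm h1
    refine (integrableOn_of_isBounded (f := fun x => (inner ℝ (γ K) x + c) ^ 2) (by fun_prop)
      hKb).congr_fun (fun x hx => ?_) hKm
    dsimp only
    rw [hc x (openCell_subset K hx)]
  have e2 : volume.real (openCell K) * vs a ^ 2
      ≤ (2 + 8 * σ ^ 2 * (4 * σ) ^ d) * ∫ x in openCell K, vs x ^ 2 := by
    rw [hcs a hac, setIntegral_congr_fun hKm (g := fun x => (inner ℝ (γs K) x + cs) ^ 2)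
      fun x hx => by dsimp only; rw [hcs x (openCell_subset K hx)]]
    exact volume_mul_sq_le hKm hr.pos hσ rfl
      (fun x hx => hr.dist_le K hK' x (openCell_subset K hx) a hac) hz
  have e3 := mul_le_mul_of_nonneg_left e2 hε.le
  linarith

/-- The drift `F(u) = u - u ^ q` of the scheme, tested with the discrete Laplacian: the power
controls the `L²` norm, up to a constant that does not depend on the mesh. -/
lemma exists_dissipativity (hd : d = 1 ∨ d = 2) (hL : 0 < L) (hσ : 0 < σ) {n : ℕ} (hn : 1 ≤ n) :
    ∃ B : ℝ, 0 ≤ B ∧ ∀ 𝒯 : Geometry.SimplicialComplex ℝ (E d), IsTriangulation 𝒯 (box d L) →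
      MeshAssumption 𝒯 (box d L) → ∀ r, IsShapeRegular 𝒯 σ r → ∀ u : Vh (box d L) 𝒯,
      ∃ J : Vh (box d L) 𝒯, fn (J : H10 (box d L)) =ᵐ[volume.restrict (box d L)]
          interp 𝒯 (fun y => rep u y - rep u y ^ (2 * n + 1)) ∧
        inner ℝ (grad (J : H10 (box d L))) (grad (u : H10 (box d L)))
          ≤ ‖grad (u : H10 (box d L))‖ ^ 2 - ‖fn (u : H10 (box d L))‖ ^ 2 + B := by
  have hd0 : 0 < d := by omega
  set C := 2 + 8 * σ ^ 2 * (4 * σ) ^ d with hC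
  have hC0 : 0 < C := by positivity
  set κ : ℝ := ((n : ℝ) + 1) ^ 2 with hκ
  have hκ0 : 0 < κ := by positivity
  -- `C` comes from `norm_fn_sq_le_nodal_pow`, `L ^ 2` from Poincaré's inequality and `κ` from the
  -- Stroock–Varopoulos inequality; `ε` makes their product equal to one.
  set ε := (C * L ^ 2 * κ)⁻¹ with hε
  have hε0 : 0 < ε := by positivity
  refine ⟨(ε + ε⁻¹) * volume.real (box d L), by positivity, ?_⟩
  intro 𝒯 hT hm r hr u
  set v := rep u with hv
  obtain ⟨γ, hγ⟩ := exists_isPL_rep u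
  rw [← hv] at hγ
  have hu := fn_ae_eq_rep u
  rw [← hv] at hu
  have hfr : ∀ a ∈ frontier (box d L), v a = 0 := hγ.zero
  obtain ⟨ζ, hζ⟩ := exists_isPL_interp hT (g := fun y => v y ^ (2 * n + 1))
    fun a ha => by simp [hfr a ha]
  obtain ⟨η, hη⟩ := exists_isPL_interp hT (g := fun y => v y ^ (n + 1))
    fun a ha => by simp [hfr a ha]
  obtain ⟨θ, hθ⟩ := exists_isPL_interp hT (g := fun y => v y - v y ^ (2 * n + 1))
    fun a ha => by simp [hfr a ha]
  obtain ⟨Jq, hJq⟩ := hζ.exists_H10 hL hT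
  obtain ⟨Js, hJs⟩ := hη.exists_H10 hL hT
  obtain ⟨J, hJ⟩ := hθ.exists_H10 hL hT
  -- Nodal interpolation is linear and reproduces the finite element function `u`.
  have hJe : J = (u : H10 (box d L)) - Jq := by
    refine fn_injective (isOpen_box d L) (isBounded_box d L) (Lp.ext ?_)
    have heq := hθ.eqOn_of_vertices (hγ.sub hζ) hT fun K hK a ha => by
      rw [interp_apply_vertex hK.1 _ ha, Pi.sub_apply, interp_apply_vertex hK.1 _ ha]
    rw [fn_sub]
    filter_upwards [hJ, hJq, hu, Lp.coeFn_sub (fn (u : H10 (box d L))) (fn Jq),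
      ae_restrict_mem (isOpen_box d L).measurableSet] with x h1 h2 h3 h4 h5
    rw [h1, h4, Pi.sub_apply, h2, h3, heq (subset_closure h5)]
    rfl
  refine ⟨⟨J, hθ.mem_Vh hJ⟩, hJ, ?_⟩
  have hmono := dirichlet_mono hd hT hm hη hη hζ (hγ.const_mul κ) fun K hK a ha b hb => by
    rw [interp_apply_vertex hK.1 _ ha, interp_apply_vertex hK.1 _ hb,
      interp_apply_vertex hK.1 _ ha, interp_apply_vertex hK.1 _ hb]
    have := sq_pow_sub_pow_le n (v a) (v b)
    rw [← hκ] at this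
    linarith
  simp_rw [real_inner_smul_right, mul_left_comm _ κ] at hmono
  rw [← Finset.mul_sum, ← hη.inner_grad_eq_sum hL hT hJs hη hJs,
    ← hζ.inner_grad_eq_sum hL hT hJq hγ hu, real_inner_self_eq_norm_sq] at hmono
  have hP := pow_le_pow_left₀ (norm_nonneg _) (poincare hd0 hL Js) 2
  rw [mul_pow] at hP
  have hnod := norm_fn_sq_le_nodal_pow hL hσ hT hr hn hε0 hγ hu hη hJs fun K hK a ha =>
    interp_apply_vertex hK.1 _ ha
  set I : ℝ := inner ℝ (grad Jq) (grad (u : H10 (box d L)))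
  have h1 : ε * C * ‖fn Js‖ ^ 2 ≤ I := by
    calc ε * C * ‖fn Js‖ ^ 2 ≤ ε * C * (L ^ 2 * (κ * I)) := by
          gcongr
          exact hP.trans (by gcongr)
      _ = ε * (C * L ^ 2 * κ) * I := by ring
      _ = I := by rw [hε, inv_mul_cancel₀ (by positivity), one_mul]
  have h2 : inner ℝ (grad J) (grad (u : H10 (box d L))) = ‖grad (u : H10 (box d L))‖ ^ 2 - I := by
    rw [hJe, grad_sub, inner_sub_left, real_inner_self_eq_norm_sq]
  change inner ℝ (grad J) (grad (u : H10 (box d L))) ≤ _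
  rw [h2]
  linarith

lemma sq_le_of_energy_identity {a b g g' i j B τ : ℝ} (hτ : 0 ≤ τ)
    (h : g ^ 2 - i + τ * a ^ 2 = τ * j) (hj : j ≤ g ^ 2 - b ^ 2 + B) (hab : g ^ 2 ≤ a * b)
    (hi : i ≤ g * g') : g ^ 2 ≤ g' ^ 2 + τ * (2 * B) := by
  have h1 : a * b ≤ (a ^ 2 + b ^ 2) / 2 := by nlinarith [sq_nonneg (a - b)]
  have h2 : g * g' ≤ (g ^ 2 + g' ^ 2) / 2 := by nlinarith [sq_nonneg (g - g')]
  have h3 : j - a ^ 2 ≤ B := by linarith [sq_nonneg a, sq_nonneg b]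
  have h4 := mul_le_mul_of_nonneg_left h3 hτ
  linarith

/-- One implicit step, tested with the discrete Laplacian of the new value `x`; here `y` is the old
value plus the noise. There is no restriction on the time step. -/
lemma exists_step_bound (hd : d = 1 ∨ d = 2) (hL : 0 < L) (hσ : 0 < σ) {n : ℕ} (hn : 1 ≤ n) :
    ∃ B : ℝ, 0 ≤ B ∧ ∀ 𝒯 : Geometry.SimplicialComplex ℝ (E d), IsTriangulation 𝒯 (box d L) →
      MeshAssumption 𝒯 (box d L) → ∀ r, IsShapeRegular 𝒯 σ r → ∀ (x y : Vh (box d L) 𝒯) (τ : ℝ),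
      0 ≤ τ →
      (∀ v : Vh (box d L) 𝒯, inner ℝ (fn (x - y : H10 (box d L))) (fn (v : H10 (box d L)))
          + τ * inner ℝ (grad (x : H10 (box d L))) (grad (v : H10 (box d L)))
        = τ * ∫ z in box d L, interp 𝒯 (fun y => rep x y - rep x y ^ (2 * n + 1)) z
            * fn (v : H10 (box d L)) z) →
      ‖grad (x : H10 (box d L))‖ ^ 2 ≤ ‖grad (y : H10 (box d L))‖ ^ 2 + τ * B := by
  obtain ⟨B, hB, h⟩ := exists_dissipativity (d := d) hd hL hσ hn
  refine ⟨2 * B, by positivity, ?_⟩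
  intro 𝒯 hT hm r hr x y τ hτ hxy
  obtain ⟨J, hJ, hJx⟩ := h 𝒯 hT hm r hr x
  obtain ⟨A, hA⟩ := exists_isNegLaplacian hL hT
  have hJi : ∀ v : Vh (box d L) 𝒯,
      ∫ z in box d L, interp 𝒯 (fun y => rep x y - rep x y ^ (2 * n + 1)) z
        * fn (v : H10 (box d L)) z = inner ℝ (fn (J : H10 (box d L))) (fn (v : H10 (box d L))) := by
    intro v
    rw [inner_L2_real]
    refine integral_congr_ae ?_
    filter_upwards [hJ] with z hz
    rw [hz]
  have h1 := hxy (A x)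
  have e1 : inner ℝ (fn (x - y : H10 (box d L))) (fn (A x : H10 (box d L)))
      = ‖grad (x : H10 (box d L))‖ ^ 2
        - inner ℝ (grad (x : H10 (box d L))) (grad (y : H10 (box d L))) := by
    have := hA x (x - y)
    rw [real_inner_comm, Submodule.coe_sub] at this
    rw [this, grad_sub, inner_sub_right, real_inner_self_eq_norm_sq]
  have e2 : inner ℝ (grad (x : H10 (box d L))) (grad (A x : H10 (box d L)))
      = ‖fn (A x : H10 (box d L))‖ ^ 2 := by
    rw [← hA x (A x), real_inner_self_eq_norm_sq]
  have e3 : inner ℝ (fn (J : H10 (box d L))) (fn (A x : H10 (box d L)))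
      = inner ℝ (grad (J : H10 (box d L))) (grad (x : H10 (box d L))) := by
    rw [real_inner_comm, hA x J, real_inner_comm]
  have e4 : ‖grad (x : H10 (box d L))‖ ^ 2
      ≤ ‖fn (A x : H10 (box d L))‖ * ‖fn (x : H10 (box d L))‖ := by
    rw [← real_inner_self_eq_norm_sq, ← hA x x]
    exact real_inner_le_norm _ _
  rw [e1, e2, hJi, e3] at h1
  have e5 := real_inner_le_norm (grad (x : H10 (box d L))) (grad (y : H10 (box d L)))
  exact sq_le_of_energy_identity hτ h1 hJx e4 e5

end

section

/-! ### Moments under one noise increment -/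

lemma exists_one_add_rpow_add_nat_le {θ : ℝ} (h1 : 1 ≤ θ) (h2 : θ ≤ 2) (k : ℕ) :
    ∃ C : ℝ, 0 ≤ C ∧ ∀ y : ℝ, -1 ≤ y →
      (1 + y) ^ (θ + k) ≤ 1 + (θ + k) * y + C * y ^ 2 * (1 + |y|) ^ k := by
  induction k with
  | zero =>
    refine ⟨1, zero_le_one, fun y hy => ?_⟩
    have e : (1 + y) ^ (θ + (0 : ℕ)) = (1 + y) * (1 + y) ^ (θ - 1) := by
      conv_lhs => rw [show θ + (0 : ℕ) = 1 + (θ - 1) by push_cast; ring]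
      rw [Real.rpow_add_of_nonneg (by linarith) zero_le_one (by linarith), Real.rpow_one]
    have b := rpow_one_add_le_one_add_mul_self hy (p := θ - 1) (by linarith) (by linarith)
    have := mul_le_mul_of_nonneg_left b (by linarith : 0 ≤ 1 + y)
    rw [e]
    push_cast
    nlinarith [sq_nonneg y]
  | succ k ih =>
    obtain ⟨C, hC, h⟩ := ih
    refine ⟨θ + k + C, by positivity, fun y hy => ?_⟩
    have e : (1 + y) ^ (θ + (k + 1 : ℕ)) = (1 + y) * (1 + y) ^ (θ + k) := by
      conv_lhs => rw [show θ + ((k + 1 : ℕ) : ℝ) = 1 + (θ + k) by push_cast; ring]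
      rw [Real.rpow_add_of_nonneg (by linarith) zero_le_one (by positivity), Real.rpow_one]
    have hm := mul_le_mul_of_nonneg_left (h y hy) (by linarith : 0 ≤ 1 + y)
    have hP : 1 ≤ (1 + |y|) ^ (k + 1) := one_le_pow₀ (by linarith [abs_nonneg y])
    have hQ : (1 + y) * (1 + |y|) ^ k ≤ (1 + |y|) ^ (k + 1) := by
      rw [pow_succ']
      gcongr
      exact le_abs_self y
    rw [e]
    push_cast
    have a1 : (θ + k) * y ^ 2 * 1 ≤ (θ + k) * y ^ 2 * (1 + |y|) ^ (k + 1) := by gcongr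
    have a2 : C * y ^ 2 * ((1 + y) * (1 + |y|) ^ k) ≤ C * y ^ 2 * (1 + |y|) ^ (k + 1) := by gcongr
    linarith

lemma exists_one_add_rpow_le {s : ℝ} (hs : 1 ≤ s) :
    ∃ (k : ℕ) (C : ℝ), 0 ≤ C ∧ ∀ y : ℝ, -1 ≤ y →
      (1 + y) ^ s ≤ 1 + s * y + C * y ^ 2 * (1 + |y|) ^ k := by
  have h0 : 0 ≤ s - 1 := by linarith
  have h1 := Nat.floor_le h0
  have h2 := (Nat.lt_floor_add_one (s - 1)).le
  obtain ⟨C, hC, h⟩ := exists_one_add_rpow_add_nat_le (θ := s - ⌊s - 1⌋₊) (by linarith)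
    (by linarith) ⌊s - 1⌋₊
  exact ⟨⌊s - 1⌋₊, C, hC, fun y hy => by simpa using h y hy⟩

/-- The bound on the relative growth of the energy over one time step of size `t ^ 2`, when the
increment of the Wiener process is `t * x`; for a standard normal `x` the first two terms have mean
zero. -/
def growth (A t a b x : ℝ) : ℝ :=
  a * (t * x) + b * ((t * x) ^ 2 - t ^ 2) + A * ((t * x) ^ 2 + ((t * x) ^ 2 - t ^ 2) ^ 2 + t ^ 2)

lemma abs_growth_le {A t R a b : ℝ} (hA : 0 ≤ A) (ht : 0 ≤ t) (htR : t ≤ R)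
    (ha : |a| ≤ A) (hb : |b| ≤ A) (x : ℝ) :
    |growth A t a b x - (a * (t * x) + b * ((t * x) ^ 2 - t ^ 2))|
        ≤ A * (2 + R ^ 2) * t ^ 2 * (1 + |x|) ^ 4 ∧
      |growth A t a b x| ≤ A * (1 + 3 * R + R ^ 3) * t * (1 + |x|) ^ 4 := by
  set w := 1 + |x| with hw
  have hw1 : 1 ≤ w := by linarith [abs_nonneg x]
  have hw2 : w ^ 2 ≤ w ^ 4 := pow_le_pow_right₀ hw1 (by norm_num)
  have hw3 : w ≤ w ^ 4 := le_self_pow₀ hw1 (by norm_num)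
  have hw4 : 1 ≤ w ^ 4 := one_le_pow₀ hw1
  have hx : |x| ≤ w := by linarith
  have hx2 : x ^ 2 ≤ w ^ 2 := by rw [← sq_abs x]; gcongr
  have e1 : |t * x| ≤ t * w := by rw [abs_mul, abs_of_nonneg ht]; gcongr
  have e2 : |(t * x) ^ 2 - t ^ 2| ≤ t ^ 2 * w ^ 2 := by
    rw [abs_le]
    constructor <;> nlinarith [sq_nonneg t, sq_nonneg x, mul_le_mul_of_nonneg_left hx2 (sq_nonneg t),
      mul_nonneg (sq_nonneg t) (sq_nonneg x), mul_le_mul_of_nonneg_left (one_le_pow₀ hw1 (n := 2))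
      (sq_nonneg t)]
  have e3 : ((t * x) ^ 2 - t ^ 2) ^ 2 ≤ (t ^ 2 * w ^ 2) ^ 2 := by rw [← sq_abs]; gcongr
  have e4 : (t * x) ^ 2 ≤ t ^ 2 * w ^ 2 := by rw [mul_pow]; gcongr
  have e5 : 0 ≤ (t * x) ^ 2 + ((t * x) ^ 2 - t ^ 2) ^ 2 + t ^ 2 := by positivity
  have hR : 0 ≤ R := ht.trans htR
  have e6 : (t * x) ^ 2 + ((t * x) ^ 2 - t ^ 2) ^ 2 + t ^ 2 ≤ (2 + R ^ 2) * t ^ 2 * w ^ 4 := by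
    have : t ^ 2 * (t ^ 2 * w ^ 4) ≤ R ^ 2 * (t ^ 2 * w ^ 4) := by gcongr
    nlinarith [mul_le_mul_of_nonneg_left hw2 (sq_nonneg t),
      mul_le_mul_of_nonneg_left hw4 (sq_nonneg t)]
  have e7 : (t * x) ^ 2 + ((t * x) ^ 2 - t ^ 2) ^ 2 + t ^ 2 ≤ (2 * R + R ^ 3) * t * w ^ 4 := by
    refine e6.trans ?_
    have : (2 + R ^ 2) * t ^ 2 * w ^ 4 = (2 + R ^ 2) * t * t * w ^ 4 := by ring
    rw [this, show (2 * R + R ^ 3) * t = (2 + R ^ 2) * t * R by ring]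
    gcongr
  constructor
  · rw [show growth A t a b x - (a * (t * x) + b * ((t * x) ^ 2 - t ^ 2))
      = A * ((t * x) ^ 2 + ((t * x) ^ 2 - t ^ 2) ^ 2 + t ^ 2) by unfold growth; ring,
      abs_of_nonneg (by positivity)]
    calc _ ≤ A * ((2 + R ^ 2) * t ^ 2 * w ^ 4) := by gcongr
      _ = _ := by ring
  · calc |growth A t a b x| ≤ |a| * |t * x| + |b| * |(t * x) ^ 2 - t ^ 2|
          + A * ((t * x) ^ 2 + ((t * x) ^ 2 - t ^ 2) ^ 2 + t ^ 2) := by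
          unfold growth
          refine (abs_add_le _ _).trans (add_le_add ((abs_add_le _ _).trans ?_) ?_)
          · rw [abs_mul, abs_mul b]
          · rw [abs_of_nonneg (by positivity)]
      _ ≤ A * (t * w) + A * (t ^ 2 * w ^ 2) + A * ((2 * R + R ^ 3) * t * w ^ 4) := by gcongr
      _ ≤ A * (t * w ^ 4) + A * (R * t * w ^ 4) + A * ((2 * R + R ^ 3) * t * w ^ 4) := by
          rw [pow_two t]
          gcongr
      _ = _ := by ring

/-- The expansion of the `s`-th power of the energy growth: up to terms with mean zero, the excess
over `1` is of the order of the time step `t ^ 2`. -/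
lemma exists_one_add_growth_rpow_le {s A R : ℝ} (hs : 1 ≤ s) (hA : 0 ≤ A) (hR : 0 ≤ R) :
    ∃ (K : ℝ) (m : ℕ), 0 ≤ K ∧ ∀ t a b x : ℝ, 0 ≤ t → t ≤ R → |a| ≤ A → |b| ≤ A →
      -1 ≤ growth A t a b x →
      (1 + growth A t a b x) ^ s
        ≤ 1 + s * t * a * x + s * t ^ 2 * b * (x ^ 2 - 1) + K * t ^ 2 * (1 + |x|) ^ m := by
  obtain ⟨k, C, hC, h⟩ := exists_one_add_rpow_le hs
  set M := A * (1 + 3 * R + R ^ 3) with hM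
  have hM0 : 0 ≤ M := by positivity
  refine ⟨s * (A * (2 + R ^ 2)) + C * M ^ 2 * (1 + M * R) ^ k, 8 + 4 * k, by positivity, ?_⟩
  intro t a b x ht htR ha hb hY
  obtain ⟨h1, h2⟩ := abs_growth_le hA ht htR ha hb x
  have h3 := h _ hY
  set Y := growth A t a b x
  rw [← hM] at h2
  set w := 1 + |x| with hw
  have hw1 : 1 ≤ w := by linarith [abs_nonneg x]
  have hw4 : 1 ≤ w ^ 4 := one_le_pow₀ hw1
  have hwm : w ^ 4 ≤ w ^ (8 + 4 * k) := pow_le_pow_right₀ hw1 (by omega)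
  have h4 : Y ^ 2 ≤ M ^ 2 * t ^ 2 * w ^ 8 := by
    calc Y ^ 2 = |Y| ^ 2 := (sq_abs Y).symm
      _ ≤ (M * t * w ^ 4) ^ 2 := by gcongr
      _ = _ := by ring
  have h5 : (1 + |Y|) ^ k ≤ (1 + M * R) ^ k * w ^ (4 * k) := by
    rw [pow_mul, ← mul_pow]
    gcongr
    calc 1 + |Y| ≤ w ^ 4 + M * R * w ^ 4 := by
          refine add_le_add hw4 (h2.trans ?_)
          gcongr
      _ = _ := by ring
  have h6 : C * Y ^ 2 * (1 + |Y|) ^ k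
      ≤ C * M ^ 2 * (1 + M * R) ^ k * t ^ 2 * w ^ (8 + 4 * k) := by
    calc C * Y ^ 2 * (1 + |Y|) ^ k
        ≤ C * (M ^ 2 * t ^ 2 * w ^ 8) * ((1 + M * R) ^ k * w ^ (4 * k)) := by gcongr
      _ = _ := by rw [pow_add]; ring
  have h7 : Y ≤ a * (t * x) + b * ((t * x) ^ 2 - t ^ 2)
      + A * (2 + R ^ 2) * t ^ 2 * w ^ (8 + 4 * k) := by
    have : A * (2 + R ^ 2) * t ^ 2 * w ^ 4 ≤ A * (2 + R ^ 2) * t ^ 2 * w ^ (8 + 4 * k) := by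
      gcongr
    linarith [(abs_le.1 h1).2]
  have h8 := mul_le_mul_of_nonneg_left h7 (by linarith : 0 ≤ s)
  linarith

variable {Ω : Type*} {mΩ : MeasurableSpace Ω} {P : Measure Ω}

lemma integrable_mul_comp_of_indep {m : MeasurableSpace Ω} {η : Ω → ℝ}
    (hη : Indep m (MeasurableSpace.comap η inferInstance) P) {f : Ω → ℝ}
    (hf : StronglyMeasurable[m] f) (hfi : Integrable f P) {g : ℝ → ℝ} (hg : Measurable g)
    (hgi : Integrable (fun ω => g (η ω)) P) :
    Integrable (fun ω => f ω * g (η ω)) P ∧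
      ∫ ω, f ω * g (η ω) ∂P = (∫ ω, f ω ∂P) * ∫ ω, g (η ω) ∂P := by
  have hi : IndepFun f (fun ω => g (η ω)) P := by
    rw [IndepFun_iff_Indep]
    refine indep_of_indep_of_le_left (indep_of_indep_of_le_right hη ?_) hf.measurable.comap_le
    rw [show (fun ω => g (η ω)) = g ∘ η from rfl, ← MeasurableSpace.comap_comp]
    exact MeasurableSpace.comap_mono hg.comap_le
  exact ⟨hi.integrable_mul hfi hgi,
    hi.integral_fun_mul_eq_mul_integral hfi.aestronglyMeasurable hgi.aestronglyMeasurable⟩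

lemma integrable_one_add_abs_pow (m : ℕ) :
    Integrable (fun x : ℝ => (1 + |x|) ^ m) (gaussianReal 0 1) := by
  have h : MemLp (fun x : ℝ => 1 + |x|) m (gaussianReal 0 1) := by
    refine MemLp.add (memLp_const 1) ?_
    exact (memLp_id_gaussianReal' m (by simp)).norm
  refine h.integrable_norm_pow'.congr (ae_of_all _ fun x => ?_)
  simp only [Real.norm_eq_abs]
  rw [abs_of_nonneg (by positivity)]

lemma integral_sq_gaussianReal_zero_one : ∫ x : ℝ, x ^ 2 ∂(gaussianReal 0 1) = 1 := by
  have h := variance_id_gaussianReal (μ := 0) (v := 1)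
  rw [variance_of_integral_eq_zero (by fun_prop) (by simp)] at h
  simpa using h

/-- If the energy grows over a time step of size `t ^ 2` at most by the factor
`1 + growth A t α β η`, with `α`, `β` independent of the standard normal `η`, then its `s`-th moment
grows at most by a factor `1 + K * t ^ 2`. -/
lemma exists_moment_step [IsProbabilityMeasure P] {s A R : ℝ} (hs : 1 ≤ s) (hA : 0 ≤ A) (hR : 0 ≤ R) :
    ∃ K : ℝ, 0 ≤ K ∧ ∀ (m : MeasurableSpace Ω), m ≤ mΩ → ∀ (η Z Z' α β : Ω → ℝ) (t : ℝ),
      0 ≤ t → t ≤ R → HasLaw η (gaussianReal 0 1) P →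
      Indep m (MeasurableSpace.comap η inferInstance) P →
      StronglyMeasurable[m] Z → StronglyMeasurable[m] α → StronglyMeasurable[m] β →
      AEStronglyMeasurable[mΩ] Z' P → (∀ ω, 1 ≤ Z ω) → (∀ ω, 0 ≤ Z' ω) →
      (∀ ω, |α ω| ≤ A) → (∀ ω, |β ω| ≤ A) →
      (∀ᵐ ω ∂P, Z' ω ≤ Z ω * (1 + growth A t (α ω) (β ω) (η ω))) →
      Integrable (fun ω => Z ω ^ s) P →
      Integrable (fun ω => Z' ω ^ s) P ∧
        ∫ ω, Z' ω ^ s ∂P ≤ (1 + K * t ^ 2) * ∫ ω, Z ω ^ s ∂P := by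
  obtain ⟨K, k, hK, h⟩ := exists_one_add_growth_rpow_le hs hA hR
  have hI0 : 0 ≤ ∫ x : ℝ, (1 + |x|) ^ k ∂(gaussianReal 0 1) :=
    integral_nonneg fun x => by positivity
  refine ⟨K * ∫ x : ℝ, (1 + |x|) ^ k ∂(gaussianReal 0 1), by positivity, ?_⟩
  intro m hm η Z Z' α β t ht htR hlaw hind hZ hα hβ hZ' hZ1 hZ0' hαA hβA hle hint
  have hη : AEMeasurable η P := hlaw.aemeasurable
  have hcomp : ∀ g : ℝ → ℝ, Measurable g → Integrable g (gaussianReal 0 1) →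
      Integrable (fun ω => g (η ω)) P ∧ ∫ ω, g (η ω) ∂P = ∫ x, g x ∂(gaussianReal 0 1) := by
    intro g hg hgi
    rw [← hlaw.map_eq] at hgi
    exact ⟨hgi.comp_aemeasurable hη, hlaw.integral_comp hg.aestronglyMeasurable⟩
  have hZs : StronglyMeasurable[m] fun ω => Z ω ^ s :=
    (hZ.measurable.pow_const s).stronglyMeasurable
  have hf : ∀ γ : Ω → ℝ, StronglyMeasurable[m] γ → (∀ ω, |γ ω| ≤ A) →
      Integrable (fun ω => Z ω ^ s * γ ω) P := fun γ hγ hγA =>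
    hint.mul_bdd (c := A) (hγ.mono hm).aestronglyMeasurable (ae_of_all _ fun ω => hγA ω)
  have hid : Integrable (fun x : ℝ => x) (gaussianReal 0 1) :=
    (memLp_id_gaussianReal' 1 (by simp)).integrable le_rfl
  have hsq : Integrable (fun x : ℝ => x ^ 2) (gaussianReal 0 1) :=
    (memLp_id_gaussianReal' 2 (by simp)).integrable_sq
  have hsq1 : Integrable (fun x : ℝ => x ^ 2 - 1) (gaussianReal 0 1) :=
    hsq.sub (integrable_const 1)
  obtain ⟨i1, j1⟩ := hcomp (fun x => x) measurable_id hid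
  obtain ⟨i2, j2⟩ := hcomp (fun x => x ^ 2 - 1) (by fun_prop) hsq1
  obtain ⟨i3, j3⟩ := hcomp (fun x => (1 + |x|) ^ k) (by fun_prop) (integrable_one_add_abs_pow k)
  have z1 : ∫ x : ℝ, x ∂(gaussianReal 0 1) = 0 := integral_id_gaussianReal
  have z2 : ∫ x : ℝ, x ^ 2 - 1 ∂(gaussianReal 0 1) = 0 := by
    rw [integral_sub hsq (integrable_const 1), integral_sq_gaussianReal_zero_one]
    simp
  obtain ⟨a1, b1⟩ := integrable_mul_comp_of_indep hind (hZs.mul hα) (hf α hα hαA)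
    (g := fun x => x) measurable_id i1
  obtain ⟨a2, b2⟩ := integrable_mul_comp_of_indep hind (hZs.mul hβ) (hf β hβ hβA)
    (g := fun x => x ^ 2 - 1) (by fun_prop) i2
  obtain ⟨a3, b3⟩ := integrable_mul_comp_of_indep hind hZs hint
    (g := fun x => (1 + |x|) ^ k) (by fun_prop) i3
  rw [j1, z1, mul_zero] at b1
  rw [j2, z2, mul_zero] at b2
  rw [j3] at b3
  -- `Z' ≥ 0` forces `growth ≥ -1`, as the expansion of the `s`-th power requires.
  have hbound : ∀ᵐ ω ∂P, Z' ω ^ s ≤ Z ω ^ s + s * t * (Z ω ^ s * α ω * η ω)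
      + s * t ^ 2 * (Z ω ^ s * β ω * (η ω ^ 2 - 1)) + K * t ^ 2 * (Z ω ^ s * (1 + |η ω|) ^ k) := by
    filter_upwards [hle] with ω hω
    have hZpos : 0 < Z ω := by linarith [hZ1 ω]
    have hY : 0 ≤ 1 + growth A t (α ω) (β ω) (η ω) :=
      nonneg_of_mul_nonneg_right ((hZ0' ω).trans hω) hZpos
    have hp := h t (α ω) (β ω) (η ω) ht htR (hαA ω) (hβA ω) (by linarith)
    calc Z' ω ^ s ≤ (Z ω * (1 + growth A t (α ω) (β ω) (η ω))) ^ s := by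
          have := hZ0' ω
          gcongr
      _ = Z ω ^ s * (1 + growth A t (α ω) (β ω) (η ω)) ^ s := Real.mul_rpow hZpos.le hY
      _ ≤ Z ω ^ s * _ := mul_le_mul_of_nonneg_left hp (by positivity)
      _ = _ := by ring
  have hi := ((hint.add (a1.const_mul (s * t))).add (a2.const_mul (s * t ^ 2))).add
    (a3.const_mul (K * t ^ 2))
  have hZs' : Integrable (fun ω => Z' ω ^ s) P := by
    refine hi.mono' (hZ'.aemeasurable.pow_const s).aestronglyMeasurable ?_
    filter_upwards [hbound] with ω hω
    have := hZ0' ω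
    rw [Real.norm_of_nonneg (by positivity)]
    exact hω
  refine ⟨hZs', (integral_mono_ae hZs' hi hbound).trans_eq ?_⟩
  rw [integral_add' ((hint.add (a1.const_mul (s * t))).add (a2.const_mul (s * t ^ 2)))
    (a3.const_mul (K * t ^ 2)), integral_add' (hint.add (a1.const_mul (s * t)))
    (a2.const_mul (s * t ^ 2)), integral_add' hint (a1.const_mul (s * t)),
    integral_const_mul, integral_const_mul, integral_const_mul, b1, b2, b3]
  ring

/-- The energy after adding the Milstein noise terms `ξ • g + ½ (ξ ^ 2 - τ) • k`, where `ξ = t * x`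
and `τ = t ^ 2`; the term `t ^ 2 * B` is the contribution of the drift. -/
lemma one_add_norm_sq_le_growth {H : Type*} [NormedAddCommGroup H] [InnerProductSpace ℝ H]
    {c B t x : ℝ} (hc : 0 ≤ c) (hB : 0 ≤ B) {u g k : H} (hg : ‖g‖ ≤ c * (‖u‖ + 1))
    (hk : ‖k‖ ≤ c * (‖u‖ + 1)) :
    |2 * inner ℝ u g / (1 + ‖u‖ ^ 2)| ≤ 4 * c + 4 * c ^ 2 + B ∧
    |inner ℝ u k / (1 + ‖u‖ ^ 2)| ≤ 4 * c + 4 * c ^ 2 + B ∧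
    1 + ‖u + (t * x) • g + (1 / 2 * ((t * x) ^ 2 - t ^ 2)) • k‖ ^ 2 + t ^ 2 * B
      ≤ (1 + ‖u‖ ^ 2) * (1 + growth (4 * c + 4 * c ^ 2 + B) t (2 * inner ℝ u g / (1 + ‖u‖ ^ 2))
          (inner ℝ u k / (1 + ‖u‖ ^ 2)) x) := by
  have hZ : 0 < 1 + ‖u‖ ^ 2 := by positivity
  have hu : ‖u‖ * (‖u‖ + 1) ≤ 2 * (1 + ‖u‖ ^ 2) := by nlinarith [sq_nonneg (‖u‖ - 1), norm_nonneg u]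
  have hu2 : (‖u‖ + 1) ^ 2 ≤ 2 * (1 + ‖u‖ ^ 2) := by nlinarith [sq_nonneg (‖u‖ - 1)]
  have aux : ∀ f : H, ‖f‖ ≤ c * (‖u‖ + 1) → |inner ℝ u f| ≤ 2 * c * (1 + ‖u‖ ^ 2) ∧
      ‖f‖ ^ 2 ≤ 2 * c ^ 2 * (1 + ‖u‖ ^ 2) := by
    intro f hf
    constructor
    · calc |inner ℝ u f| ≤ ‖u‖ * ‖f‖ := abs_real_inner_le_norm u f
        _ ≤ ‖u‖ * (c * (‖u‖ + 1)) := by gcongr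
        _ = c * (‖u‖ * (‖u‖ + 1)) := by ring
        _ ≤ c * (2 * (1 + ‖u‖ ^ 2)) := by gcongr
        _ = _ := by ring
    · calc ‖f‖ ^ 2 ≤ (c * (‖u‖ + 1)) ^ 2 := by gcongr
        _ = c ^ 2 * (‖u‖ + 1) ^ 2 := by ring
        _ ≤ c ^ 2 * (2 * (1 + ‖u‖ ^ 2)) := by gcongr
        _ = _ := by ring
  obtain ⟨g1, g2⟩ := aux g hg
  obtain ⟨k1, k2⟩ := aux k hk
  refine ⟨?_, ?_, ?_⟩
  · rw [abs_div, abs_mul, abs_of_pos hZ, div_le_iff₀ hZ, abs_two]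
    nlinarith [mul_nonneg (by positivity : 0 ≤ 4 * c ^ 2 + B) hZ.le]
  · rw [abs_div, abs_of_pos hZ, div_le_iff₀ hZ]
    nlinarith [mul_nonneg (by positivity : 0 ≤ 2 * c + 4 * c ^ 2 + B) hZ.le]
  · set ξ := t * x
    set Z := 1 + ‖u‖ ^ 2
    set c' := 1 / 2 * (ξ ^ 2 - t ^ 2) with hc'
    have e1 : ‖u + ξ • g + c' • k‖ ^ 2 = ‖u‖ ^ 2 + 2 * ξ * inner ℝ u g + 2 * c' * inner ℝ u k
        + ‖ξ • g + c' • k‖ ^ 2 := by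
      rw [add_assoc, norm_add_sq_real, inner_add_right, inner_smul_right, inner_smul_right]
      ring
    have e2 : ‖ξ • g + c' • k‖ ^ 2 ≤ 2 * (ξ ^ 2 * ‖g‖ ^ 2 + c' ^ 2 * ‖k‖ ^ 2) := by
      have h1 := norm_add_le (ξ • g) (c' • k)
      have h2 : ‖ξ • g‖ ^ 2 = ξ ^ 2 * ‖g‖ ^ 2 := by
        rw [norm_smul, mul_pow, Real.norm_eq_abs, sq_abs]
      have h3 : ‖c' • k‖ ^ 2 = c' ^ 2 * ‖k‖ ^ 2 := by
        rw [norm_smul, mul_pow, Real.norm_eq_abs, sq_abs]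
      rw [← h2, ← h3]
      have := pow_le_pow_left₀ (norm_nonneg _) h1 2
      nlinarith [sq_nonneg (‖ξ • g‖ - ‖c' • k‖)]
    have e3 : ξ ^ 2 * ‖g‖ ^ 2 ≤ ξ ^ 2 * (2 * c ^ 2 * Z) := by gcongr
    have e4 : c' ^ 2 * ‖k‖ ^ 2 ≤ c' ^ 2 * (2 * c ^ 2 * Z) := by gcongr
    have e5 : Z * (1 + growth (4 * c + 4 * c ^ 2 + B) t (2 * inner ℝ u g / Z) (inner ℝ u k / Z) x)
        = Z + 2 * ξ * inner ℝ u g + 2 * c' * inner ℝ u k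
          + (4 * c + 4 * c ^ 2 + B) * (ξ ^ 2 + 4 * c' ^ 2 + t ^ 2) * Z := by
      have : growth (4 * c + 4 * c ^ 2 + B) t (2 * inner ℝ u g / Z) (inner ℝ u k / Z) x
        = 2 * inner ℝ u g / Z * ξ + inner ℝ u k / Z * (ξ ^ 2 - t ^ 2)
          + (4 * c + 4 * c ^ 2 + B) * (ξ ^ 2 + (ξ ^ 2 - t ^ 2) ^ 2 + t ^ 2) := rfl
      rw [this, hc']
      field_simp
      ring
    have hZ1 : 1 ≤ Z := by simp only [Z]; nlinarith [sq_nonneg ‖u‖]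
    rw [e5, e1]
    have hZe : 1 + ‖u‖ ^ 2 = Z := rfl
    have f1 : t ^ 2 * B * 1 ≤ t ^ 2 * B * Z := by gcongr
    have f2 : 0 ≤ (4 * c + B) * (ξ ^ 2 + 4 * c' ^ 2) * Z := by positivity
    have f3 : 0 ≤ (4 * c + 4 * c ^ 2) * t ^ 2 * Z := by positivity
    have f4 : 0 ≤ c ^ 2 * c' ^ 2 * Z := by positivity
    nlinarith

end

section

/-! ### The diffusion map -/

section Diffusion

variable {H : Type} [NormedAddCommGroup H] [NormedSpace ℝ H] {G : H → H} {DG : H → H →L[ℝ] H}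

lemma DiffusionAssumptions.continuous (hG : DiffusionAssumptions G DG) : Continuous G := by
  obtain ⟨C, hC⟩ := hG.lipschitz
  refine (LipschitzWith.of_dist_le_mul (K := C.toNNReal) fun v w => ?_).continuous
  rw [dist_eq_norm, dist_eq_norm]
  exact (hC v w).trans (mul_le_mul_of_nonneg_right (Real.le_coe_toNNReal C) (norm_nonneg _))

/-- A bounded second Gateaux derivative makes the first one Lipschitz continuous. -/
lemma DiffusionAssumptions.continuous_deriv (hG : DiffusionAssumptions G DG) : Continuous DG := by
  obtain ⟨C, D2G, hD, hC⟩ := hG.bounded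
  have hC0 : 0 ≤ C := (by positivity : 0 ≤ ‖DG 0‖ + ‖D2G 0‖).trans (hC 0 0)
  refine (LipschitzWith.of_dist_le_mul (K := ⟨C, hC0⟩) fun v w => ?_).continuous
  rw [dist_eq_norm, dist_eq_norm]
  have h1 : ∀ t : ℝ, HasDerivAt (fun t : ℝ => DG (w + t • (v - w)))
      (D2G (w + t • (v - w)) (v - w)) t := by
    intro t
    have h : HasDerivAt (fun s : ℝ => DG (w + t • (v - w) + s • (v - w)))
        (D2G (w + t • (v - w)) (v - w)) (t - t) := by
      rw [sub_self]
      exact hD (w + t • (v - w)) (v - w)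
    refine (h.comp_sub_const t t).congr_of_eventuallyEq (Filter.Eventually.of_forall fun s => ?_)
    simp only
    congr 1
    module
  have h2 := norm_image_sub_le_of_norm_deriv_le_segment_01'
    (fun t _ => (h1 t).hasDerivWithinAt) (C := C * ‖v - w‖) fun t _ => by
      refine (ContinuousLinearMap.le_opNorm _ _).trans ?_
      gcongr
      linarith [hC 0 (w + t • (v - w)), norm_nonneg (DG 0)]
  rw [one_smul, zero_smul, add_zero, add_sub_cancel] at h2
  exact h2

lemma DiffusionAssumptions.exists_norm_deriv_le (hG : DiffusionAssumptions G DG) :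
    ∃ C : ℝ, 0 ≤ C ∧ ∀ u, ‖DG u‖ ≤ C := by
  obtain ⟨C, D2G, -, hC⟩ := hG.bounded
  have h : ∀ u, ‖DG u‖ ≤ C := fun u => by linarith [hC u 0, norm_nonneg (D2G 0)]
  exact ⟨C, (norm_nonneg _).trans (h 0), h⟩

end Diffusion

variable {d : ℕ} {L σ : ℝ}

/-- Linear growth of the projected noise coefficients, measured by the gradient alone, uniformly
over the triangulations. -/
lemma exists_noise_growth (hd : 0 < d) (hL : 0 < L) (hσ : 0 < σ)
    {G : H10 (box d L) → H10 (box d L)} {DG : H10 (box d L) → H10 (box d L) →L[ℝ] H10 (box d L)}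
    (hG : DiffusionAssumptions G DG) :
    ∃ c : ℝ, 0 ≤ c ∧ ∀ 𝒯 : Geometry.SimplicialComplex ℝ (E d), IsTriangulation 𝒯 (box d L) →
      ∀ r, IsShapeRegular 𝒯 σ r → ∀ Ph : H10 (box d L) →ₗ[ℝ] Vh (box d L) 𝒯, IsL2Proj Ph →
      ∀ v : H10 (box d L), ‖grad (Ph (G v) : H10 (box d L))‖ ≤ c * (‖grad v‖ + 1) ∧
        ‖grad (Ph (DG v (G v)) : H10 (box d L))‖ ≤ c * (‖grad v‖ + 1) := by
  obtain ⟨C, hC⟩ := hG.growth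
  obtain ⟨C', hC0', hC'⟩ := hG.exists_norm_deriv_le
  have hC0 : 0 ≤ C := by
    have := (norm_nonneg _).trans (hC 0)
    simpa using this
  set S := 72 * ((4 * σ) ^ d + 1) * 3 ^ d * σ ^ 2 with hS
  have hS0 : 0 ≤ S := by positivity
  refine ⟨√S * (1 + C') * C * (1 + L), by positivity, ?_⟩
  intro 𝒯 hT r hr Ph hP v
  have h1 : ∀ w : H10 (box d L), ‖grad (Ph w : H10 (box d L))‖ ≤ √S * ‖w‖ := by
    intro w
    refine (sq_le_sq₀ (norm_nonneg _) (by positivity)).1 ?_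
    rw [mul_pow, Real.sq_sqrt hS0]
    refine (hP.norm_grad_sq_le hL hσ hT hr w).trans ?_
    gcongr
    exact norm_grad_le w
  have h2 : ‖v‖ ≤ (1 + L) * ‖grad v‖ := by
    refine (sq_le_sq₀ (norm_nonneg _) (by positivity)).1 ?_
    rw [norm_sq_eq]
    have := pow_le_pow_left₀ (norm_nonneg _) (poincare hd hL v) 2
    nlinarith [mul_nonneg hL.le (sq_nonneg ‖grad v‖)]
  have h3 : ‖G v‖ ≤ C * (1 + L) * (‖grad v‖ + 1) := by
    refine (hC v).trans ?_
    rw [mul_assoc]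
    gcongr
    linarith
  have h4 : ‖DG v (G v)‖ ≤ C' * ‖G v‖ := by
    refine ((DG v).le_opNorm _).trans ?_
    gcongr
    exact hC' v
  constructor
  · calc _ ≤ √S * ‖G v‖ := h1 _
      _ ≤ √S * ((1 + C') * ‖G v‖) := by
          gcongr
          nlinarith [norm_nonneg (G v)]
      _ ≤ √S * ((1 + C') * (C * (1 + L) * (‖grad v‖ + 1))) := by gcongr
      _ = _ := by ring
  · calc _ ≤ √S * ‖DG v (G v)‖ := h1 _
      _ ≤ √S * ((1 + C') * ‖G v‖) := by
          gcongr
          nlinarith [norm_nonneg (G v)]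
      _ ≤ √S * ((1 + C') * (C * (1 + L) * (‖grad v‖ + 1))) := by gcongr
      _ = _ := by ring

/-! ### The increments of the Wiener process -/

section Increments

variable {Ω : Type*} {mΩ : MeasurableSpace Ω} {P : Measure Ω} {ℱ : Filtration ℝ≥0 mΩ}
  {W : ℝ≥0 → Ω → ℝ} {T : ℝ≥0} {N : ℕ}

lemma IsWiener.hasLaw_incr_div (hW : IsWiener P ℱ W) (hτ : 0 < step T N) (n : ℕ) :
    HasLaw (fun ω => incr W T N n ω / √(step T N : ℝ)) (gaussianReal 0 1) P := by
  have e : nndist ((n + 1 : ℕ) * step T N : ℝ≥0).1 (n * step T N : ℝ≥0).1 = step T N := by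
    ext
    change dist (((n + 1 : ℕ) * step T N : ℝ≥0) : ℝ) ((n * step T N : ℝ≥0) : ℝ) = _
    rw [Real.dist_eq]
    push_cast
    rw [show ((n : ℝ) + 1) * step T N - n * step T N = step T N by ring]
    simp
  have h0 := hW.brownian.toIsPreBrownianReal.hasLaw_sub ((n + 1 : ℕ) * step T N) (n * step T N)
  rw [e] at h0
  have h := gaussianReal_div_const h0 √(step T N : ℝ)
  have e2 : step T N / NNReal.mk (√(step T N : ℝ) ^ 2) (sq_nonneg _) = 1 := by
    ext
    change (step T N : ℝ) / (√(step T N : ℝ) ^ 2) = 1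
    rw [Real.sq_sqrt (step T N).coe_nonneg, div_self (by positivity)]
  rw [zero_div, e2] at h
  exact h

lemma IsWiener.indep_incr_div (hW : IsWiener P ℱ W) (n : ℕ) (c : ℝ) :
    Indep (ℱ (n * step T N)) (MeasurableSpace.comap (fun ω => incr W T N n ω / c) inferInstance)
      P := by
  refine indep_of_indep_of_le_right
    (hW.indep (n * step T N) ((n + 1 : ℕ) * step T N) (by gcongr; simp)) ?_
  rw [show (fun ω => incr W T N n ω / c)
    = (fun x : ℝ => x / c) ∘ fun ω => W ((n + 1 : ℕ) * step T N) ω - W (n * step T N) ω from rfl,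
    ← MeasurableSpace.comap_comp]
  exact MeasurableSpace.comap_mono (by fun_prop : Measurable fun x : ℝ => x / c).comap_le

end Increments

/-! ### Moments of the energy along the scheme -/

variable {Ω : Type*} {mΩ : MeasurableSpace Ω} {P : Measure Ω} [IsProbabilityMeasure P]

/-- The moments of the energy `1 + ‖∇ u_h^n‖ ^ 2` grow at most exponentially along the scheme,
provided that the initial value is also measurable. -/
lemma exists_energy_moment_bound (hd : d = 1 ∨ d = 2) (hL : 0 < L) (hσ : 0 < σ) {T : ℝ≥0}
    (hT0 : 0 < T) {j : ℕ} (hj : 1 ≤ j) {s : ℝ} (hs : 1 ≤ s) {ℱ : Filtration ℝ≥0 mΩ}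
    {W : ℝ≥0 → Ω → ℝ} (hW : IsWiener P ℱ W) {G : H10 (box d L) → H10 (box d L)}
    {DG : H10 (box d L) → H10 (box d L) →L[ℝ] H10 (box d L)} (hG : DiffusionAssumptions G DG)
    (u₀ : Ω → H10 (box d L)) :
    ∃ K : ℝ, 0 ≤ K ∧ ∀ 𝒯 : Geometry.SimplicialComplex ℝ (E d), IsTriangulation 𝒯 (box d L) →
      MeshAssumption 𝒯 (box d L) → ∀ r, IsShapeRegular 𝒯 σ r → ∀ N : ℕ, 1 ≤ N →
      ∀ u : ℕ → Ω → Vh (box d L) 𝒯,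
      IsDiscreteSolution P ℱ W G DG u₀ (2 * j + 1) T 𝒯 N u →
      StronglyMeasurable[ℱ 0] (u 0) →
      Integrable (fun ω => (1 + ‖grad (u 0 ω : H10 (box d L))‖ ^ 2) ^ s) P →
      ∀ n ≤ N, Integrable (fun ω => (1 + ‖grad (u n ω : H10 (box d L))‖ ^ 2) ^ s) P ∧
        ∫ ω, (1 + ‖grad (u n ω : H10 (box d L))‖ ^ 2) ^ s ∂P
          ≤ (1 + K * step T N) ^ n * ∫ ω, (1 + ‖grad (u 0 ω : H10 (box d L))‖ ^ 2) ^ s ∂P := by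
  have hd0 : 0 < d := by omega
  obtain ⟨B, hB, hstep⟩ := exists_step_bound (d := d) hd hL hσ hj
  obtain ⟨c, hc, hnoise⟩ := exists_noise_growth hd0 hL hσ hG
  obtain ⟨K, hK, hmom⟩ := exists_moment_step (P := P) hs
    (by positivity : 0 ≤ 4 * c + 4 * c ^ 2 + B) (Real.sqrt_nonneg T)
  refine ⟨K, hK, ?_⟩
  intro 𝒯 hT hm r hr N hN u hu hu0 hint n
  obtain ⟨Ph, hP⟩ := exists_isL2Proj hL hT
  have hPc := hP.continuous hL hσ hT hr
  have hτ : 0 < step T N := div_pos hT0 (by exact_mod_cast hN)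
  have hτT : step T N ≤ T := div_le_self T.2 (by exact_mod_cast hN)
  have hmeas : ∀ n ≤ N, StronglyMeasurable[ℱ (n * step T N)] (u n) := by
    intro n hn
    rcases Nat.eq_zero_or_pos n with rfl | hn0
    · rw [show ((0 : ℕ) : ℝ≥0) * step T N = 0 by simp]
      exact hu0
    · exact hu.adapted n hn0 hn
  have hcg : Continuous fun v : Vh (box d L) 𝒯 => grad (v : H10 (box d L)) :=
    continuous_grad.comp continuous_subtype_val
  have hG1 : Continuous fun v : Vh (box d L) 𝒯 => G v := hG.continuous.comp continuous_subtype_val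
  have hG2 : Continuous fun v : Vh (box d L) 𝒯 => DG v (G v) :=
    (hG.continuous_deriv.comp continuous_subtype_val).clm_apply hG1
  have hne : ∀ v : Vh (box d L) 𝒯, 1 + ‖grad (v : H10 (box d L))‖ ^ 2 ≠ 0 := fun v => by positivity
  have hcZ : Continuous fun v : Vh (box d L) 𝒯 => 1 + ‖grad (v : H10 (box d L))‖ ^ 2 := by fun_prop
  induction n with
  | zero => exact fun _ => ⟨hint, by simp⟩
  | succ n ih =>
    intro hn
    obtain ⟨hi, hle⟩ := ih (by omega)
    have hmn := hmeas n (by omega)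
    have hle' := ℱ.le (n * step T N)
    have key := hmom (ℱ (n * step T N)) hle' (fun ω => incr W T N n ω / √(step T N : ℝ))
      (fun ω => 1 + ‖grad (u n ω : H10 (box d L))‖ ^ 2)
      (fun ω => 1 + ‖grad (u (n + 1) ω : H10 (box d L))‖ ^ 2)
      (fun ω => 2 * inner ℝ (grad (u n ω : H10 (box d L)))
        (grad (Ph (G (u n ω)) : H10 (box d L))) / (1 + ‖grad (u n ω : H10 (box d L))‖ ^ 2))
      (fun ω => inner ℝ (grad (u n ω : H10 (box d L)))
        (grad (Ph (DG (u n ω) (G (u n ω))) : H10 (box d L)))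
          / (1 + ‖grad (u n ω : H10 (box d L))‖ ^ 2))
      (√(step T N : ℝ)) (Real.sqrt_nonneg _) (Real.sqrt_le_sqrt (by exact_mod_cast hτT))
      (hW.hasLaw_incr_div hτ n) (hW.indep_incr_div n _)
      (hcZ.comp_stronglyMeasurable hmn)
      ((((continuous_const.mul (hcg.inner (hcg.comp (hPc.comp hG1)))).div hcZ
        hne)).comp_stronglyMeasurable hmn)
      ((((hcg.inner (hcg.comp (hPc.comp hG2)))).div hcZ hne).comp_stronglyMeasurable hmn)
      ((hcZ.comp_stronglyMeasurable (hmeas (n + 1) hn)).mono (ℱ.le _)).aestronglyMeasurable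
      (fun ω => by linarith [sq_nonneg ‖grad (u n ω : H10 (box d L))‖])
      (fun ω => by positivity)
      (fun ω => (one_add_norm_sq_le_growth (t := 0) (x := 0) hc hB
        (hnoise 𝒯 hT r hr Ph hP (u n ω)).1 (hnoise 𝒯 hT r hr Ph hP (u n ω)).2).1)
      (fun ω => (one_add_norm_sq_le_growth (t := 0) (x := 0) hc hB
        (hnoise 𝒯 hT r hr Ph hP (u n ω)).1 (hnoise 𝒯 hT r hr Ph hP (u n ω)).2).2.1)
      ?_ hi
    · refine ⟨key.1, key.2.trans ?_⟩
      rw [Real.sq_sqrt (step T N).coe_nonneg, pow_succ']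
      rw [mul_assoc]
      gcongr
    · filter_upwards [hu.scheme n (by omega)] with ω hω
      obtain ⟨g1, g2⟩ := hnoise 𝒯 hT r hr Ph hP (u n ω)
      have hb := (one_add_norm_sq_le_growth (t := √(step T N : ℝ))
        (x := incr W T N n ω / √(step T N : ℝ)) hc hB g1 g2).2.2
      refine le_trans ?_ hb
      have e1 : √(step T N : ℝ) * (incr W T N n ω / √(step T N : ℝ)) = incr W T N n ω :=
        mul_div_cancel₀ _ (by positivity)
      rw [e1, Real.sq_sqrt (step T N).coe_nonneg]
      -- Since the test functions lie in `V_h`, the noise may be replaced by its projection.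
      have h := hstep 𝒯 hT hm r hr (u (n + 1) ω) (u n ω + (incr W T N n ω) • Ph (G (u n ω))
        + (1 / 2 * (incr W T N n ω ^ 2 - (step T N : ℝ))) • Ph (DG (u n ω) (G (u n ω))))
        (step T N) (step T N).coe_nonneg fun v => by
          have h1 := hω v
          rw [fn_sub, inner_sub_left] at h1 ⊢
          simp only [Submodule.coe_add, Submodule.coe_smul, fn_add, fn_smul, inner_add_left,
            real_inner_smul_left]
          rw [hP, hP]
          linarith
      simp only [Submodule.coe_add, Submodule.coe_smul, grad_add, grad_smul] at h
      linarith

end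

lemma sq_rpow_half {a : ℝ} (ha : 0 ≤ a) (p : ℝ) : (a ^ 2) ^ (p / 2) = a ^ p := by
  rw [← Real.rpow_natCast, ← Real.rpow_mul ha]
  congr 1
  push_cast
  ring

lemma one_add_sq_rpow_le {a b S p : ℝ} (hb : 0 ≤ b) (hS : 0 ≤ S) (h : a ^ 2 ≤ S * b ^ 2)
    (hp : 0 ≤ p) : (1 + a ^ 2) ^ (p / 2) ≤ (1 + S) ^ (p / 2) * (1 + b) ^ p := by
  rw [← sq_rpow_half (by positivity : 0 ≤ 1 + b), ← Real.mul_rpow (by positivity) (by positivity)]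
  refine Real.rpow_le_rpow (by positivity) ?_ (by positivity)
  nlinarith [mul_nonneg hS hb]

lemma integrable_one_add_norm_rpow {Ω : Type*} {mΩ : MeasurableSpace Ω} {P : Measure Ω}
    [IsFiniteMeasure P] {H : Type*} [NormedAddCommGroup H] {f : Ω → H} {p : ℝ} (hp : 0 < p)
    (hf : MemLp f (ENNReal.ofReal p) P) : Integrable (fun ω => (1 + ‖f ω‖) ^ p) P := by
  have h1 : MemLp (fun _ : Ω => (1 : ℝ)) (ENNReal.ofReal p) P := memLp_const 1
  refine ((h1.add hf.norm).integrable_norm_rpow (by simpa using hp) ENNReal.ofReal_ne_top).congr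
    (ae_of_all _ fun ω => ?_)
  have h2 : 0 ≤ 1 + ‖f ω‖ := by positivity
  simp [ENNReal.toReal_ofReal hp.le, abs_of_nonneg h2]

/-- The initial value of a solution may be replaced by the everywhere measurable `P_h u₀`. -/
lemma IsDiscreteSolution.exists_modification {d : ℕ} {L σ r : ℝ} (hL : 0 < L) (hσ : 0 < σ)
    {Ω : Type*} {mΩ : MeasurableSpace Ω} {P : Measure Ω} {ℱ : Filtration ℝ≥0 mΩ}
    {W : ℝ≥0 → Ω → ℝ} {G : H10 (box d L) → H10 (box d L)}
    {DG : H10 (box d L) → H10 (box d L) →L[ℝ] H10 (box d L)} {u₀ : Ω → H10 (box d L)}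
    (hu₀ : StronglyMeasurable[ℱ 0] u₀) {q : ℕ} {T : ℝ≥0}
    {𝒯 : Geometry.SimplicialComplex ℝ (E d)} (hT : IsTriangulation 𝒯 (box d L))
    (hr : IsShapeRegular 𝒯 σ r) {N : ℕ} {u : ℕ → Ω → Vh (box d L) 𝒯}
    (hu : IsDiscreteSolution P ℱ W G DG u₀ q T 𝒯 N u) :
    ∃ U : ℕ → Ω → Vh (box d L) 𝒯, IsDiscreteSolution P ℱ W G DG u₀ q T 𝒯 N U ∧
      StronglyMeasurable[ℱ 0] (U 0) ∧ (∀ n, U n =ᵐ[P] u n) ∧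
      ∀ ω, ‖grad (U 0 ω : H10 (box d L))‖ ^ 2
        ≤ 72 * ((4 * σ) ^ d + 1) * 3 ^ d * σ ^ 2 * ‖u₀ ω‖ ^ 2 := by
  obtain ⟨Ph, hP⟩ := exists_isL2Proj hL hT
  let U : ℕ → Ω → Vh (box d L) 𝒯 := fun n ω => if n = 0 then Ph (u₀ ω) else u n ω
  have hU0 : ∀ ω, U 0 ω = Ph (u₀ ω) := fun ω => if_pos rfl
  have hUn : ∀ n, n ≠ 0 → U n = u n := fun n hn => funext fun ω => if_neg hn
  have hae : ∀ n, U n =ᵐ[P] u n := by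
    intro n
    by_cases hn : n = 0
    · subst hn
      filter_upwards [hu.initial] with ω hω
      rw [hU0]
      exact eq_of_inner_fn_eq fun v => by rw [hP, hω]
    · rw [hUn n hn]
  refine ⟨U, ⟨fun n h1 hn => ?_, ae_of_all _ fun ω v => ?_, fun n hn => ?_⟩, ?_, hae, fun ω => ?_⟩
  · rw [hUn n (by omega)]
    exact hu.adapted n h1 hn
  · rw [hU0, hP]
  · filter_upwards [hu.scheme n hn, hae n] with ω hω he
    rw [hUn (n + 1) (by omega), he]
    exact hω
  · rw [show U 0 = fun ω => Ph (u₀ ω) from funext hU0]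
    exact (hP.continuous hL hσ hT hr).comp_stronglyMeasurable hu₀
  · rw [hU0]
    refine (hP.norm_grad_sq_le hL hσ hT hr (u₀ ω)).trans ?_
    gcongr
    exact norm_grad_le _

end MilsteinFEM

theorem theorem4p2 (d : ℕ) (hd : d = 1 ∨ d = 2) (L : ℝ) (hL : 0 < L) (T : ℝ≥0) (hT : 0 < T)
    (q : ℕ) (hq : 3 ≤ q) (hq_odd : Odd q) (p : ℝ) (hp : 2 ≤ p) (σ : ℝ) (hσ : 0 < σ)
    {Ω : Type*} {mΩ : MeasurableSpace Ω} (P : Measure Ω) [IsProbabilityMeasure P]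
    (ℱ : Filtration ℝ≥0 mΩ) (W : ℝ≥0 → Ω → ℝ) (hW : MilsteinFEM.IsWiener P ℱ W)
    (G : MilsteinFEM.H10 (MilsteinFEM.box d L) → MilsteinFEM.H10 (MilsteinFEM.box d L))
    (DG : MilsteinFEM.H10 (MilsteinFEM.box d L) →
      MilsteinFEM.H10 (MilsteinFEM.box d L) →L[ℝ] MilsteinFEM.H10 (MilsteinFEM.box d L))
    (hG : MilsteinFEM.DiffusionAssumptions G DG)
    (u₀ : Ω → MilsteinFEM.H10 (MilsteinFEM.box d L))
    (hu₀_meas : StronglyMeasurable[ℱ 0] u₀) (hu₀ : MemLp u₀ (ENNReal.ofReal p) P) :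
    ∃ C : ℝ, ∀ 𝒯 : Geometry.SimplicialComplex ℝ (MilsteinFEM.E d),
      MilsteinFEM.IsTriangulation 𝒯 (MilsteinFEM.box d L) →
      MilsteinFEM.QuasiUniform 𝒯 σ →
      MilsteinFEM.MeshAssumption 𝒯 (MilsteinFEM.box d L) →
      ∀ N : ℕ, 1 ≤ N →
      ∀ u : ℕ → Ω → MilsteinFEM.Vh (MilsteinFEM.box d L) 𝒯,
        MilsteinFEM.IsDiscreteSolution P ℱ W G DG u₀ q T 𝒯 N u →
        ∀ n ≤ N,
          Integrable (fun ω => ‖MilsteinFEM.grad (u n ω : MilsteinFEM.H10 (MilsteinFEM.box d L))‖ ^ p) P ∧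
          ∫ ω, ‖MilsteinFEM.grad (u n ω : MilsteinFEM.H10 (MilsteinFEM.box d L))‖ ^ p ∂P ≤ C := by
  have hd0 : 0 < d := by omega
  obtain ⟨j, rfl⟩ := hq_odd
  obtain ⟨K, hK, hmom⟩ := MilsteinFEM.exists_energy_moment_bound hd hL hσ hT
    (by omega : 1 ≤ j) (by linarith : 1 ≤ p / 2) hW hG u₀
  set S := 72 * ((4 * σ) ^ d + 1) * 3 ^ d * σ ^ 2 with hS
  have hS0 : 0 ≤ S := by positivity
  have hp0 : 0 < p := by linarith
  have hint : Integrable (fun ω => (1 + S) ^ (p / 2) * (1 + ‖u₀ ω‖) ^ p) P := by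
    exact (MilsteinFEM.integrable_one_add_norm_rpow hp0 hu₀).const_mul _
  refine ⟨Real.exp (K * T) * ∫ ω, (1 + S) ^ (p / 2) * (1 + ‖u₀ ω‖) ^ p ∂P, ?_⟩
  intro 𝒯 h𝒯 hqu hmesh N hN u hu n hn
  obtain ⟨r, hr⟩ := hqu.exists_isShapeRegular hd0 hL hσ h𝒯
  obtain ⟨U, hU, hU0, hae, hgrad⟩ := hu.exists_modification hL hσ hu₀_meas h𝒯 hr
  have hle0 : ∀ ω, (1 + ‖MilsteinFEM.grad (U 0 ω : MilsteinFEM.H10 (MilsteinFEM.box d L))‖ ^ 2)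
      ^ (p / 2) ≤ (1 + S) ^ (p / 2) * (1 + ‖u₀ ω‖) ^ p :=
    fun ω => MilsteinFEM.one_add_sq_rpow_le (norm_nonneg _) hS0 (hgrad ω) hp0.le
  have hcont : Continuous fun v : MilsteinFEM.Vh (MilsteinFEM.box d L) 𝒯 =>
      1 + ‖MilsteinFEM.grad (v : MilsteinFEM.H10 (MilsteinFEM.box d L))‖ ^ 2 := by
    have := MilsteinFEM.continuous_grad (D := MilsteinFEM.box d L)
    fun_prop
  have hint0 : Integrable (fun ω => (1 + ‖MilsteinFEM.grad
      (U 0 ω : MilsteinFEM.H10 (MilsteinFEM.box d L))‖ ^ 2) ^ (p / 2)) P := by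
    refine hint.mono' ?_ (ae_of_all _ fun ω => ?_)
    · exact (((hcont.comp_stronglyMeasurable hU0).mono (ℱ.le 0)).measurable.pow_const
        (p / 2)).aestronglyMeasurable
    · rw [Real.norm_of_nonneg (by positivity)]
      exact hle0 ω
  obtain ⟨hi, hb⟩ := hmom 𝒯 h𝒯 hmesh r hr N hN U hU hU0 hint0 n hn
  have hτ : (n : ℝ) * MilsteinFEM.step T N ≤ T := by
    have hN' : (0 : ℝ) < N := by exact_mod_cast hN
    have e : (MilsteinFEM.step T N : ℝ) = T / N := by simp [MilsteinFEM.step]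
    rw [e, ← mul_div_assoc, div_le_iff₀ hN', mul_comm]
    gcongr
  have hexp : (1 + K * MilsteinFEM.step T N) ^ n ≤ Real.exp (K * T) := by
    calc (1 + K * MilsteinFEM.step T N) ^ n ≤ Real.exp (K * MilsteinFEM.step T N) ^ n := by
          gcongr
          rw [add_comm]
          exact Real.add_one_le_exp _
      _ = Real.exp (K * (n * MilsteinFEM.step T N)) := by rw [← Real.exp_nat_mul]; ring_nf
      _ ≤ Real.exp (K * T) := by gcongr
  have hpow : ∀ᵐ ω ∂P,
      ‖MilsteinFEM.grad (u n ω : MilsteinFEM.H10 (MilsteinFEM.box d L))‖ ^ p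
        ≤ (1 + ‖MilsteinFEM.grad (U n ω : MilsteinFEM.H10 (MilsteinFEM.box d L))‖ ^ 2)
          ^ (p / 2) := by
    filter_upwards [hae n] with ω hω
    rw [hω]
    set a := ‖MilsteinFEM.grad (u n ω : MilsteinFEM.H10 (MilsteinFEM.box d L))‖
    have ha : 0 ≤ a := norm_nonneg _
    rw [← MilsteinFEM.sq_rpow_half ha]
    exact Real.rpow_le_rpow (by positivity) (by linarith) (by positivity)
  have hUmeas : StronglyMeasurable (U n) := by
    rcases Nat.eq_zero_or_pos n with rfl | hn0
    · exact hU0.mono (ℱ.le 0)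
    · exact (hU.adapted n hn0 hn).mono (ℱ.le _)
  have humeas : AEStronglyMeasurable (fun ω =>
      ‖MilsteinFEM.grad (u n ω : MilsteinFEM.H10 (MilsteinFEM.box d L))‖ ^ p) P := by
    have hc : Continuous fun v : MilsteinFEM.Vh (MilsteinFEM.box d L) 𝒯 =>
        ‖MilsteinFEM.grad (v : MilsteinFEM.H10 (MilsteinFEM.box d L))‖ :=
      (MilsteinFEM.continuous_grad.comp continuous_subtype_val).norm
    exact ((hc.comp_aestronglyMeasurable
      (hUmeas.aestronglyMeasurable.congr (hae n))).aemeasurable.pow_const p).aestronglyMeasurable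
  have hiu : Integrable (fun ω =>
      ‖MilsteinFEM.grad (u n ω : MilsteinFEM.H10 (MilsteinFEM.box d L))‖ ^ p) P := by
    refine hi.mono' humeas ?_
    filter_upwards [hpow] with ω hω
    rw [Real.norm_of_nonneg (by positivity)]
    exact hω
  refine ⟨hiu, (integral_mono_ae hiu hi hpow).trans (hb.trans ?_)⟩
  have h0 := integral_mono hint0 hint hle0
  have h0' : 0 ≤ ∫ ω, (1 + ‖MilsteinFEM.grad
      (U 0 ω : MilsteinFEM.H10 (MilsteinFEM.box d L))‖ ^ 2) ^ (p / 2) ∂P :=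
    integral_nonneg fun ω => by positivity
  exact mul_le_mul hexp h0 h0' (Real.exp_nonneg _)
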